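/- **Setting.** Let $f_\varepsilon:\mathbb R^n\times\mathbb R^n\to\mathbb R^n$ be a family of maps depending on a small parameter $\varepsilon\in\mathbb R$, let $r:\mathbb R^n\to\mathbb R$, and write $\mathbb T^d=\mathbb R^d/\mathbb Z^d$. Consider the invariance equation $$(\omega\cdot\partial_\theta K)(\theta)=f_\varepsilon\bigl(K(\theta),\,K(\theta-\varepsilon\,\omega\, r(K(\theta)))\bigr),\qquad \theta\in\mathbb T^d, \tag{1}$$ for quasi-periodic solutions $y(t)=K(\omega t)$ of $\dot y(t)=f_\varepsilon(y(t),y(t-\varepsilon r(y(t))))$. Let $K_0:\mathbb T^d\to\mathbb R^n$ be a $C^\infty$ embedding and $\omega_0\in\mathbb R^d$ with $\omega_0\cdot\partial_\theta K_0=f_0(K_0,K_0)$. Assume that $(\varepsilon,x,y)\mapsto f_\varepsilon(x,y)$ is $C^\infty$ near the points $(0,K_0(\theta),K_0(\theta))$ and that $r$ is $C^\infty$ near the points $K_0(\theta)$, $\theta\in\mathbb T^d$. Put $$A(\theta)=D_1f_0(K_0(\theta),K_0(\theta))+D_2f_0(K_0(\theta),K_0(\theta)).$$ For $\xi>0$ let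 $\mathbb T^d_\xi=\{\theta\in(\mathbb C/\mathbb Z)^d:\ |\mathrm{Im}\,\theta_j|<\xi,\ j=1,\dots,d\}$. A function on $\mathbb T^d$ is *analytic on $\mathbb T^d_\xi$* if it has a holomorphic extension to $\mathbb T^d_\xi$. The linear equation $\dot v=A(\theta+\omega_0t)v$ is *reducible to the constant matrix $\Lambda\in\mathbb C^{n\times n}$* on $\mathbb T^d_\xi$ (resp. in the class $C^\infty$) if there is a map $M:\mathbb T^d_\xi\to GL(n,\mathbb C)$ that is analytic (resp. a map $M:\mathbb T^d\to GL(n,\mathbb C)$ of class $C^\infty$) with $$M^{-1}\bigl[-\omega_0\cdot\partial_\theta M+AM\bigr]=\Lambda\quad\text{on }\mathbb T^d .$$ Let $|k|$ be the $\ell^1$-norm of $k\in\mathbb Z^d$. The vector $\omega_0$ is *Diophantine* if there are $\gamma>0$ and $\tau\in\mathbb R$ with $|\omega_0\cdot k|\ge\gamma|k|^{-\tau}$ for all $k\ne0$, and *subexponentially Diophantine* if $\omega_0\cdot k\ne0$ for all $k\neq0$ and $\lim_{|k|\to\infty}\frac1{|k|}\log\frac1{|\omega_0\cdot k|}=0$.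 A number $\mu\in\mathbb C$ is *Diophantine with respect to $\omega_0$* if there are $\gamma>0$ and $\tau\in\mathbb R$ with $|\mu-2\pi i\,\omega_0\cdot k|\ge\gamma|k|^{-\tau}$ for all $k\neq0$, and *subexponentially Diophantine with respect to $\omega_0$* if $\mu\ne2\pi i\,\omega_0\cdot k$ for all $k\ne0$ and $\lim_{|k|\to\infty}\frac1{|k|}\log|\mu-2\pi i\,\omega_0\cdot k|=0$. A *Lindstedt series solving (1) to all orders* consists of vectors $\omega_j\in\mathbb R^d$ and functions $K_j\in C^\infty(\mathbb T^d,\mathbb R^n)$, $j\ge0$, beginning with the given $\omega_0$, $K_0$, such that for every $N$ there are $C_N$ and $\varepsilon_N>0$ for which the truncations $K_\varepsilon^{[\le N]}=\sum_{j\le N}\varepsilon^jK_j$ and $\omega_\varepsilon^{[\le N]}=\sum_{j\le N}\varepsilon^j\omega_j$ satisfy (1), for $|\varepsilon|\le\varepsilon_N$, up to an error that is bounded by $C_N|\varepsilon|^{N+1}$ for all $\theta\in\mathbb T^d$, and the functions $y(t)=K_\varepsilon^{[\le N]}(\omega_\varepsilon^{[\le N]}t)$ satisfy $$\bigl|\dot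 y(t)-f_\varepsilon(y(t),y(t-\varepsilon r(y(t))))\bigr|\le C_N|\varepsilon|^{N+1}\qquad\text{for all }t\in\mathbb R .$$ **Theorem.** Let $\Lambda\in\mathbb C^{n\times n}$ have exactly $d$ zero eigenvalues, counted with algebraic multiplicity. 1. *(Analytic case.)* Let $\xi>0$. Suppose that $K_0$ is analytic on $\mathbb T^d_\xi$; that every coefficient $\partial_\varepsilon^jf_\varepsilon|_{\varepsilon=0}$, $j\ge0$ (in particular $f_0$), and $r$ are analytic, in the sense that they agree near the points $(K_0(\theta),K_0(\theta))$, respectively $K_0(\theta)$, $\theta\in\mathbb T^d$, with functions that are holomorphic near all the points $(K_0(z),K_0(z))$, respectively $K_0(z)$, $z\in\mathbb T^d_\xi$; that $\dot v=A(\theta+\omega_0t)v$ is reducible to $\Lambda$ on $\mathbb T^d_\xi$; and that $\omega_0$ is subexponentially Diophantine and all nonzero eigenvalues of $\Lambda$ are subexponentially Diophantine with respect to $\omega_0$. Then there is a Lindstedt series solving (1) to all orders whose coefficients $K_j$ are analytic on $\mathbb T^d_{\xi'}$ for all $0<\xi'<\xi$. 2. *($C^\infty$ case.)* Suppose that $\dot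 v=A(\theta+\omega_0t)v$ is reducible to $\Lambda$ in the class $C^\infty$, that $\omega_0$ is Diophantine, and that all nonzero eigenvalues of $\Lambda$ are Diophantine with respect to $\omega_0$. Then there is a Lindstedt series solving (1) to all orders (with coefficients $K_j$ of class $C^\infty$). -/

import Mathlib

open scoped Topology

noncomputable section

namespace DelayTorus

/-! Functions on the torus `ℝᵈ / ℤᵈ` are represented by `ℤᵈ`-periodic functions on `ℝᵈ = Fin d → ℝ`.
The sup norm of `Fin n → ℝ` enters only in estimates up to a multiplicative constant. -/

/-- The inclusion `ℝᵐ ⊆ ℂᵐ`. -/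
def toC {m : ℕ} (x : Fin m → ℝ) : Fin m → ℂ := fun i => (x i : ℂ)

/-- The (lift to `ℂᵈ` of the) complex strip of width `ξ` around the torus. -/
def strip (d : ℕ) (ξ : ℝ) : Set (Fin d → ℂ) := {z | ∀ j, |(z j).im| < ξ}

/-- `ℤᵈ`-periodicity, for functions on `ℝᵈ` or on `ℂᵈ`. -/
def IsZPeriodic {d : ℕ} {R X : Type*} [Ring R] (u : (Fin d → R) → X) : Prop :=
  ∀ (z : Fin d → R) (m : Fin d → ℤ), u (fun j => z j + (m j : R)) = u z

/-- A smooth embedding of the torus `ℝᵈ / ℤᵈ` into `ℝⁿ`: a smooth injective immersion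
(the torus is compact). -/
structure IsTorusEmbedding {d n : ℕ} (K : (Fin d → ℝ) → (Fin n → ℝ)) : Prop where
  periodic : IsZPeriodic K
  smooth : ContDiff ℝ (⊤ : ℕ∞) K
  immersion : ∀ θ, Function.Injective (fderiv ℝ K θ)
  injective : ∀ θ θ', K θ = K θ' → ∃ m : Fin d → ℤ, θ' = fun j => θ j + (m j : ℝ)

/-- `U` is a periodic holomorphic extension of `u` to the strip of width `ξ`. -/
structure IsStripExtension {d n : ℕ} (ξ : ℝ) (u : (Fin d → ℝ) → (Fin n → ℝ))
    (U : (Fin d → ℂ) → (Fin n → ℂ)) : Prop where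
  holomorphic : DifferentiableOn ℂ U (strip d ξ)
  periodic : ∀ z ∈ strip d ξ, ∀ m : Fin d → ℤ, U (fun j => z j + (m j : ℂ)) = U z
  extends_real : ∀ θ, U (toC θ) = toC (u θ)

/-- A function on the torus that is analytic on the strip of width `ξ`. -/
def IsAnalyticOnStrip {d n : ℕ} (ξ : ℝ) (u : (Fin d → ℝ) → (Fin n → ℝ)) : Prop :=
  ∃ U : (Fin d → ℂ) → (Fin n → ℂ), IsStripExtension ξ u U

/-- `ω · k`. -/
def dotZ {d : ℕ} (ω : Fin d → ℝ) (k : Fin d → ℤ) : ℝ := ∑ j, ω j * (k j : ℝ)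

/-- The `ℓ¹` norm of an integer vector. -/
def norm1 {d : ℕ} (k : Fin d → ℤ) : ℝ := ∑ j, |(k j : ℝ)|

/-- The standard Diophantine condition. -/
def IsDiophantine {d : ℕ} (ω : Fin d → ℝ) : Prop :=
  ∃ γ τ : ℝ, 0 < γ ∧ ∀ k : Fin d → ℤ, k ≠ 0 → γ / norm1 k ^ τ ≤ |dotZ ω k|

/-- Subexponentially Diophantine frequency vectors. The first clause says that the logarithms
in the second one are those of positive numbers. -/
def IsSubexpDiophantine {d : ℕ} (ω : Fin d → ℝ) : Prop :=
  (∀ k : Fin d → ℤ, k ≠ 0 → dotZ ω k ≠ 0) ∧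
  Filter.Tendsto (fun k : Fin d → ℤ => 1 / norm1 k * Real.log (1 / |dotZ ω k|))
    Filter.cofinite (𝓝 0)

/-- The small divisor `μ - 2πi (ω · k)`. -/
def divisor {d : ℕ} (ω : Fin d → ℝ) (μ : ℂ) (k : Fin d → ℤ) : ℂ :=
  μ - 2 * (Real.pi : ℂ) * Complex.I * (dotZ ω k : ℂ)

/-- `μ` is Diophantine with respect to `ω`. -/
def IsDiophantineWrt {d : ℕ} (ω : Fin d → ℝ) (μ : ℂ) : Prop :=
  ∃ γ τ : ℝ, 0 < γ ∧ ∀ k : Fin d → ℤ, k ≠ 0 → γ / norm1 k ^ τ ≤ ‖divisor ω μ k‖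

/-- `μ` is subexponentially Diophantine with respect to `ω`. -/
def IsSubexpDiophantineWrt {d : ℕ} (ω : Fin d → ℝ) (μ : ℂ) : Prop :=
  (∀ k : Fin d → ℤ, k ≠ 0 → divisor ω μ k ≠ 0) ∧
  Filter.Tendsto (fun k : Fin d → ℤ => 1 / norm1 k * Real.log ‖divisor ω μ k‖)
    Filter.cofinite (𝓝 0)

/-- The coefficient matrix `D₁f₀(K₀(θ), K₀(θ)) + D₂f₀(K₀(θ), K₀(θ))` of the linearized equation,
as a complex matrix. -/
def linMatrix {d n : ℕ} (f : ℝ → (Fin n → ℝ) → (Fin n → ℝ) → (Fin n → ℝ))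
    (K₀ : (Fin d → ℝ) → (Fin n → ℝ)) (θ : Fin d → ℝ) : Matrix (Fin n) (Fin n) ℂ :=
  (LinearMap.toMatrix'
    (fderiv ℝ (fun x => f 0 x (K₀ θ)) (K₀ θ) +
      fderiv ℝ (fun y => f 0 (K₀ θ) y) (K₀ θ)).toLinearMap).map (fun a : ℝ => (a : ℂ))

/-- `ω · ∂_θ M`, for a matrix valued function `M`. -/
def matDirDeriv {d n : ℕ} (ω : Fin d → ℝ) (M : (Fin d → ℝ) → Matrix (Fin n) (Fin n) ℂ)
    (θ : Fin d → ℝ) : Matrix (Fin n) (Fin n) ℂ :=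
  Matrix.of fun i j => fderiv ℝ (fun θ' => M θ' i j) θ ω

/-- The equation `v' = A(θ + ω t) v` is reduced to the constant matrix `Λ` by a `C^∞` change of
variables `M : ℝᵈ / ℤᵈ → GL(n, ℂ)`. -/
def IsReducibleSmooth {d n : ℕ} (ω : Fin d → ℝ) (A : (Fin d → ℝ) → Matrix (Fin n) (Fin n) ℂ)
    (Λ : Matrix (Fin n) (Fin n) ℂ) : Prop :=
  ∃ M : (Fin d → ℝ) → Matrix.GeneralLinearGroup (Fin n) ℂ,
    IsZPeriodic M ∧
    (∀ i j, ContDiff ℝ (⊤ : ℕ∞) (fun θ => (M θ : Matrix (Fin n) (Fin n) ℂ) i j)) ∧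
    ∀ θ, (M θ : Matrix (Fin n) (Fin n) ℂ)⁻¹ *
      (-matDirDeriv ω (fun θ' => (M θ' : Matrix (Fin n) (Fin n) ℂ)) θ +
        A θ * (M θ : Matrix (Fin n) (Fin n) ℂ)) = Λ

/-- The equation `v' = A(θ + ω t) v` is reduced to the constant matrix `Λ` by a change of
variables that is analytic, with values in `GL(n, ℂ)`, on the strip of width `ξ`. -/
def IsReducibleOnStrip {d n : ℕ} (ξ : ℝ) (ω : Fin d → ℝ)
    (A : (Fin d → ℝ) → Matrix (Fin n) (Fin n) ℂ) (Λ : Matrix (Fin n) (Fin n) ℂ) : Prop :=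
  ∃ M : (Fin d → ℂ) → Matrix.GeneralLinearGroup (Fin n) ℂ,
    (∀ z ∈ strip d ξ, ∀ m : Fin d → ℤ, M (fun j => z j + (m j : ℂ)) = M z) ∧
    (∀ i j, DifferentiableOn ℂ (fun z => (M z : Matrix (Fin n) (Fin n) ℂ) i j) (strip d ξ)) ∧
    ∀ θ, (M (toC θ) : Matrix (Fin n) (Fin n) ℂ)⁻¹ *
      (-matDirDeriv ω (fun θ' => (M (toC θ') : Matrix (Fin n) (Fin n) ℂ)) θ +
        A θ * (M (toC θ) : Matrix (Fin n) (Fin n) ℂ)) = Λ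

/-- `(ε, x, y) ↦ f_ε(x, y)` is `C^∞` near the points `(0, K₀(θ), K₀(θ))`. -/
def IsSmoothFamilyAlong {d n : ℕ} (f : ℝ → (Fin n → ℝ) → (Fin n → ℝ) → (Fin n → ℝ))
    (K₀ : (Fin d → ℝ) → (Fin n → ℝ)) : Prop :=
  ∀ θ, ContDiffAt ℝ (⊤ : ℕ∞) (fun p : ℝ × (Fin n → ℝ) × (Fin n → ℝ) => f p.1 p.2.1 p.2.2)
    (0, K₀ θ, K₀ θ)

/-- Every coefficient `∂_ε^j f_ε|_{ε = 0}` (in particular `f₀`) of the expansion of `f_ε` in powers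
of `ε` is analytic: near the points `(K₀(θ), K₀(θ))` it is the restriction of a function that is
holomorphic near all the points `(K₀(z), K₀(z))` with `z` in the strip of width `ξ`. Here `K₀C` is
the extension of `K₀` to the strip. -/
def IsAnalyticFamilyAlong {d n : ℕ} (ξ : ℝ)
    (f : ℝ → (Fin n → ℝ) → (Fin n → ℝ) → (Fin n → ℝ))
    (K₀ : (Fin d → ℝ) → (Fin n → ℝ)) (K₀C : (Fin d → ℂ) → (Fin n → ℂ)) : Prop :=
  ∀ j : ℕ, ∃ F : (Fin n → ℂ) × (Fin n → ℂ) → (Fin n → ℂ),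
    AnalyticOnNhd ℂ F ((fun z => (K₀C z, K₀C z)) '' strip d ξ) ∧
    ∀ θ, ∀ᶠ p : (Fin n → ℝ) × (Fin n → ℝ) in 𝓝 (K₀ θ, K₀ θ),
      F (toC p.1, toC p.2) = toC (iteratedDeriv j (fun ε => f ε p.1 p.2) 0)

/-- The delay is analytic near the image under `K₀` of the strip of width `ξ`, in the same
sense. -/
def IsAnalyticDelayAlong {d n : ℕ} (ξ : ℝ) (r : (Fin n → ℝ) → ℝ)
    (K₀ : (Fin d → ℝ) → (Fin n → ℝ)) (K₀C : (Fin d → ℂ) → (Fin n → ℂ)) : Prop :=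
  ∃ F : (Fin n → ℂ) → ℂ,
    AnalyticOnNhd ℂ F (K₀C '' strip d ξ) ∧
    ∀ θ, ∀ᶠ x : Fin n → ℝ in 𝓝 (K₀ θ), F (toC x) = (r x : ℂ)

/-- The truncations `K_ε^{[≤ N]}`. -/
def truncK {d n : ℕ} (K : ℕ → (Fin d → ℝ) → (Fin n → ℝ)) (N : ℕ) (ε : ℝ) (θ : Fin d → ℝ) :
    Fin n → ℝ :=
  ∑ j ∈ Finset.range (N + 1), ε ^ j • K j θ

/-- The truncations `ω_ε^{[≤ N]}`. -/
def truncω {d : ℕ} (ω : ℕ → Fin d → ℝ) (N : ℕ) (ε : ℝ) : Fin d → ℝ :=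
  ∑ j ∈ Finset.range (N + 1), ε ^ j • ω j

/-- The approximate solutions `y_ε^{[≤ N]}(t) = K_ε^{[≤ N]}(ω_ε^{[≤ N]} t)`. -/
def truncY {d n : ℕ} (ω : ℕ → Fin d → ℝ) (K : ℕ → (Fin d → ℝ) → (Fin n → ℝ)) (N : ℕ) (ε : ℝ)
    (t : ℝ) : Fin n → ℝ :=
  truncK K N ε (t • truncω ω N ε)

/-- The formal series `∑ ε^j K_j`, `∑ ε^j ω_j` solve
`(ω · ∂_θ K)(θ) = f_ε(K(θ), K(θ - ε ω r(K(θ))))` to all orders in `ε`: the truncations at order `N`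
solve the invariance equation up to an error `O(ε^{N+1})`, uniformly on the torus, and the functions
`y_ε^{[≤ N]}` solve the delay equation up to such an error, uniformly in time. -/
def SolvesToAllOrders {d n : ℕ} (f : ℝ → (Fin n → ℝ) → (Fin n → ℝ) → (Fin n → ℝ))
    (r : (Fin n → ℝ) → ℝ) (ω : ℕ → Fin d → ℝ) (K : ℕ → (Fin d → ℝ) → (Fin n → ℝ)) : Prop :=
  ∀ N : ℕ, ∃ C ε₀ : ℝ, 0 < ε₀ ∧ ∀ ε : ℝ, |ε| ≤ ε₀ →
    (∀ θ : Fin d → ℝ,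
      ‖fderiv ℝ (truncK K N ε) θ (truncω ω N ε) -
        f ε (truncK K N ε θ)
          (truncK K N ε (θ - (ε * r (truncK K N ε θ)) • truncω ω N ε))‖ ≤ C * |ε| ^ (N + 1)) ∧
    (∀ t : ℝ,
      ‖deriv (truncY ω K N ε) t -
        f ε (truncY ω K N ε t)
          (truncY ω K N ε (t - ε * r (truncY ω K N ε t)))‖ ≤ C * |ε| ^ (N + 1))

/-- A Lindstedt series based on `(K₀, ω₀)` that solves the invariance equation to all orders, with
coefficients `K_j` that are functions on the torus of class `C^∞`. -/
structure IsLindstedtSeries {d n : ℕ} (f : ℝ → (Fin n → ℝ) → (Fin n → ℝ) → (Fin n → ℝ))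
    (r : (Fin n → ℝ) → ℝ) (ω₀ : Fin d → ℝ) (K₀ : (Fin d → ℝ) → (Fin n → ℝ))
    (ω : ℕ → Fin d → ℝ) (K : ℕ → (Fin d → ℝ) → (Fin n → ℝ)) : Prop where
  freq_zero : ω 0 = ω₀
  emb_zero : K 0 = K₀
  periodic : ∀ j, IsZPeriodic (K j)
  smooth : ∀ j, ContDiff ℝ (⊤ : ℕ∞) (K j)
  solves : SolvesToAllOrders f r ω K

end DelayTorus

end

/-! Suppose that the truncations at order N solve (1) up to o(ε^N). A further term (w, u) changes
the coefficient of ε^{N+1} in the defect by ω₀·∂u + DK₀ w − A u: the delay carries a factor ε, so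
the shift of the delayed argument caused by the new term is of higher order and the linearized
operator contains no delay (`resid_succ_sub_isLittleO`). Each order thus asks for a solution of
ω₀·∂u + DK₀ w − A u = −R with known R, and `exists_lindstedt` carries out the recursion in any class
of functions in which this is possible.

With u = M v the equation becomes ω₀·∂v − Λ v = g, where g = −M⁻¹R − M⁻¹DK₀ w. At a Fourier index k
≠ 0 one inverts 2πi ω₀·k − Λ: its determinant is a product of small divisors and its adjugate grows
polynomially in k, so the arithmetic conditions bound the inverse (`exists_coeff_solution`).
Polynomial factors preserve rapid decay, and subexponential factors preserve exponential decay at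
every rate below 2πξ; hence no smoothness and no strip width is lost from one order to the next.

At k = 0 one needs −Λ v₀ = avg g. The columns of DK₀ solve the variational equation, so those of
M⁻¹DK₀ solve ω₀·∂p = Λ p; without resonances they are constant and form a matrix P of rank d with ΛP
= 0 (`exists_const_frame`). Since 0 has algebraic multiplicity d, the range of P is the whole
generalized eigenspace; it therefore equals the kernel of Λ and is complementary to the range of Λ
(`exists_neg_mulVec_eq`). The choice of w moves the average into the range. As A is real, the real
parts of u and w solve the real equation.

Two points remain. Pointwise formal estimates become uniform because the defect is jointly smooth in
(ε, θ) and the torus is compact (`solvesToAllOrders_of_resid`). And R is analytic although f is only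
smooth in ε: R depends on finitely many ε-coefficients of f, so f may be replaced by a holomorphic
Taylor polynomial (`isAnalyticOnStrip_taylorCoeff_resid`). -/

noncomputable section
namespace DelayTorus
open Asymptotics Filter

/-! ### Taylor expansion in ε with a parameter, over ℝ and ℂ alike. -/

section Taylor

variable {𝕜 V W : Type*} [RCLike 𝕜] [NormedAddCommGroup V] [NormedSpace 𝕜 V]
  [NormedAddCommGroup W] [NormedSpace 𝕜 W]

/-- The Taylor coefficients at `ε = 0` of a function of `(ε, z)`. -/
def taylorCoeff (H : 𝕜 × V → W) (i : ℕ) (z : V) : W :=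
  ((i.factorial : 𝕜)⁻¹) • iteratedDeriv i (fun ε => H (ε, z)) 0

lemma hasDerivAt_slice {H : 𝕜 × V → W} {p : 𝕜 × V} (h : DifferentiableAt 𝕜 H p) :
    HasDerivAt (fun ε => H (ε, p.2)) (fderiv 𝕜 H p (1, 0)) p.1 := by
  have h1 : HasFDerivAt H (fderiv 𝕜 H p) (p.1, p.2) := h.hasFDerivAt
  have h2 : HasDerivAt (fun ε : 𝕜 => (ε, p.2)) ((1 : 𝕜), (0 : V)) p.1 :=
    (hasDerivAt_id p.1).prodMk (hasDerivAt_const p.1 p.2)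
  exact h1.comp_hasDerivAt p.1 h2

/-- The derivative is taken at the moving point `q.1`, so that the result is again a function of (ε,
z) and the statement can be iterated. -/
lemma contDiffAt_deriv_slice {H : 𝕜 × V → W} {p : 𝕜 × V}
    (h : ContDiffAt 𝕜 (⊤ : ℕ∞) H p) :
    ContDiffAt 𝕜 (⊤ : ℕ∞) (fun q : 𝕜 × V => deriv (fun ε => H (ε, q.2)) q.1) p := by
  have h1 : ContDiffAt 𝕜 (⊤ : ℕ∞) (fun q => fderiv 𝕜 H q (1, 0)) p :=
    (h.fderiv_right (m := ((⊤ : ℕ∞) : WithTop ℕ∞)) (by simp)).clm_apply contDiffAt_const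
  refine h1.congr_of_eventuallyEq ?_
  have h2 : ∀ᶠ q in 𝓝 p, ContDiffAt 𝕜 1 H q :=
    (h.of_le (by exact_mod_cast le_top)).eventually (by simp)
  filter_upwards [h2] with q hq
  exact (hasDerivAt_slice (hq.differentiableAt (by simp))).deriv

lemma contDiffAt_iteratedDeriv_slice (i : ℕ) {H : 𝕜 × V → W} {p : 𝕜 × V}
    (h : ContDiffAt 𝕜 (⊤ : ℕ∞) H p) :
    ContDiffAt 𝕜 (⊤ : ℕ∞) (fun q : 𝕜 × V => iteratedDeriv i (fun ε => H (ε, q.2)) q.1) p := by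
  induction i generalizing H with
  | zero => simpa using h
  | succ i ih =>
    simp only [iteratedDeriv_succ']
    exact ih (contDiffAt_deriv_slice h)

lemma contDiffAt_taylorCoeff (i : ℕ) {H : 𝕜 × V → W} {z : V}
    (h : ContDiffAt 𝕜 (⊤ : ℕ∞) H (0, z)) :
    ContDiffAt 𝕜 (⊤ : ℕ∞) (taylorCoeff H i) z := by
  have h1 : ContDiffAt 𝕜 (⊤ : ℕ∞) (fun z : V => ((0 : 𝕜), z)) z :=
    contDiffAt_const.prodMk contDiffAt_id
  exact (ContDiffAt.comp z (contDiffAt_iteratedDeriv_slice i h) h1).const_smul _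

/-- Taylor's formula in `ε`, locally uniformly in `z`. -/
lemma taylor_isBigO (m : ℕ) {H : 𝕜 × V → W} {z₀ : V}
    (h : ContDiffAt 𝕜 (⊤ : ℕ∞) H (0, z₀)) :
    (fun p : 𝕜 × V => H p - ∑ i ∈ Finset.range m, p.1 ^ i • taylorCoeff H i p.2)
      =O[𝓝 (0, z₀)] fun p => p.1 ^ m := by
  induction m generalizing H with
  | zero =>
    simp only [Finset.range_zero, Finset.sum_empty, sub_zero, pow_zero]
    exact h.continuousAt.isBigO_one 𝕜
  | succ m ih =>
    -- The ε-derivative of the remainder of order m + 1 is the remainder of order m of ∂_ε H; the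
    -- mean value inequality on the ball of radius ‖ε‖ then yields one more power.
    obtain ⟨C, hC0, hC⟩ := (ih (contDiffAt_deriv_slice h)).exists_nonneg
    have h2 : ∀ᶠ q in 𝓝 ((0 : 𝕜), z₀), ContDiffAt 𝕜 1 H q :=
      (h.of_le (by exact_mod_cast le_top)).eventually (by simp)
    obtain ⟨r, hr, hball⟩ := Metric.eventually_nhds_iff_ball.1 (hC.bound.and h2)
    refine IsBigO.of_bound C ?_
    filter_upwards [Metric.ball_mem_nhds _ hr] with p hp
    set G : 𝕜 → W := fun ε =>
      H (ε, p.2) - ∑ i ∈ Finset.range (m + 1), ε ^ i • taylorCoeff H i p.2 with hG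
    have hmem : ∀ ε ∈ Metric.closedBall (0 : 𝕜) ‖p.1‖, (ε, p.2) ∈ Metric.ball ((0 : 𝕜), z₀) r := by
      intro ε hε
      rw [Metric.mem_ball, Prod.dist_eq, max_lt_iff] at hp ⊢
      simp only [dist_zero_right] at hp ⊢
      exact ⟨lt_of_le_of_lt (by simpa using hε) hp.1, hp.2⟩
    have hder : ∀ ε ∈ Metric.closedBall (0 : 𝕜) ‖p.1‖, HasDerivAt G
        (deriv (fun ε => H (ε, p.2)) ε - ∑ i ∈ Finset.range m, ε ^ i •
          taylorCoeff (fun q : 𝕜 × V => deriv (fun ε => H (ε, q.2)) q.1) i p.2) ε := by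
      intro ε hε
      have h3 := hasDerivAt_slice ((hball _ (hmem ε hε)).2.differentiableAt (by simp))
      have h4 : HasDerivAt (fun ε : 𝕜 => ∑ i ∈ Finset.range (m + 1), ε ^ i • taylorCoeff H i p.2)
          (∑ i ∈ Finset.range (m + 1), ((i : 𝕜) * ε ^ (i - 1)) • taylorCoeff H i p.2) ε := by
        refine HasDerivAt.fun_sum fun i _ => ?_
        exact (hasDerivAt_pow i ε).smul_const (taylorCoeff H i p.2)
      have h5 := h3.differentiableAt.hasDerivAt.sub h4
      refine h5.congr_deriv ?_
      congr 1
      rw [Finset.sum_range_succ']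
      simp only [Nat.cast_zero, zero_mul, zero_smul, add_zero]
      refine Finset.sum_congr rfl fun i _ => ?_
      simp only [taylorCoeff, iteratedDeriv_succ', smul_smul, Nat.factorial_succ]
      congr 1
      have : ((i : 𝕜) + 1) ≠ 0 := by exact_mod_cast Nat.succ_ne_zero i
      push_cast
      field_simp
    have hbd : ∀ ε ∈ Metric.closedBall (0 : 𝕜) ‖p.1‖,
        ‖deriv (fun ε => H (ε, p.2)) ε - ∑ i ∈ Finset.range m, ε ^ i •
          taylorCoeff (fun q : 𝕜 × V => deriv (fun ε => H (ε, q.2)) q.1) i p.2‖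
          ≤ C * ‖p.1‖ ^ m := by
      intro ε hε
      refine (hball _ (hmem ε hε)).1.trans ?_
      rw [norm_pow]
      have : ‖ε‖ ≤ ‖p.1‖ := by simpa using hε
      gcongr
    have hmv := (convex_closedBall (0 : 𝕜) ‖p.1‖).norm_image_sub_le_of_norm_hasDerivWithin_le
      (fun ε hε => (hder ε hε).hasDerivWithinAt) hbd (x := 0) (y := p.1) (by simp) (by simp)
    have hG0 : G 0 = 0 := by
      simp only [hG]
      rw [Finset.sum_range_succ']
      simp [taylorCoeff]
    rw [hG0, sub_zero, sub_zero] at hmv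
    calc _ = ‖G p.1‖ := by simp [hG]
      _ ≤ _ := hmv
      _ = _ := by rw [norm_pow, pow_succ, mul_assoc]

end Taylor

/-- Uniqueness of asymptotic expansions in powers of `ε`. -/
lemma coeff_eq_zero_of_isLittleO {W : Type*} [NormedAddCommGroup W] [NormedSpace ℝ W]
    (a : ℕ → W) (m : ℕ)
    (h : (fun ε : ℝ => ∑ i ∈ Finset.range (m + 1), ε ^ i • a i) =o[𝓝 0] fun ε => ε ^ m) :
    ∀ i ≤ m, a i = 0 := by
  -- For a single term, division by ε^m away from 0 shows that a constant is o(1).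
  have key : ∀ (m : ℕ) (b : W), (fun ε : ℝ => ε ^ m • b) =o[𝓝 0] (fun ε => ε ^ m) → b = 0 := by
    intro m b hb
    have h1 : (fun ε : ℝ => ε ^ m • b) =o[𝓝[≠] 0] (fun ε => ε ^ m) := hb.mono nhdsWithin_le_nhds
    have h2 : (fun _ : ℝ => b) =o[𝓝[≠] 0] (fun _ => (1 : ℝ)) := by
      rw [isLittleO_iff] at h1 ⊢
      intro c hc
      filter_upwards [h1 hc, self_mem_nhdsWithin] with ε hε hne
      have hpos : 0 < ‖ε ^ m‖ := norm_pos_iff.2 (pow_ne_zero _ hne)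
      rw [norm_smul, mul_comm] at hε
      simpa using le_of_mul_le_mul_right hε hpos
    simpa using (isLittleO_const_const_iff.1 h2)
  induction m with
  | zero =>
    intro i hi
    obtain rfl : i = 0 := by omega
    exact key 0 _ (by simpa using h)
  | succ m ih =>
    have hlow : ∀ i ≤ m, a i = 0 := by
      refine ih ?_
      have h1 : (fun ε : ℝ => ε ^ (m + 1)) =o[𝓝 0] (fun ε : ℝ => ε ^ m) :=
        isLittleO_pow_pow (Nat.lt_succ_self m)
      have h2 : (fun ε : ℝ => ε ^ (m + 1) • a (m + 1)) =O[𝓝 0] (fun ε : ℝ => ε ^ (m + 1)) := by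
        refine IsBigO.of_bound ‖a (m + 1)‖ (Eventually.of_forall fun ε => ?_)
        rw [norm_smul, mul_comm]
      refine ((h.trans h1).sub (h2.trans_isLittleO h1)).congr_left fun ε => ?_
      rw [Finset.sum_range_succ _ (m + 1)]
      simp
    intro i hi
    rcases Nat.lt_or_ge i (m + 1) with hlt | hge
    · exact hlow i (by omega)
    · obtain rfl : i = m + 1 := by omega
      refine key (m + 1) _ (h.congr_left fun ε => ?_)
      rw [Finset.sum_range_succ, Finset.sum_eq_zero, zero_add]
      intro i hi
      rw [hlow i (by simpa [Nat.lt_succ_iff] using hi), smul_zero]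

end DelayTorus
end

noncomputable section
namespace DelayTorus
open Asymptotics Filter

/-! ### The defect of the truncations and its dependence on the last term. -/

section Residual

variable {𝕜 E X : Type*} [RCLike 𝕜] [NormedAddCommGroup E] [NormedSpace 𝕜 E]
  [NormedAddCommGroup X] [NormedSpace 𝕜 X]

/-- The truncation at order `N` of the formal power series `∑ ε^j a_j`. -/
def partialSum (a : ℕ → X) (N : ℕ) (ε : 𝕜) : X := ∑ j ∈ Finset.range (N + 1), ε ^ j • a j

/-- The truncation at order `N` of a formal power series of functions. -/
def partialSumFun (K : ℕ → E → X) (N : ℕ) (p : 𝕜 × E) : X :=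
  ∑ j ∈ Finset.range (N + 1), p.1 ^ j • K j p.2

/-- The defect of the truncations in the invariance equation. -/
def resid (f : 𝕜 → X → X → X) (r : X → 𝕜) (ω : ℕ → E) (K : ℕ → E → X) (N : ℕ) (p : 𝕜 × E) : X :=
  fderiv 𝕜 (fun θ => partialSumFun K N (p.1, θ)) p.2 (partialSum ω N p.1) -
    f p.1 (partialSumFun K N p)
      (partialSumFun K N
        (p.1, p.2 - (p.1 * r (partialSumFun K N p)) • partialSum ω N p.1))

lemma partialSum_zero (a : ℕ → X) (N : ℕ) : partialSum a N (0 : 𝕜) = a 0 := by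
  rw [partialSum, Finset.sum_range_succ']
  simp

omit [NormedAddCommGroup E] [NormedSpace 𝕜 E] in
lemma partialSumFun_zero (K : ℕ → E → X) (N : ℕ) (z : E) :
    partialSumFun K N ((0 : 𝕜), z) = K 0 z := by
  rw [partialSumFun, Finset.sum_range_succ']
  simp

lemma contDiffAt_partialSum (a : ℕ → X) (N : ℕ) {m : WithTop ℕ∞} (ε : 𝕜) :
    ContDiffAt 𝕜 m (partialSum a N) ε := by
  unfold partialSum
  fun_prop

lemma contDiffAt_partialSumFun {K : ℕ → E → X} (N : ℕ) {m : WithTop ℕ∞} {p : 𝕜 × E}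
    (hK : ∀ j, ContDiffAt 𝕜 m (K j) p.2) : ContDiffAt 𝕜 m (partialSumFun K N) p := by
  unfold partialSumFun
  refine ContDiffAt.sum fun j _ => ContDiffAt.smul (by fun_prop) ?_
  exact ContDiffAt.comp p (hK j) contDiffAt_snd

lemma fderiv_partialSumFun {K : ℕ → E → X} (N : ℕ) (ε : 𝕜) {z : E}
    (hK : ∀ j ∈ Finset.range (N + 1), DifferentiableAt 𝕜 (K j) z) :
    fderiv 𝕜 (fun θ => partialSumFun K N (ε, θ)) z = partialSum (fun j => fderiv 𝕜 (K j) z) N ε := by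
  simp only [partialSumFun, partialSum]
  rw [fderiv_fun_sum fun j hj => (hK j hj).fun_const_smul _]
  exact Finset.sum_congr rfl fun j hj => fderiv_fun_const_smul (hK j hj) _

/-- At ε = 0 the delay vanishes, so the delayed argument is z itself and regularity at the points
over z suffices. The field is general because the lemma serves both the real defect and its
complexification. -/
lemma contDiffAt_resid {f : 𝕜 → X → X → X} {r : X → 𝕜} {ω : ℕ → E} {K : ℕ → E → X} (N : ℕ) {z : E}
    (hK : ∀ j, ContDiffAt 𝕜 (⊤ : ℕ∞) (K j) z)
    (hf : ContDiffAt 𝕜 (⊤ : ℕ∞) (fun p : 𝕜 × X × X => f p.1 p.2.1 p.2.2) (0, K 0 z, K 0 z))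
    (hr : ContDiffAt 𝕜 (⊤ : ℕ∞) r (K 0 z)) :
    ContDiffAt 𝕜 (⊤ : ℕ∞) (resid f r ω K N) (0, z) := by
  have hω : ContDiffAt 𝕜 (⊤ : ℕ∞) (fun p : 𝕜 × E => partialSum ω N p.1) (0, z) :=
    ContDiffAt.comp (g := partialSum ω N) _ (contDiffAt_partialSum ω N _) contDiffAt_fst
  have hKs : ContDiffAt 𝕜 (⊤ : ℕ∞) (partialSumFun K N) ((0 : 𝕜), z) :=
    contDiffAt_partialSumFun N hK
  have hD : ContDiffAt 𝕜 (⊤ : ℕ∞)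
      (fun p : 𝕜 × E => fderiv 𝕜 (fun θ => partialSumFun K N (p.1, θ)) p.2) (0, z) := by
    have h1 : ContDiffAt 𝕜 (⊤ : ℕ∞) (partialSumFun (fun j => fderiv 𝕜 (K j)) N) ((0 : 𝕜), z) :=
      contDiffAt_partialSumFun N fun j => (hK j).fderiv_right (by simp)
    refine h1.congr_of_eventuallyEq ?_
    have h2 : ∀ᶠ x in 𝓝 z, ∀ j ∈ Finset.range (N + 1), ContDiffAt 𝕜 1 (K j) x := by
      rw [Finset.eventually_all]
      exact fun j _ => ((hK j).of_le (by exact_mod_cast le_top)).eventually (by simp)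
    filter_upwards [continuousAt_snd.eventually h2] with p hp
    exact fderiv_partialSumFun N p.1 fun j hj => (hp j hj).differentiableAt (by simp)
  have hrK : ContDiffAt 𝕜 (⊤ : ℕ∞) (fun p => r (partialSumFun K N p)) ((0 : 𝕜), z) :=
    ContDiffAt.comp _ (by rwa [partialSumFun_zero]) hKs
  have hs : ContDiffAt 𝕜 (⊤ : ℕ∞) (fun p : 𝕜 × E =>
      (p.1, p.2 - (p.1 * r (partialSumFun K N p)) • partialSum ω N p.1)) ((0 : 𝕜), z) :=
    contDiffAt_fst.prodMk (contDiffAt_snd.sub ((contDiffAt_fst.mul hrK).smul hω))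
  have hb : ContDiffAt 𝕜 (⊤ : ℕ∞) (fun p : 𝕜 × E => partialSumFun K N
      (p.1, p.2 - (p.1 * r (partialSumFun K N p)) • partialSum ω N p.1)) ((0 : 𝕜), z) :=
    ContDiffAt.comp (g := partialSumFun K N) _ (contDiffAt_partialSumFun N (by simpa using hK)) hs
  refine (hD.clm_apply hω).sub ?_
  refine ContDiffAt.comp ((0 : 𝕜), z) (g := fun p : 𝕜 × X × X => f p.1 p.2.1 p.2.2)
    (f := fun p : 𝕜 × E => (p.1, partialSumFun K N p, partialSumFun K N
      (p.1, p.2 - (p.1 * r (partialSumFun K N p)) • partialSum ω N p.1))) ?_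
    (contDiffAt_fst.prodMk (hKs.prodMk hb))
  simpa [partialSumFun_zero] using hf

/-- In the recursion this says that the choice of the term of order N + 1 does not disturb the
defect at order N. -/
lemma resid_congr {f : 𝕜 → X → X → X} {r : X → 𝕜} {ω ω' : ℕ → E} {K K' : ℕ → E → X} {N : ℕ}
    (hω : ∀ j ≤ N, ω j = ω' j) (hK : ∀ j ≤ N, K j = K' j) :
    resid f r ω K N = resid f r ω' K' N := by
  have h1 : ∀ ε : 𝕜, partialSum ω N ε = partialSum ω' N ε := fun ε =>
    Finset.sum_congr rfl fun j hj => by rw [hω j (Nat.lt_succ_iff.1 (Finset.mem_range.1 hj))]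
  have h2 : (partialSumFun K N : 𝕜 × E → X) = partialSumFun K' N := by
    funext p
    exact Finset.sum_congr rfl fun j hj => by rw [hK j (Nat.lt_succ_iff.1 (Finset.mem_range.1 hj))]
  funext p
  simp only [resid, h1, h2]

end Residual

section Linearization

variable {E X : Type*} [NormedAddCommGroup E] [NormedSpace ℝ E]
  [NormedAddCommGroup X] [NormedSpace ℝ X]

/-- The effect on the defect of a new term in the expansion. -/
lemma resid_succ_sub_isLittleO {f : ℝ → X → X → X} {r : X → ℝ} {ω : ℕ → E} {K : ℕ → E → X} (N : ℕ)
    {θ : E} (hK : ∀ j, ContDiffAt ℝ (⊤ : ℕ∞) (K j) θ)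
    (hf : ContDiffAt ℝ (⊤ : ℕ∞) (fun p : ℝ × X × X => f p.1 p.2.1 p.2.2) (0, K 0 θ, K 0 θ))
    (hr : ContDiffAt ℝ (⊤ : ℕ∞) r (K 0 θ)) :
    (fun ε : ℝ => resid f r ω K (N + 1) (ε, θ) - resid f r ω K N (ε, θ) - ε ^ (N + 1) •
      (fderiv ℝ (K (N + 1)) θ (ω 0) + fderiv ℝ (K 0) θ (ω (N + 1)) -
        fderiv ℝ (fun p : ℝ × X × X => f p.1 p.2.1 p.2.2) (0, K 0 θ, K 0 θ)
          (0, K (N + 1) θ, K (N + 1) θ))) =o[𝓝 0] fun ε => ε ^ (N + 1) := by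
  set Ω : ℝ → E := partialSum ω N with hΩ
  set Ω' : ℝ → E := partialSum ω (N + 1) with hΩ'
  set a : ℝ → X := fun ε => partialSumFun K N (ε, θ) with ha
  set a' : ℝ → X := fun ε => partialSumFun K (N + 1) (ε, θ) with ha'
  set s : ℝ → E := fun ε => θ - (ε * r (a ε)) • Ω ε with hs
  set s' : ℝ → E := fun ε => θ - (ε * r (a' ε)) • Ω' ε with hs'
  set b : ℝ → X := fun ε => partialSumFun K N (ε, s ε) with hb
  set b' : ℝ → X := fun ε => partialSumFun K (N + 1) (ε, s' ε) with hb'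
  have hΩΩ : ∀ ε, Ω' ε - Ω ε = ε ^ (N + 1) • ω (N + 1) := fun ε => by
    simp only [hΩ, hΩ', partialSum]; rw [Finset.sum_range_succ _ (N + 1)]; abel
  have haa : ∀ ε, a' ε - a ε = ε ^ (N + 1) • K (N + 1) θ := fun ε => by
    simp only [ha, ha', partialSumFun]; rw [Finset.sum_range_succ _ (N + 1)]; abel
  have hbb : ∀ ε, b' ε - b ε = (partialSumFun K N (ε, s' ε) - partialSumFun K N (ε, s ε)) +
      ε ^ (N + 1) • K (N + 1) (s' ε) := fun ε => by
    simp only [hb, hb', partialSumFun]; rw [Finset.sum_range_succ _ (N + 1)]; abel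
  have hΩc : ∀ M, ContinuousAt (partialSum ω M : ℝ → E) 0 := fun M =>
    (contDiffAt_partialSum ω M (m := 1) 0).continuousAt
  have hpair : ContinuousAt (fun ε : ℝ => (ε, θ)) 0 := by fun_prop
  have hKj : ∀ M, ContDiffAt ℝ (⊤ : ℕ∞) (partialSumFun K M) ((0 : ℝ), θ) := fun M =>
    contDiffAt_partialSumFun M hK
  have hac : ∀ M, ContinuousAt (fun ε : ℝ => partialSumFun K M (ε, θ)) 0 := fun M =>
    ContinuousAt.comp (f := fun ε : ℝ => (ε, θ)) (hKj M).continuousAt hpair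
  have hrc : ∀ M, ContinuousAt (fun ε : ℝ => r (partialSumFun K M (ε, θ))) 0 := fun M =>
    ContinuousAt.comp (f := fun ε : ℝ => partialSumFun K M (ε, θ))
      (by simpa [partialSumFun_zero] using hr.continuousAt) (hac M)
  have hsc : ∀ M, ContinuousAt
      (fun ε : ℝ => θ - (ε * r (partialSumFun K M (ε, θ))) • partialSum ω M ε) 0 := fun M =>
    continuousAt_const.sub ((continuousAt_id.mul (hrc M)).smul (hΩc M))
  have hs0 : s 0 = θ := by simp [hs]
  have hs0' : s' 0 = θ := by simp [hs']
  have hst : Tendsto s (𝓝 0) (𝓝 θ) := by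
    have h := (hsc N).tendsto; simpa using h
  have hst' : Tendsto s' (𝓝 0) (𝓝 θ) := by
    have h := (hsc (N + 1)).tendsto; simpa using h
  have hat : Tendsto a (𝓝 0) (𝓝 (K 0 θ)) := by
    have h := (hac N).tendsto; simpa [partialSumFun_zero] using h
  have hat' : Tendsto a' (𝓝 0) (𝓝 (K 0 θ)) := by
    have h := (hac (N + 1)).tendsto; simpa [partialSumFun_zero] using h
  have hΩt : Tendsto Ω (𝓝 0) (𝓝 (ω 0)) := by
    have h := (hΩc N).tendsto; rwa [partialSum_zero] at h
  have hΩt' : Tendsto Ω' (𝓝 0) (𝓝 (ω 0)) := by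
    have h := (hΩc (N + 1)).tendsto; rwa [partialSum_zero] at h
  have hbt : ∀ M (σ : ℝ → E), Tendsto σ (𝓝 0) (𝓝 θ) →
      Tendsto (fun ε => partialSumFun K M (ε, σ ε)) (𝓝 0) (𝓝 (K 0 θ)) := fun M σ hσ => by
    have h := (hKj M).continuousAt.tendsto.comp (tendsto_id.prodMk_nhds hσ)
    simpa [partialSumFun_zero, Function.comp_def] using h
  have hpow : ∀ v : X, (fun ε : ℝ => ε ^ (N + 1) • v) =O[𝓝 0] fun ε => ε ^ (N + 1) := fun v =>
    IsBigO.of_bound ‖v‖ (Eventually.of_forall fun ε => by rw [norm_smul, mul_comm])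
  have hpowE : ∀ v : E, (fun ε : ℝ => ε ^ (N + 1) • v) =O[𝓝 0] fun ε => ε ^ (N + 1) := fun v =>
    IsBigO.of_bound ‖v‖ (Eventually.of_forall fun ε => by rw [norm_smul, mul_comm])
  have hpow_o : ∀ v : ℝ → X, Tendsto v (𝓝 0) (𝓝 0) →
      (fun ε : ℝ => ε ^ (N + 1) • v ε) =o[𝓝 0] fun ε => ε ^ (N + 1) := fun v hv => by
    have h := (isBigO_refl (fun ε : ℝ => ε ^ (N + 1)) (𝓝 0)).smul_isLittleO
      ((isLittleO_one_iff ℝ).2 hv)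
    simpa using h
  -- the change of the delayed argument
  have hss : (fun ε => s' ε - s ε) =o[𝓝 0] fun ε => ε ^ (N + 1) := by
    -- Strict differentiability is what compares two points that both move with ε.
    have hψ : HasStrictFDerivAt (fun q : X × E => r q.1 • q.2)
        (fderiv ℝ (fun q : X × E => r q.1 • q.2) (K 0 θ, ω 0)) (K 0 θ, ω 0) := by
      have : ContDiffAt ℝ (⊤ : ℕ∞) (fun q : X × E => r q.1 • q.2) (K 0 θ, ω 0) :=
        (ContDiffAt.comp (K 0 θ, ω 0) hr contDiffAt_fst).smul contDiffAt_snd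
      exact this.hasStrictFDerivAt (by simp)
    have h1 := hψ.isBigO_sub.comp_tendsto
      ((hat.prodMk_nhds hΩt).prodMk_nhds (hat'.prodMk_nhds hΩt'))
    have h2 : (fun ε => r (a ε) • Ω ε - r (a' ε) • Ω' ε) =O[𝓝 0] fun ε => ε ^ (N + 1) := by
      refine h1.trans ?_
      refine IsBigO.prod_left ?_ ?_
      · refine (hpow (-K (N + 1) θ)).congr_left fun ε => ?_
        simp [smul_neg, ← haa]
      · refine (hpowE (-ω (N + 1))).congr_left fun ε => ?_
        simp [smul_neg, ← hΩΩ]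
    -- The prefactor ε of the delay turns O into o; for this reason no shifted argument survives in
    -- the linearized equation.
    have h3 := ((isLittleO_one_iff ℝ).2 (tendsto_id (α := ℝ) (x := 𝓝 0))).smul_isBigO h2
    simp only [id, smul_eq_mul, one_mul] at h3
    refine h3.congr_left fun ε => ?_
    simp only [hs, hs', smul_sub, mul_smul]
    abel
  have hPs : (fun ε => partialSumFun K N (ε, s' ε) - partialSumFun K N (ε, s ε))
      =o[𝓝 0] fun ε => ε ^ (N + 1) := by
    have h1 := ((hKj N).hasStrictFDerivAt (by simp)).isBigO_sub.comp_tendsto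
      ((tendsto_id.prodMk_nhds hst').prodMk_nhds (tendsto_id.prodMk_nhds hst))
    refine IsBigO.trans_isLittleO h1 ?_
    refine IsLittleO.prod_left ?_ hss
    simp only [id, sub_self]
    exact isLittleO_zero _ _
  have hbdiff : (fun ε => b' ε - b ε - ε ^ (N + 1) • K (N + 1) θ) =o[𝓝 0]
      fun ε => ε ^ (N + 1) := by
    have h1 : Tendsto (fun ε => K (N + 1) (s' ε) - K (N + 1) θ) (𝓝 0) (𝓝 0) := by
      have := ((hK (N + 1)).continuousAt.tendsto.comp hst').sub_const (K (N + 1) θ)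
      simpa using this
    refine (hPs.add (hpow_o _ h1)).congr_left fun ε => ?_
    rw [hbb, smul_sub]
    abel
  have hbO : (fun ε => b' ε - b ε) =O[𝓝 0] fun ε => ε ^ (N + 1) := by
    refine (hbdiff.isBigO.add (hpow (K (N + 1) θ))).congr_left fun ε => ?_
    abel
  have haO : (fun ε => a' ε - a ε) =O[𝓝 0] fun ε => ε ^ (N + 1) :=
    (hpow (K (N + 1) θ)).congr_left fun ε => (haa ε).symm
  -- the change of `f`
  set F : ℝ × X × X → X := fun p => f p.1 p.2.1 p.2.2 with hF
  set F' := fderiv ℝ F (0, K 0 θ, K 0 θ) with hF'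
  have hfdiff : (fun ε => f ε (a' ε) (b' ε) - f ε (a ε) (b ε) -
      ε ^ (N + 1) • F' (0, K (N + 1) θ, K (N + 1) θ)) =o[𝓝 0] fun ε => ε ^ (N + 1) := by
    have hstr : HasStrictFDerivAt F F' (0, K 0 θ, K 0 θ) := hf.hasStrictFDerivAt (by simp)
    -- Both arguments of f change by ε^{N+1} K_{N+1}(θ) up to o(ε^{N+1}), so only the derivative in
    -- the diagonal direction enters.
    have h1 := hstr.isLittleO.comp_tendsto
      ((tendsto_id.prodMk_nhds (hat'.prodMk_nhds (hbt (N + 1) s' hst'))).prodMk_nhds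
        (tendsto_id.prodMk_nhds (hat.prodMk_nhds (hbt N s hst))))
    have h2 := h1.trans_isBigO (k := fun ε : ℝ => ε ^ (N + 1)) (by
      refine IsBigO.prod_left ?_ (IsBigO.prod_left haO hbO)
      simp only [id, sub_self]
      exact isBigO_zero _ _)
    have h3 : (fun ε => F' (0, 0, b' ε - b ε - ε ^ (N + 1) • K (N + 1) θ)) =o[𝓝 0]
        fun ε => ε ^ (N + 1) := by
      refine (F'.isBigO_comp _ _).trans_isLittleO ?_
      exact (isLittleO_zero _ _).prod_left ((isLittleO_zero _ _).prod_left hbdiff)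
    refine (h2.add h3).congr_left fun ε => ?_
    have h4 : ((id ε, a' ε, b' ε) - (id ε, a ε, b ε) : ℝ × X × X) =
        ε ^ (N + 1) • (0, K (N + 1) θ, K (N + 1) θ) +
          (0, 0, b' ε - b ε - ε ^ (N + 1) • K (N + 1) θ) := by
      simp [haa]
    simp only [Function.comp_def]
    rw [show ((id ε, a' ε, partialSumFun K (N + 1) (ε, s' ε)) -
      (id ε, a ε, partialSumFun K N (ε, s ε)) : ℝ × X × X) = _ from h4, map_add, map_smul]
    simp only [hF, id]
    abel
  -- the change of the derivative
  have hdiff : ∀ j, DifferentiableAt ℝ (K j) θ := fun j => (hK j).differentiableAt (by simp)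
  set D : ℝ → E →L[ℝ] X := partialSum (fun j => fderiv ℝ (K j) θ) N with hD
  have hDt : Tendsto D (𝓝 0) (𝓝 (fderiv ℝ (K 0) θ)) := by
    have h := (contDiffAt_partialSum (fun j => fderiv ℝ (K j) θ) N (m := 1) (0 : ℝ)).continuousAt
    have h := h.tendsto
    rwa [partialSum_zero] at h
  have hDdiff : (fun ε => (D ε + ε ^ (N + 1) • fderiv ℝ (K (N + 1)) θ) (Ω' ε) - D ε (Ω ε) -
      ε ^ (N + 1) • (fderiv ℝ (K (N + 1)) θ (ω 0) + fderiv ℝ (K 0) θ (ω (N + 1))))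
      =o[𝓝 0] fun ε => ε ^ (N + 1) := by
    have h1 : Tendsto (fun ε => fderiv ℝ (K (N + 1)) θ (Ω' ε) - fderiv ℝ (K (N + 1)) θ (ω 0) +
        (D ε (ω (N + 1)) - fderiv ℝ (K 0) θ (ω (N + 1)))) (𝓝 0) (𝓝 0) := by
      have h2 := (((fderiv ℝ (K (N + 1)) θ).continuous.tendsto _).comp hΩt').sub_const
        (fderiv ℝ (K (N + 1)) θ (ω 0))
      have h3 := (((ContinuousLinearMap.apply ℝ X (ω (N + 1))).continuous.tendsto _).comp
        hDt).sub_const (fderiv ℝ (K 0) θ (ω (N + 1)))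
      simpa using h2.add h3
    refine (hpow_o _ h1).congr_left fun ε => ?_
    have h4 : Ω' ε = Ω ε + ε ^ (N + 1) • ω (N + 1) := by rw [← hΩΩ]; abel
    have h5 : D ε (Ω' ε) = D ε (Ω ε) + ε ^ (N + 1) • D ε (ω (N + 1)) := by
      rw [h4, map_add, map_smul]
    rw [add_apply, smul_apply, h5]
    simp only [smul_add, smul_sub]
    abel
  refine (hDdiff.sub hfdiff).congr_left fun ε => ?_
  simp only [resid]
  rw [fderiv_partialSumFun (N + 1) ε fun j _ => hdiff j,
    fderiv_partialSumFun N ε fun j _ => hdiff j]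
  have h6 : partialSum (fun j => fderiv ℝ (K j) θ) (N + 1) ε =
      D ε + ε ^ (N + 1) • fderiv ℝ (K (N + 1)) θ := by
    simp only [hD, partialSum]; rw [Finset.sum_range_succ _ (N + 1)]
  rw [h6]
  simp only [smul_sub]
  change _ = (D ε + ε ^ (N + 1) • fderiv ℝ (K (N + 1)) θ) (Ω' ε) - f ε (a' ε) (b' ε) -
    (D ε (Ω ε) - f ε (a ε) (b ε)) - _
  abel

end Linearization

end DelayTorus
end

/-! ### Uniform estimates on the torus and the recursion over the orders. -/

noncomputable section
namespace DelayTorus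
open Asymptotics Filter

lemma IsZPeriodic.fderiv {d : ℕ} {W : Type*} [NormedAddCommGroup W] [NormedSpace ℝ W]
    {u : (Fin d → ℝ) → W} (hu : IsZPeriodic u) : IsZPeriodic (fderiv ℝ u) := by
  intro z m
  have h1 : u = fun x => u (x + fun j => (m j : ℝ)) := by
    funext x
    exact (hu x m).symm
  conv_rhs => rw [h1, fderiv_comp_add_right]
  rfl

section

variable {d n : ℕ} {f : ℝ → (Fin n → ℝ) → (Fin n → ℝ) → (Fin n → ℝ)} {r : (Fin n → ℝ) → ℝ}

lemma resid_periodic {ω : ℕ → Fin d → ℝ} {K : ℕ → (Fin d → ℝ) → (Fin n → ℝ)}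
    (hper : ∀ j, IsZPeriodic (K j)) (N : ℕ) (ε : ℝ) :
    IsZPeriodic fun θ => resid f r ω K N (ε, θ) := by
  have h1 : IsZPeriodic fun θ => partialSumFun K N (ε, θ) := fun z m => by
    simp only [partialSumFun, hper _ z m]
  intro θ m
  have h2 := h1.fderiv θ m
  have h3 := h1 θ m
  simp only at h3
  simp only [resid]
  rw [h2, h3]
  congr 2
  have h4 := h1 (θ - (ε * r (partialSumFun K N (ε, θ))) • partialSum ω N ε) m
  simp only at h4
  rw [← h4]
  congr 2
  funext j
  simp only [Pi.sub_apply]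
  ring

lemma deriv_truncY {ω : ℕ → Fin d → ℝ} {K : ℕ → (Fin d → ℝ) → (Fin n → ℝ)}
    (hsm : ∀ j, ContDiff ℝ (⊤ : ℕ∞) (K j)) (N : ℕ) (ε t : ℝ) :
    deriv (truncY ω K N ε) t = fderiv ℝ (truncK K N ε) (t • truncω ω N ε) (truncω ω N ε) := by
  have h1 : DifferentiableAt ℝ (truncK K N ε) (t • truncω ω N ε) := by
    have : ContDiff ℝ 1 (truncK K N ε) := by
      unfold truncK
      exact ContDiff.sum fun j _ => ((hsm j).of_le (by exact_mod_cast le_top)).const_smul _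
    exact this.differentiable (by simp) _
  have h2 : HasDerivAt (fun t : ℝ => t • truncω ω N ε) (truncω ω N ε) t := by
    simpa using (hasDerivAt_id t).smul_const (truncω ω N ε)
  exact (h1.hasFDerivAt.comp_hasDerivAt t h2).deriv

/-- Pointwise estimates of the defect in the sense of formal power series imply uniform ones. -/
lemma solvesToAllOrders_of_resid {ω : ℕ → Fin d → ℝ} {K : ℕ → (Fin d → ℝ) → (Fin n → ℝ)}
    (hf : IsSmoothFamilyAlong f (K 0)) (hr : ∀ θ, ContDiffAt ℝ (⊤ : ℕ∞) r (K 0 θ))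
    (hper : ∀ j, IsZPeriodic (K j)) (hsm : ∀ j, ContDiff ℝ (⊤ : ℕ∞) (K j))
    (h : ∀ N θ, (fun ε => resid f r ω K N (ε, θ)) =o[𝓝 0] fun ε => ε ^ N) :
    SolvesToAllOrders f r ω K := by
  intro N
  have hsmooth : ∀ θ, ContDiffAt ℝ (⊤ : ℕ∞) (resid f r ω K N) (0, θ) := fun θ =>
    contDiffAt_resid N (fun j => (hsm j).contDiffAt) (hf θ) (hr θ)
  -- This is the passage from pointwise o(ε^N) to locally uniform O(ε^{N+1}): the first N + 1
  -- coefficients vanish at every θ, and Taylor's remainder is locally uniform.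
  have hcoeff : ∀ θ, ∀ i ≤ N, taylorCoeff (resid f r ω K N) i θ = 0 := by
    intro θ
    refine coeff_eq_zero_of_isLittleO _ N ?_
    have hpair : Tendsto (fun ε : ℝ => (ε, θ)) (𝓝 0) (𝓝 (0, θ)) :=
      tendsto_id.prodMk_nhds tendsto_const_nhds
    have h1 := (taylor_isBigO (N + 1) (hsmooth θ)).comp_tendsto hpair
    have h2 : (fun ε : ℝ => ε ^ (N + 1)) =o[𝓝 0] fun ε => ε ^ N :=
      isLittleO_pow_pow (Nat.lt_succ_self N)
    refine ((h N θ).sub (h1.trans_isLittleO h2)).congr_left fun ε => ?_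
    simp
  have hO : ∀ θ, resid f r ω K N =O[𝓝 (0, θ)] fun p => p.1 ^ (N + 1) := by
    intro θ
    refine (taylor_isBigO (N + 1) (hsmooth θ)).congr_left fun p => ?_
    rw [Finset.sum_eq_zero, sub_zero]
    intro i hi
    rw [hcoeff p.2 i (Nat.lt_succ_iff.1 (Finset.mem_range.1 hi)), smul_zero]
  -- a bound that is uniform on the torus
  obtain ⟨C, hC⟩ : ∃ C : ℝ, ∀ᶠ ε in 𝓝 (0 : ℝ), ∀ θ,
      ‖resid f r ω K N (ε, θ)‖ ≤ C * |ε| ^ (N + 1) := by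
    choose c hc using fun θ => (hO θ).bound
    have hcov : ∀ θ : Fin d → ℝ, ∃ U ∈ 𝓝 θ, ∀ᶠ ε in 𝓝 (0 : ℝ), ∀ x ∈ U,
        ‖resid f r ω K N (ε, x)‖ ≤ c θ * ‖ε ^ (N + 1)‖ := by
      intro θ
      have h1 := hc θ
      rw [nhds_prod_eq] at h1
      obtain ⟨p, hp, q, hq, hpq⟩ := eventually_prod_iff.1 h1
      exact ⟨{x | q x}, hq, hp.mono fun ε hε x hx => hpq hε hx⟩
    choose U hU hUc using hcov
    obtain ⟨t, -, ht⟩ := (isCompact_Icc (a := (0 : Fin d → ℝ)) (b := 1)).elim_nhds_subcover U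
      fun θ _ => hU θ
    refine ⟨∑ θ ∈ t, |c θ|, ?_⟩
    have h2 : ∀ᶠ ε in 𝓝 (0 : ℝ), ∀ θ ∈ t, ∀ x ∈ U θ,
        ‖resid f r ω K N (ε, x)‖ ≤ c θ * ‖ε ^ (N + 1)‖ := by
      rw [Finset.eventually_all]
      exact fun θ _ => hUc θ
    filter_upwards [h2] with ε hε θ
    -- Periodicity moves θ into the compact cube.
    have h3 : (fun j => Int.fract (θ j)) ∈ Set.Icc (0 : Fin d → ℝ) 1 :=
      ⟨fun j => Int.fract_nonneg _, fun j => (Int.fract_lt_one _).le⟩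
    obtain ⟨x, hx, hxU⟩ := Set.mem_iUnion₂.1 (ht h3)
    have h4 := hε x hx _ hxU
    have h5 := resid_periodic (f := f) (r := r) (ω := ω) hper N ε (fun j => Int.fract (θ j))
      fun j => ⌊θ j⌋
    simp only [Int.fract_add_floor] at h5
    rw [show (θ : Fin d → ℝ) = fun j => θ j from rfl, h5]
    rw [norm_pow, Real.norm_eq_abs] at h4
    refine h4.trans ?_
    gcongr
    exact (le_abs_self _).trans (Finset.single_le_sum (f := fun θ => |c θ|)
      (fun i _ => abs_nonneg _) hx)
  obtain ⟨ρ, hρ, hball⟩ := Metric.eventually_nhds_iff_ball.1 hC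
  -- The estimate is known on an open ball but is wanted for the closed condition |ε| ≤ ε₀, hence
  -- the factor 1/2.
  refine ⟨C, ρ / 2, by positivity, fun ε hε => ?_⟩
  have h1 : ∀ θ, ‖resid f r ω K N (ε, θ)‖ ≤ C * |ε| ^ (N + 1) :=
    hball ε (by rw [Metric.mem_ball, dist_zero_right, Real.norm_eq_abs]; linarith)
  refine ⟨fun θ => h1 θ, fun t => ?_⟩
  -- A time delay moves the phase along the frequency vector, so the delay equation at time t is the
  -- invariance equation at θ = tω.
  have h2 := h1 (t • truncω ω N ε)
  rw [deriv_truncY hsm]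
  have h3 : truncY ω K N ε (t - ε * r (truncY ω K N ε t)) = truncK K N ε (t • truncω ω N ε -
      (ε * r (truncK K N ε (t • truncω ω N ε))) • truncω ω N ε) := by
    simp only [truncY, sub_smul]
  rw [h3]
  exact h2

end

/-- Sequences built by extending finite ones. -/
lemma exists_seq_of_extend {α : Type*} (P : ℕ → (ℕ → α) → Prop) (x₀ : ℕ → α)
    (hcongr : ∀ N x y, (∀ j ≤ N, x j = y j) → P N x → P N y) (h0 : P 0 x₀)
    (hstep : ∀ N x, P N x → ∃ a, P (N + 1) (Function.update x (N + 1) a)) :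
    ∃ x : ℕ → α, x 0 = x₀ 0 ∧ ∀ N, P N x := by
  have : Nonempty α := ⟨x₀ 0⟩
  choose! next hnext using hstep
  let s : ℕ → ℕ → α := fun N => Nat.rec x₀
    (fun N x => Function.update x (N + 1) (next N x)) N
  have hs : ∀ N, s (N + 1) = Function.update (s N) (N + 1) (next N (s N)) := fun N => rfl
  have hP : ∀ N, P N (s N) := by
    intro N
    induction N with
    | zero => exact h0
    | succ N ih => rw [hs]; exact hnext N _ ih
  have hstab : ∀ N j, j ≤ N → s N j = s j j := by
    intro N
    induction N with
    | zero => intro j hj; obtain rfl : j = 0 := by omega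
              rfl
    | succ N ih =>
      intro j hj
      rcases Nat.lt_or_ge j (N + 1) with hlt | hge
      · rw [hs, Function.update_of_ne (by omega), ih j (by omega)]
      · obtain rfl : j = N + 1 := by omega
        rfl
  -- The diagonal agrees with `s N` at all indices up to N, and these are all that `P N` depends on.
  exact ⟨fun j => s j j, rfl, fun N => hcongr N _ _ (fun j hj => hstab N j hj) (hP N)⟩

/-- Lindstedt series exist in any class `Good` of functions on the torus in which the linearized
equation can be solved and which is stable under the formation of the right hand sides. -/
theorem exists_lindstedt {d n : ℕ} {f : ℝ → (Fin n → ℝ) → (Fin n → ℝ) → (Fin n → ℝ)}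
    {r : (Fin n → ℝ) → ℝ} {ω₀ : Fin d → ℝ} {K₀ : (Fin d → ℝ) → (Fin n → ℝ)}
    (Good : ((Fin d → ℝ) → (Fin n → ℝ)) → Prop)
    (hf : IsSmoothFamilyAlong f K₀) (hr : ∀ θ, ContDiffAt ℝ (⊤ : ℕ∞) r (K₀ θ))
    (hper : IsZPeriodic K₀) (hsm : ContDiff ℝ (⊤ : ℕ∞) K₀) (hgood : Good K₀)
    (hinv : ∀ θ, fderiv ℝ K₀ θ ω₀ = f 0 (K₀ θ) (K₀ θ))
    (hcoeff : ∀ (ω : ℕ → Fin d → ℝ) (K : ℕ → (Fin d → ℝ) → (Fin n → ℝ)) (N : ℕ), K 0 = K₀ →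
      (∀ j, IsZPeriodic (K j)) → (∀ j, ContDiff ℝ (⊤ : ℕ∞) (K j)) → (∀ j, Good (K j)) →
      Good (taylorCoeff (resid f r ω K N) (N + 1)))
    (hsolve : ∀ R : (Fin d → ℝ) → (Fin n → ℝ), IsZPeriodic R → ContDiff ℝ (⊤ : ℕ∞) R → Good R →
      ∃ (w : Fin d → ℝ) (u : (Fin d → ℝ) → (Fin n → ℝ)), IsZPeriodic u ∧
        ContDiff ℝ (⊤ : ℕ∞) u ∧ Good u ∧ ∀ θ, fderiv ℝ u θ ω₀ + fderiv ℝ K₀ θ w -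
          fderiv ℝ (fun p : ℝ × (Fin n → ℝ) × (Fin n → ℝ) => f p.1 p.2.1 p.2.2)
            (0, K₀ θ, K₀ θ) (0, u θ, u θ) = -R θ) :
    ∃ (ω : ℕ → Fin d → ℝ) (K : ℕ → (Fin d → ℝ) → (Fin n → ℝ)),
      IsLindstedtSeries f r ω₀ K₀ ω K ∧ ∀ j, Good (K j) := by
  -- Periodicity, smoothness and `Good` are bundled into the entries, so they hold at every index,
  -- including the placeholders beyond N.
  let P : ℕ → (ℕ → (Fin d → ℝ) × {u : (Fin d → ℝ) → (Fin n → ℝ) //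
      IsZPeriodic u ∧ ContDiff ℝ (⊤ : ℕ∞) u ∧ Good u}) → Prop := fun N x =>
    (x 0).1 = ω₀ ∧ (x 0).2.1 = K₀ ∧ ∀ θ, (fun ε => resid f r (fun j => (x j).1)
      (fun j => (x j).2.1) N (ε, θ)) =o[𝓝 0] fun ε => ε ^ N
  obtain ⟨x, -, hx⟩ := exists_seq_of_extend P (fun _ => (ω₀, ⟨K₀, hper, hsm, hgood⟩))
    (by
      rintro N x y hxy ⟨h1, h2, h3⟩
      refine ⟨by rw [← hxy 0 (Nat.zero_le _), h1], by rw [← hxy 0 (Nat.zero_le _), h2], fun θ => ?_⟩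
      rw [resid_congr (ω' := fun j => (x j).1) (K' := fun j => (x j).2.1)
        (fun j hj => by rw [hxy j hj]) (fun j hj => by rw [hxy j hj])]
      exact h3 θ)
    (by
      refine ⟨rfl, rfl, fun θ => ?_⟩
      simp only [pow_zero]
      rw [isLittleO_one_iff]
      have h1 := (contDiffAt_resid (f := f) (r := r) (ω := fun _ => ω₀) (K := fun _ => K₀) 0
        (fun j => hsm.contDiffAt) (hf θ) (hr θ)).continuousAt.tendsto.comp
          (tendsto_id.prodMk_nhds (tendsto_const_nhds (x := θ)))
      have h2 : resid f r (fun _ => ω₀) (fun _ => K₀) 0 (0, θ) = 0 := by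
        simp only [resid, partialSum_zero, partialSumFun_zero, zero_mul, zero_smul, sub_zero]
        rw [hinv θ, sub_self]
      rw [h2] at h1
      exact h1)
    (by
      rintro N x ⟨h1, h2, h3⟩
      set ω : ℕ → Fin d → ℝ := fun j => (x j).1 with hω
      set K : ℕ → (Fin d → ℝ) → (Fin n → ℝ) := fun j => (x j).2.1 with hK
      have hK0 : K 0 = K₀ := h2
      have hKp : ∀ j, IsZPeriodic (K j) := fun j => (x j).2.2.1
      have hKs : ∀ j, ContDiff ℝ (⊤ : ℕ∞) (K j) := fun j => (x j).2.2.2.1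
      have hKg : ∀ j, Good (K j) := fun j => (x j).2.2.2.2
      have hsmooth : ∀ θ, ContDiffAt ℝ (⊤ : ℕ∞) (resid f r ω K N) (0, θ) := fun θ =>
        contDiffAt_resid N (fun j => (hKs j).contDiffAt) (by rw [hK0]; exact hf θ)
          (by rw [hK0]; exact hr θ)
      set R := taylorCoeff (resid f r ω K N) (N + 1) with hR
      have hRs : ContDiff ℝ (⊤ : ℕ∞) R :=
        contDiff_iff_contDiffAt.2 fun θ => contDiffAt_taylorCoeff _ (hsmooth θ)
      have hRp : IsZPeriodic R := fun θ m => by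
        simp only [hR, taylorCoeff]
        congr 2
        funext ε
        exact resid_periodic hKp N ε θ m
      obtain ⟨w, u, hup, hus, hug, hu⟩ := hsolve R hRp hRs (hcoeff ω K N hK0 hKp hKs hKg)
      refine ⟨(w, ⟨u, hup, hus, hug⟩), ?_⟩
      set y := Function.update x (N + 1) (w, ⟨u, hup, hus, hug⟩) with hy
      have hylt : ∀ j ≤ N, y j = x j := fun j hj => Function.update_of_ne (by omega) _ _
      have hyN : y (N + 1) = (w, ⟨u, hup, hus, hug⟩) := Function.update_self _ _ _
      refine ⟨by rw [hylt 0 (Nat.zero_le _)]; exact h1, by rw [hylt 0 (Nat.zero_le _)]; exact h2,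
        fun θ => ?_⟩
      have hy0 : (y 0).2.1 = K₀ := by rw [hylt 0 (Nat.zero_le _)]; exact h2
      have hpair : Tendsto (fun ε : ℝ => (ε, θ)) (𝓝 0) (𝓝 (0, θ)) :=
        tendsto_id.prodMk_nhds tendsto_const_nhds
      have hlo : (fun ε : ℝ => ε ^ (N + 2)) =o[𝓝 0] fun ε => ε ^ (N + 1) :=
        isLittleO_pow_pow (Nat.lt_succ_self _)
      have hlo' : (fun ε : ℝ => ε ^ (N + 1)) =o[𝓝 0] fun ε => ε ^ N :=
        isLittleO_pow_pow (Nat.lt_succ_self _)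
      have hTay' := (taylor_isBigO (N + 1) (hsmooth θ)).comp_tendsto hpair
      have hTay := (taylor_isBigO (N + 2) (hsmooth θ)).comp_tendsto hpair
      -- By uniqueness of expansions the old defect is ε^{N+1} R + o(ε^{N+1}).
      have hz : ∀ i ≤ N, taylorCoeff (resid f r ω K N) i θ = 0 := by
        refine coeff_eq_zero_of_isLittleO _ N ?_
        refine ((h3 θ).sub (hTay'.trans_isLittleO hlo')).congr_left fun ε => ?_
        simp [hω, hK]
      have hmain : (fun ε : ℝ => resid f r ω K N (ε, θ) - ε ^ (N + 1) • R θ) =o[𝓝 0]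
          fun ε => ε ^ (N + 1) := by
        refine (hTay.trans_isLittleO hlo).congr_left fun ε => ?_
        simp only [Function.comp_def]
        rw [Finset.sum_range_succ, Finset.sum_eq_zero, zero_add]
        intro i hi
        rw [hz i (Nat.lt_succ_iff.1 (Finset.mem_range.1 hi)), smul_zero]
      have hlin := resid_succ_sub_isLittleO (f := f) (r := r) (ω := fun j => (y j).1)
        (K := fun j => (y j).2.1) N (θ := θ) (fun j => (y j).2.2.2.1.contDiffAt)
        (by simp only [hy0]; exact hf θ) (by simp only [hy0]; exact hr θ)
      have hcong : resid f r (fun j => (y j).1) (fun j => (y j).2.1) N = resid f r ω K N :=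
        resid_congr (fun j hj => by rw [hylt j hj]) (fun j hj => by rw [hylt j hj])
      -- By `hu` the new term contributes −ε^{N+1} R, which cancels the leading part of the old
      -- defect.
      refine (hlin.add hmain).congr_left fun ε => ?_
      simp only [hcong, hy0, hyN]
      rw [show (y 0).1 = ω₀ by rw [hylt 0 (Nat.zero_le _)]; exact h1, hu θ, smul_neg]
      abel)
  have hx0 : (x 0).1 = ω₀ := (hx 0).1
  have hxK : (x 0).2.1 = K₀ := (hx 0).2.1
  refine ⟨fun j => (x j).1, fun j => (x j).2.1, ⟨hx0, hxK, fun j => (x j).2.2.1,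
    fun j => (x j).2.2.2.1, ?_⟩, fun j => (x j).2.2.2.2⟩
  exact solvesToAllOrders_of_resid (by simpa only [hxK] using hf) (by simpa only [hxK] using hr)
    (fun j => (x j).2.2.1) (fun j => (x j).2.2.2.1) fun N θ => (hx N).2.2 θ

end DelayTorus
end

/-! ### Holomorphic functions of several variables and the identity theorem on the strip. -/

noncomputable section
namespace DelayTorus
open Asymptotics Filter MeasureTheory

section Holomorphic

variable {E F : Type*} [NormedAddCommGroup E] [NormedSpace ℂ E] [FiniteDimensional ℂ E]
  [NormedAddCommGroup F] [NormedSpace ℂ F] [FiniteDimensional ℂ F]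

/-- Directional derivatives of holomorphic functions of several variables are holomorphic. -/
lemma differentiableOn_fderiv_apply {f : E → F} {U : Set E} (hU : IsOpen U)
    (hf : DifferentiableOn ℂ f U) (v : E) : DifferentiableOn ℂ (fun z => fderiv ℂ f z v) U := by
  intro z₀ hz₀
  refine DifferentiableAt.differentiableWithinAt ?_
  have : CompleteSpace F := FiniteDimensional.complete ℂ F
  have hcont : ContinuousAt f z₀ := (hf.continuousOn z₀ hz₀).continuousAt (hU.mem_nhds hz₀)
  obtain ⟨δ, hδ, hball⟩ := Metric.eventually_nhds_iff_ball.1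
    ((hU.eventually_mem hz₀).and (Metric.tendsto_nhds.1 hcont 1 one_pos))
  set ρ : ℝ := δ / 3 with hρ
  have hρ0 : 0 < ρ := by positivity
  have hsub : ∀ w ∈ Metric.ball z₀ (2 * ρ), ∀ x ∈ Metric.ball w ρ, x ∈ Metric.ball z₀ δ := by
    intro w hw x hx
    rw [Metric.mem_ball] at *
    linarith [dist_triangle x w z₀]
  have hbd : ∀ w ∈ Metric.ball z₀ (2 * ρ), DifferentiableAt ℂ f w ∧ ‖fderiv ℂ f w‖ ≤ 2 / ρ := by
    intro w hw
    have hwU := (hball w (hsub w hw w (Metric.mem_ball_self hρ0)))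
    refine ⟨hf.differentiableAt (hU.mem_nhds hwU.1), ?_⟩
    -- On `ball z₀ δ` the function stays within 1 of its central value, so it oscillates by less
    -- than 2 and Cauchy's estimate applies.
    refine Complex.norm_fderiv_le_div_of_mapsTo_ball
      (hf.mono fun x hx => (hball x (hsub w hw x hx)).1) (fun x hx => ?_) hρ0
    have h1 := (hball x (hsub w hw x hx)).2
    rw [Metric.mem_closedBall]
    linarith [dist_triangle_right (f x) (f w) (f z₀), hwU.2]
  -- The circle ζ • v with ‖ζ‖ = R must stay within distance ρ; the summand 1 covers v = 0.
  set R : ℝ := ρ / (‖v‖ + 1) with hR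
  have hv1 : 0 < ‖v‖ + 1 := by positivity
  have hR0 : 0 < R := by positivity
  have hRv : ∀ ζ : ℂ, ‖ζ‖ ≤ R → ‖ζ • v‖ < ρ := by
    intro ζ hζ
    rw [norm_smul]
    calc ‖ζ‖ * ‖v‖ ≤ R * ‖v‖ := by gcongr
      _ < R * (‖v‖ + 1) := by gcongr; linarith
      _ = ρ := by rw [hR]; field_simp
  have hmem : ∀ z ∈ Metric.ball z₀ ρ, ∀ ζ : ℂ, ‖ζ‖ ≤ R → z + ζ • v ∈ Metric.ball z₀ (2 * ρ) := by
    intro z hz ζ hζ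
    have h1 := hRv ζ hζ
    rw [Metric.mem_ball, dist_eq_norm] at *
    calc ‖z + ζ • v - z₀‖ = ‖(z - z₀) + ζ • v‖ := by congr 1; abel
      _ ≤ ‖z - z₀‖ + ‖ζ • v‖ := norm_add_le _ _
      _ < 2 * ρ := by linarith
  -- Cauchy's formula along the complex lines in direction `v`
  have hcauchy : ∀ z ∈ Metric.ball z₀ ρ, fderiv ℂ f z v = (2 * Real.pi * Complex.I : ℂ)⁻¹ •
      ∫ t in Set.Ioc 0 (2 * Real.pi), (deriv (circleMap 0 R) t *
        (1 / (circleMap 0 R t - 0) ^ 2)) • f (z + circleMap 0 R t • v) := by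
    intro z hz
    have hline : ∀ ζ : ℂ, HasDerivAt (fun ζ : ℂ => z + ζ • v) v ζ := fun ζ => by
      simpa using ((hasDerivAt_id ζ).smul_const v).const_add z
    have h1 : HasDerivAt (fun ζ : ℂ => f (z + ζ • v)) (fderiv ℂ f z v) 0 := by
      have h2 := (hbd z (Metric.ball_subset_ball (by linarith) hz)).1.hasFDerivAt
      have h3 : HasFDerivAt f (fderiv ℂ f z) (z + (0 : ℂ) • v) := by simpa using h2
      exact h3.comp_hasDerivAt (0 : ℂ) (hline 0)
    have h4 : DifferentiableOn ℂ (fun ζ : ℂ => f (z + ζ • v)) (Metric.closedBall 0 R) := by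
      intro ζ hζ
      have h5 := (hbd _ (hmem z hz ζ (by simpa using hζ))).1.hasFDerivAt
      exact (h5.comp_hasDerivAt ζ (hline ζ)).differentiableAt.differentiableWithinAt
    rw [← h1.deriv, eq_inv_smul_iff₀ Complex.two_pi_I_ne_zero,
      ← DifferentiableOn.deriv_eq_smul_circleIntegral hR0 h4]
    rw [circleIntegral, intervalIntegral.integral_of_le (by positivity)]
    simp only [mul_smul]
  set c : ℝ → ℂ := fun t => deriv (circleMap 0 R) t * (1 / (circleMap 0 R t - 0) ^ 2) with hc
  have hcirc : ∀ t, ‖circleMap 0 R t‖ = R := fun t => by simp [abs_of_pos hR0]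
  have hcc : Continuous c := by
    simp only [hc, deriv_circleMap]
    refine ((continuous_circleMap 0 R).mul continuous_const).mul ?_
    refine continuous_const.div (((continuous_circleMap 0 R).sub continuous_const).pow 2) fun t => ?_
    rw [sub_zero, ← norm_pos_iff, norm_pow, hcirc]
    positivity
  have hcn : ∀ t, ‖c t‖ = R * (1 / R ^ 2) := fun t => by
    simp only [hc, deriv_circleMap, norm_mul, norm_div, norm_one, norm_pow, sub_zero, hcirc, Complex.norm_I, mul_one]
  have hfc : ∀ z ∈ Metric.ball z₀ ρ, Continuous fun t => c t • f (z + circleMap 0 R t • v) := by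
    intro z hz
    refine hcc.smul (continuous_iff_continuousAt.2 fun t => ?_)
    refine ContinuousAt.comp (g := f) (hbd _ (hmem z hz _ (hcirc t).le)).1.continuousAt ?_
    exact (continuous_const.add ((continuous_circleMap 0 R).smul continuous_const)).continuousAt
  -- In Cauchy's formula z is merely a parameter, so the integral may be differentiated under the
  -- integral sign.
  have hder : HasFDerivAt
      (fun z => ∫ t in Set.Ioc 0 (2 * Real.pi), c t • f (z + circleMap 0 R t • v))
      (∫ t in Set.Ioc 0 (2 * Real.pi), c t • fderiv ℂ f (z₀ + circleMap 0 R t • v)) z₀ := by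
    refine hasFDerivAt_integral_of_dominated_of_fderiv_le (𝕜 := ℂ) (s := Metric.ball z₀ ρ)
      (F' := fun z t => c t • fderiv ℂ f (z + circleMap 0 R t • v))
      (bound := fun _ => R * (1 / R ^ 2) * (2 / ρ)) (Metric.ball_mem_nhds _ hρ0) ?_ ?_ ?_ ?_ ?_ ?_
    · filter_upwards [Metric.ball_mem_nhds z₀ hρ0] with z hz
      exact (hfc z hz).aestronglyMeasurable
    · exact (hfc z₀ (Metric.mem_ball_self hρ0)).integrableOn_Ioc
    -- Continuity of `fderiv ℂ f` is not available at this stage; measurability is enough.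
    · borelize E
      have : ProperSpace E := FiniteDimensional.proper ℂ E
      have : ProperSpace (E →L[ℂ] F) := FiniteDimensional.proper ℂ _
      have h1 : Measurable fun t : ℝ => fderiv ℂ f (z₀ + circleMap 0 R t • v) :=
        (measurable_fderiv ℂ f).comp (continuous_const.add
          ((continuous_circleMap 0 R).smul continuous_const)).measurable
      exact (hcc.measurable.smul h1).aestronglyMeasurable
    · refine Eventually.of_forall fun t z hz => ?_
      rw [norm_smul, hcn]
      have := (hbd _ (hmem z hz _ (hcirc t).le)).2
      gcongr
    · exact (continuous_const).integrableOn_Ioc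
    · refine Eventually.of_forall fun t z hz => ?_
      have h1 := (hbd _ (hmem z hz _ (hcirc t).le)).1.hasFDerivAt
      exact ((hasFDerivAt_comp_add_right _).2 h1).const_smul (c t)
  refine ((hder.differentiableAt.const_smul (2 * Real.pi * Complex.I : ℂ)⁻¹)).congr_of_eventuallyEq ?_
  filter_upwards [Metric.ball_mem_nhds z₀ hρ0] with z hz
  exact hcauchy z hz

/-- Holomorphic functions of several variables are smooth. -/
theorem contDiffOn_of_differentiableOn {f : E → F} {U : Set E} (hU : IsOpen U)
    (hf : DifferentiableOn ℂ f U) : ContDiffOn ℂ (⊤ : ℕ∞) f U := by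
  rw [contDiffOn_infty]
  intro m
  induction m generalizing f with
  | zero => simpa using hf.continuousOn
  | succ m ih =>
    push_cast
    rw [contDiffOn_succ_iff_fderiv_of_isOpen hU]
    refine ⟨hf, by simp, ?_⟩
    rw [contDiffOn_clm_apply]
    exact fun v => ih (differentiableOn_fderiv_apply hU hf v)

end Holomorphic

/-- The inclusion `ℝᵐ ⊆ ℂᵐ` as a continuous linear map. -/
def toCL (m : ℕ) : (Fin m → ℝ) →L[ℝ] (Fin m → ℂ) :=
  ContinuousLinearMap.pi fun i => Complex.ofRealCLM.comp (ContinuousLinearMap.proj i)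

lemma toCL_apply {m : ℕ} (x : Fin m → ℝ) : toCL m x = toC x := rfl

lemma norm_toC {m : ℕ} (x : Fin m → ℝ) : ‖toC x‖ = ‖x‖ := by
  simp [Pi.norm_def, toC, Complex.nnnorm_real]

lemma isOpen_strip (d : ℕ) (ξ : ℝ) : IsOpen (strip d ξ) := by
  simp only [strip, Set.ofPred_forall]
  exact isOpen_iInter_of_finite fun j =>
    isOpen_lt (Complex.continuous_im.comp (continuous_apply j)).abs continuous_const

lemma convex_strip (d : ℕ) (ξ : ℝ) : Convex ℝ (strip d ξ) := by
  intro x hx y hy a b ha hb hab j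
  have h1 := hx j
  have h2 := hy j
  rw [abs_lt] at *
  have h3 : ((a • x + b • y) j).im = a * (x j).im + b * (y j).im := by simp
  rw [h3]
  have h4 := convex_Ioo (-ξ) ξ h1 h2 ha hb hab
  simpa using h4

lemma toC_mem_strip {d : ℕ} {ξ : ℝ} (hξ : 0 < ξ) (θ : Fin d → ℝ) : toC θ ∈ strip d ξ := by
  intro j
  simpa [toC] using hξ

/-- The identity theorem for the strip. -/
lemma eqOn_strip_of_eq_real {d : ℕ} {F : Type*} [NormedAddCommGroup F] [NormedSpace ℂ F]
    [CompleteSpace F] {ξ : ℝ}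
    {U V : (Fin d → ℂ) → F} (hU : DifferentiableOn ℂ U (strip d ξ))
    (hV : DifferentiableOn ℂ V (strip d ξ)) (h : ∀ θ, U (toC θ) = V (toC θ)) :
    Set.EqOn U V (strip d ξ) := by
  intro z hz
  set x : Fin d → ℝ := fun j => (z j).re with hx
  set y : Fin d → ℝ := fun j => (z j).im with hy
  -- On this complex line real s gives real points and s = i gives z; the one-variable identity
  -- theorem on a convex set then suffices.
  set ℓ : ℂ → (Fin d → ℂ) := fun s => toC x + s • toC y with hℓ
  set S : Set ℂ := ℓ ⁻¹' strip d ξ with hS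
  have hℓd : Differentiable ℂ ℓ := by fun_prop
  have hSo : IsOpen S := (isOpen_strip d ξ).preimage hℓd.continuous
  have hSc : Convex ℝ S := by
    intro s hs t ht a b ha hb hab
    have h1 := convex_strip d ξ hs ht ha hb hab
    have h2 : ℓ (a • s + b • t) = a • ℓ s + b • ℓ t := by
      simp only [hℓ]
      have : toC x = (a + b) • toC x := by rw [hab, one_smul]
      rw [this]
      ext j
      simp only [Pi.add_apply, Pi.smul_apply, Complex.real_smul, smul_eq_mul]
      have hab' : ((a : ℂ) + b) = 1 := by exact_mod_cast hab
      push_cast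
      linear_combination (-((a : ℂ) + b) * toC x j) * hab'
    change ℓ _ ∈ strip d ξ
    rw [h2]
    exact h1
  have hℓI : ℓ Complex.I = z := by
    ext j
    simp only [hℓ, toC, hx, hy, Pi.add_apply, Pi.smul_apply, smul_eq_mul]
    rw [mul_comm, Complex.re_add_im]
  have hI : Complex.I ∈ S := by
    change ℓ _ ∈ strip d ξ
    rwa [hℓI]
  have hreal : ∀ t : ℝ, ℓ t = toC (x + t • y) := fun t => by
    ext j
    simp [hℓ, toC]
  have h0 : (0 : ℂ) ∈ S := by
    intro j
    have := hz j
    simpa [hℓ, toC] using (abs_nonneg _).trans_lt this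
  have hUa : AnalyticOnNhd ℂ (U ∘ ℓ) S :=
    (hU.comp hℓd.differentiableOn fun s hs => hs).analyticOnNhd hSo
  have hVa : AnalyticOnNhd ℂ (V ∘ ℓ) S :=
    (hV.comp hℓd.differentiableOn fun s hs => hs).analyticOnNhd hSo
  have hfreq : ∃ᶠ s in 𝓝[≠] (0 : ℂ), (U ∘ ℓ) s = (V ∘ ℓ) s := by
    have h1 : Tendsto (fun t : ℝ => (t : ℂ)) (𝓝[≠] 0) (𝓝[≠] 0) := by
      refine tendsto_nhdsWithin_iff.2 ⟨?_, ?_⟩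
      · have := Complex.continuous_ofReal.tendsto 0
        simp only [Complex.ofReal_zero] at this
        exact this.mono_left nhdsWithin_le_nhds
      · filter_upwards [self_mem_nhdsWithin] with t ht
        simpa using ht
    refine h1.frequently (Eventually.frequently (Eventually.of_forall fun t => ?_))
    simp only [Function.comp_apply, hreal, h]
  have := hUa.eqOn_of_preconnected_of_frequently_eq hVa hSc.isPreconnected h0 hfreq hI
  simpa [hℓI] using this

end DelayTorus
end

/-! ### Averages over the torus and their behaviour under real and complex translations. -/

noncomputable section
namespace DelayTorus
open Asymptotics Filter MeasureTheory

variable {d : ℕ} {E : Type*} [NormedAddCommGroup E] [NormedSpace ℂ E]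

/-- The measure on `ℝ / ℤ` is normalized to have total mass `1`. -/
local instance : MeasureSpace UnitAddCircle := ⟨AddCircle.haarAddCircle⟩

local instance : Measure.IsAddHaarMeasure (volume : Measure UnitAddCircle) :=
  inferInstanceAs (Measure.IsAddHaarMeasure AddCircle.haarAddCircle)

/-- The fundamental domain over which averages are taken. -/
def unitCube (d : ℕ) : Set (Fin d → ℝ) :=
  {x | ∀ i, x i ∈ Set.Ioc ((0 : Fin d → ℝ) i) ((0 : Fin d → ℝ) i + 1)}

/-- The average of a periodic function. -/
def torusAvg (u : (Fin d → ℝ) → E) : E := ∫ θ in unitCube d, u θ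

/-- The function on the torus with a given periodic lift. -/
def descend (u : (Fin d → ℝ) → E) (x : UnitAddTorus (Fin d)) : E :=
  u fun i => Function.surjInv (QuotientAddGroup.mk_surjective (s := AddSubgroup.zmultiples (1 : ℝ)))
    (x i)

omit [NormedAddCommGroup E] [NormedSpace ℂ E] in
lemma descend_coe {u : (Fin d → ℝ) → E} (hu : IsZPeriodic u) (θ : Fin d → ℝ) :
    descend u (fun i => (θ i : UnitAddCircle)) = u θ := by
  have h : ∀ i, ∃ m : ℤ, Function.surjInv
      (QuotientAddGroup.mk_surjective (s := AddSubgroup.zmultiples (1 : ℝ)))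
      ((θ i : UnitAddCircle)) = θ i + m := by
    intro i
    have h1 := Function.surjInv_eq
      (QuotientAddGroup.mk_surjective (s := AddSubgroup.zmultiples (1 : ℝ))) ((θ i : UnitAddCircle))
    obtain ⟨m, hm⟩ := AddSubgroup.mem_zmultiples_iff.1 (QuotientAddGroup.eq.1 h1.symm)
    refine ⟨m, ?_⟩
    rw [zsmul_one] at hm
    rw [hm]
    abel
  choose m hm using h
  simp only [descend, hm]
  exact hu θ m

omit [NormedSpace ℂ E] in
lemma continuous_descend {u : (Fin d → ℝ) → E} (hu : IsZPeriodic u) (hc : Continuous u) :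
    Continuous (descend u) := by
  have hq : IsOpenQuotientMap
      (Pi.map (fun _ : Fin d => ((↑) : ℝ → UnitAddCircle))) :=
    IsOpenQuotientMap.piMap fun _ => QuotientAddGroup.isOpenQuotientMap_mk
  rw [hq.isQuotientMap.continuous_iff]
  convert hc using 1
  funext θ
  exact descend_coe hu θ

/-- The passage to the compact group gives access to the translation invariance of Haar measure. -/
lemma torusAvg_eq {u : (Fin d → ℝ) → E} (hu : IsZPeriodic u) :
    torusAvg u = ∫ x : UnitAddTorus (Fin d), descend u x := by
  rw [UnitAddTorus.integral_preimage _ 0]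
  simp only [descend_coe hu]
  rfl

/-- Averages are invariant under translations. -/
lemma torusAvg_comp_add {u : (Fin d → ℝ) → E} (hu : IsZPeriodic u) (h : Fin d → ℝ) :
    torusAvg (fun θ => u (θ + h)) = torusAvg u := by
  rw [torusAvg_eq hu,
    ← integral_add_right_eq_self (descend u) (fun i => (h i : UnitAddCircle) : UnitAddTorus (Fin d)),
    UnitAddTorus.integral_preimage _ 0]
  unfold torusAvg
  congr 1
  funext θ
  exact (descend_coe hu (θ + h)).symm

lemma unitCube_subset : unitCube d ⊆ Set.Icc (0 : Fin d → ℝ) 1 := fun x hx =>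
  ⟨fun i => (hx i).1.le, fun i => by simpa using (hx i).2⟩

lemma measurableSet_unitCube : MeasurableSet (unitCube d) :=
  MeasurableSet.univ_pi' (t := fun i => Set.Ioc ((0 : Fin d → ℝ) i) ((0 : Fin d → ℝ) i + 1))
    fun _ => measurableSet_Ioc

lemma volume_unitCube : volume (unitCube d) = 1 := by
  have : unitCube d = Set.univ.pi fun i => Set.Ioc ((0 : Fin d → ℝ) i) ((0 : Fin d → ℝ) i + 1) := by
    ext x
    simp [unitCube]
  rw [this, Real.volume_pi_Ioc]
  simp

omit [NormedSpace ℂ E] in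
lemma integrableOn_unitCube {u : (Fin d → ℝ) → E} (hu : Continuous u) :
    IntegrableOn u (unitCube d) :=
  (hu.continuousOn.integrableOn_compact isCompact_Icc).mono_set unitCube_subset

lemma norm_torusAvg_le {u : (Fin d → ℝ) → E} {C : ℝ}
    (hC : ∀ θ ∈ Set.Icc (0 : Fin d → ℝ) 1, ‖u θ‖ ≤ C) : ‖torusAvg u‖ ≤ C := by
  have h := norm_setIntegral_le_of_norm_le_const (μ := volume) (s := unitCube d) (f := u) (C := C)
    (by rw [volume_unitCube]; exact ENNReal.one_lt_top) fun x hx => hC x (unitCube_subset hx)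
  simpa [torusAvg, Measure.real, volume_unitCube] using h

/-- Differentiation of averages with respect to a translation parameter. -/
lemma hasFDerivAt_torusAvg {𝕜 V F : Type*} [RCLike 𝕜] [NormedAddCommGroup V] [NormedSpace 𝕜 V]
    [ProperSpace V] [NormedAddCommGroup F] [NormedSpace 𝕜 F] [NormedSpace ℝ F]
    {ι : (Fin d → ℝ) → V} (hι : Continuous ι) {W : Set V} (hW : IsOpen W)
    (hWι : ∀ θ, ∀ h ∈ W, ι θ + h ∈ W) {u : V → F} (hu : ContDiffOn 𝕜 1 u W) {h₀ : V} (h₀W : h₀ ∈ W) :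
    HasFDerivAt (fun h => ∫ θ in unitCube d, u (ι θ + h))
      (∫ θ in unitCube d, fderiv 𝕜 u (ι θ + h₀)) h₀ := by
  have hud : ∀ x ∈ W, DifferentiableAt 𝕜 u x := fun x hx =>
    (hu.differentiableOn (by simp)).differentiableAt (hW.mem_nhds hx)
  have hu' : ContinuousOn (fderiv 𝕜 u) W := hu.continuousOn_fderiv_of_isOpen hW (by simp)
  obtain ⟨δ, hδ, hball⟩ := Metric.isOpen_iff.1 hW h₀ h₀W
  have hcb : Metric.closedBall h₀ (δ / 2) ⊆ W :=
    (Metric.closedBall_subset_ball (by linarith)).trans hball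
  have hcont : ∀ h ∈ W, Continuous fun θ => fderiv 𝕜 u (ι θ + h) := fun h hh =>
    hu'.comp_continuous (hι.add continuous_const) fun θ => hWι θ h hh
  have hcont0 : ∀ h ∈ W, Continuous fun θ => u (ι θ + h) := fun h hh =>
    hu.continuousOn.comp_continuous (hι.add continuous_const) fun θ => hWι θ h hh
  obtain ⟨C, hC⟩ : ∃ C, ∀ p ∈ Metric.closedBall h₀ (δ / 2) ×ˢ Set.Icc (0 : Fin d → ℝ) 1,
      ‖fderiv 𝕜 u (ι p.2 + p.1)‖ ≤ C := by
    refine ((isCompact_closedBall h₀ (δ / 2)).prod isCompact_Icc).exists_bound_of_continuousOn ?_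
    refine hu'.comp (Continuous.continuousOn (by fun_prop)) fun p hp => hWι _ _ (hcb hp.1)
  have hfin : volume (unitCube d) ≠ ⊤ := by
    rw [volume_unitCube]
    exact ENNReal.one_ne_top
  refine hasFDerivAt_integral_of_dominated_of_fderiv_le (𝕜 := 𝕜)
    (s := Metric.closedBall h₀ (δ / 2)) (F' := fun h θ => fderiv 𝕜 u (ι θ + h))
    (bound := fun _ => C) (Metric.closedBall_mem_nhds _ (by positivity)) ?_ ?_ ?_ ?_ ?_ ?_
  · filter_upwards [hW.mem_nhds h₀W] with h hh
    exact (hcont0 h hh).aestronglyMeasurable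
  · exact ((hcont0 h₀ h₀W).continuousOn.integrableOn_compact isCompact_Icc).mono_set unitCube_subset
  · exact (hcont h₀ h₀W).aestronglyMeasurable
  · refine (ae_restrict_iff' measurableSet_unitCube).2 (Eventually.of_forall fun θ hθ h hh => ?_)
    exact hC (h, θ) ⟨hh, unitCube_subset hθ⟩
  · exact integrableOn_const hfin
  · refine Eventually.of_forall fun θ h hh => ?_
    have := (hud _ (hWι θ h (hcb hh))).hasFDerivAt
    simpa using! this.comp h ((hasFDerivAt_id h).const_add (ι θ))

/-- The derivatives of periodic functions have average zero. -/
lemma torusAvg_fderiv_apply [CompleteSpace E] {u : (Fin d → ℝ) → E} (hu : IsZPeriodic u)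
    (hs : ContDiff ℝ 1 u) (h : Fin d → ℝ) : torusAvg (fun θ => fderiv ℝ u θ h) = 0 := by
  -- The average of a translate does not depend on the translation; its derivative at 0, which is
  -- the average of the derivative, therefore vanishes.
  have h1 := hasFDerivAt_torusAvg (𝕜 := ℝ) (d := d) continuous_id isOpen_univ (by simp)
    hs.contDiffOn (h₀ := 0) (Set.mem_univ _)
  have h2 : (fun h : Fin d → ℝ => ∫ θ in unitCube d, u (id θ + h)) = fun _ => torusAvg u := by
    funext h
    exact torusAvg_comp_add hu h
  rw [h2] at h1
  have h3 := h1.unique (hasFDerivAt_const (torusAvg u) _)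
  have hint : IntegrableOn (fun θ => fderiv ℝ u θ) (unitCube d) :=
    ((hs.continuous_fderiv (by simp)).continuousOn.integrableOn_compact isCompact_Icc).mono_set
      unitCube_subset
  simp only [id, add_zero] at h3
  have h4 := ContinuousLinearMap.integral_apply hint h
  rw [h3] at h4
  simpa [torusAvg] using h4.symm

/-- Averages over the translates of the real torus in the complex strip coincide. -/
lemma torusAvg_complex_translate [FiniteDimensional ℂ E] {ξ : ℝ}
    {U : (Fin d → ℂ) → E} (hU : DifferentiableOn ℂ U (strip d ξ))
    (hper : IsZPeriodic fun θ => U (toC θ)) {z : Fin d → ℂ} (hz : z ∈ strip d ξ) :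
    torusAvg (fun θ => U (toC θ + z)) = torusAvg (fun θ => U (toC θ)) := by
  have : CompleteSpace E := FiniteDimensional.complete ℂ E
  have hadd : ∀ θ : Fin d → ℝ, ∀ h ∈ strip d ξ, toC θ + h ∈ strip d ξ := fun θ h hh j => by
    simpa [toC] using hh j
  have hU1 : ContDiffOn ℂ 1 U (strip d ξ) :=
    (contDiffOn_of_differentiableOn (isOpen_strip d ξ) hU).of_le (by exact_mod_cast le_top)
  -- The average is holomorphic in the translation h and constant for real h, hence constant on the
  -- strip.
  have h1 : DifferentiableOn ℂ (fun h => ∫ θ in unitCube d, U (toC θ + h)) (strip d ξ) := fun h hh =>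
    (hasFDerivAt_torusAvg (𝕜 := ℂ) (toCL d).continuous (isOpen_strip d ξ) hadd hU1
      hh).differentiableAt.differentiableWithinAt
  refine eqOn_strip_of_eq_real h1 (differentiableOn_const (torusAvg fun θ => U (toC θ)))
    (fun h => ?_) hz
  rw [← torusAvg_comp_add hper h]
  unfold torusAvg
  congr 1
  funext θ
  congr 1
  funext j
  simp [toC]

end DelayTorus
end

/-! ### Characters, Fourier coefficients and their decay. -/

noncomputable section
namespace DelayTorus
open Asymptotics Filter MeasureTheory

variable {d n : ℕ}

/-- The linear form `2πi k · z`. -/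
def phaseCL {d : ℕ} (k : Fin d → ℤ) : (Fin d → ℂ) →L[ℂ] ℂ :=
  (2 * Real.pi * Complex.I : ℂ) • ∑ j, (k j : ℂ) • ContinuousLinearMap.proj j

lemma phaseCL_apply (k : Fin d → ℤ) (z : Fin d → ℂ) :
    phaseCL k z = 2 * Real.pi * Complex.I * ∑ j, (k j : ℂ) * z j := by
  simp [phaseCL]

lemma phaseCL_toC (k : Fin d → ℤ) (ω : Fin d → ℝ) :
    phaseCL k (toC ω) = 2 * Real.pi * Complex.I * (dotZ ω k : ℂ) := by
  rw [phaseCL_apply]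
  simp [dotZ, toC, mul_comm]

lemma phaseCL_neg (k : Fin d → ℤ) (z : Fin d → ℂ) : phaseCL (-k) z = -phaseCL k z := by
  simp [phaseCL_apply]

lemma norm1_nonneg (k : Fin d → ℤ) : 0 ≤ norm1 k := Finset.sum_nonneg fun _ _ => abs_nonneg _

lemma abs_le_norm1 (k : Fin d → ℤ) (j : Fin d) : |(k j : ℝ)| ≤ norm1 k :=
  Finset.single_le_sum (f := fun j => |(k j : ℝ)|) (fun _ _ => abs_nonneg _) (Finset.mem_univ j)

lemma one_le_norm1 {k : Fin d → ℤ} (hk : k ≠ 0) : 1 ≤ norm1 k := by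
  obtain ⟨j, hj⟩ := Function.ne_iff.1 hk
  refine le_trans ?_ (abs_le_norm1 k j)
  exact_mod_cast Int.one_le_abs hj

lemma norm_phaseCL_apply_le (k : Fin d → ℤ) (z : Fin d → ℂ) :
    ‖phaseCL k z‖ ≤ 2 * Real.pi * norm1 k * ‖z‖ := by
  rw [phaseCL_apply, norm_mul, mul_assoc _ (norm1 k)]
  have h1 : ‖(2 * Real.pi * Complex.I : ℂ)‖ = 2 * Real.pi := by
    simp [abs_of_pos Real.pi_pos]
  rw [h1]
  gcongr
  rw [norm1, Finset.sum_mul]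
  refine (norm_sum_le _ _).trans (Finset.sum_le_sum fun j _ => ?_)
  rw [norm_mul, Complex.norm_intCast]
  gcongr
  exact norm_le_pi_norm z j

lemma norm_phaseCL_le (k : Fin d → ℤ) : ‖phaseCL k‖ ≤ 2 * Real.pi * norm1 k :=
  ContinuousLinearMap.opNorm_le_bound _
    (by have := norm1_nonneg k; positivity) (norm_phaseCL_apply_le k)

/-- The character `e^{2πi k · z}`. -/
def torusChar {d : ℕ} (k : Fin d → ℤ) (z : Fin d → ℂ) : ℂ := Complex.exp (phaseCL k z)

lemma torusChar_zero (z : Fin d → ℂ) : torusChar 0 z = 1 := by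
  simp [torusChar, phaseCL_apply]

lemma torusChar_periodic (k : Fin d → ℤ) : IsZPeriodic (torusChar k) := by
  intro z m
  have h : phaseCL k (fun j => z j + (m j : ℂ)) =
      phaseCL k z + ((∑ j, k j * m j : ℤ) : ℂ) * (2 * Real.pi * Complex.I) := by
    simp only [phaseCL_apply, mul_add, Finset.sum_add_distrib]
    push_cast
    ring
  rw [torusChar, torusChar, h, Complex.exp_add, Complex.exp_int_mul_two_pi_mul_I, mul_one]

lemma toC_add_int (θ : Fin d → ℝ) (m : Fin d → ℤ) :
    toC (fun j => θ j + (m j : ℝ)) = fun j => toC θ j + (m j : ℂ) := by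
  funext j
  simp [toC]

lemma torusChar_toC_periodic (k : Fin d → ℤ) : IsZPeriodic fun θ => torusChar k (toC θ) := by
  intro θ m
  simp only [toC_add_int]
  exact torusChar_periodic k (toC θ) m

lemma norm_torusChar (k : Fin d → ℤ) (z : Fin d → ℂ) :
    ‖torusChar k z‖ = Real.exp (-(2 * Real.pi * ∑ j, (k j : ℝ) * (z j).im)) := by
  rw [torusChar, Complex.norm_exp, phaseCL_apply]
  congr 1
  have : ((∑ j, (k j : ℂ) * z j)).im = ∑ j, (k j : ℝ) * (z j).im := by
    simp [Complex.im_sum]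
  rw [← this]
  simp [Complex.mul_re]

lemma norm_torusChar_toC (k : Fin d → ℤ) (θ : Fin d → ℝ) : ‖torusChar k (toC θ)‖ = 1 := by
  rw [norm_torusChar]
  simp [toC]

lemma hasFDerivAt_torusChar (k : Fin d → ℤ) (z : Fin d → ℂ) :
    HasFDerivAt (torusChar k) (torusChar k z • phaseCL k) z :=
  (phaseCL k).hasFDerivAt.cexp

lemma hasFDerivAt_torusChar_toC (k : Fin d → ℤ) (θ : Fin d → ℝ) :
    HasFDerivAt (fun θ => torusChar k (toC θ))
      (((torusChar k (toC θ) • phaseCL k).restrictScalars ℝ).comp (toCL d)) θ :=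
  ((hasFDerivAt_torusChar k (toC θ)).restrictScalars ℝ).comp θ (toCL d).hasFDerivAt

lemma contDiff_torusChar_toC (k : Fin d → ℤ) {m : WithTop ℕ∞} :
    ContDiff ℝ m fun θ => torusChar k (toC θ) :=
  (((phaseCL k).restrictScalars ℝ).comp (toCL d)).contDiff.cexp

/-- The Fourier coefficients of a periodic function. -/
def fourierCoef {E : Type*} [NormedAddCommGroup E] [NormedSpace ℂ E]
    (u : (Fin d → ℝ) → E) (k : Fin d → ℤ) : E :=
  torusAvg fun θ => torusChar (-k) (toC θ) • u θ

section

variable {E : Type*} [NormedAddCommGroup E] [NormedSpace ℂ E]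

lemma fourierCoef_zero (u : (Fin d → ℝ) → E) : fourierCoef u 0 = torusAvg u := by
  simp [fourierCoef, torusChar_zero]

lemma IsZPeriodic.char_smul {u : (Fin d → ℝ) → E} (hu : IsZPeriodic u) (k : Fin d → ℤ) :
    IsZPeriodic fun θ => torusChar k (toC θ) • u θ := fun θ m => by
  have h1 := torusChar_toC_periodic k θ m
  simp only at h1 ⊢
  rw [h1, hu θ m]

lemma norm_fourierCoef_le {u : (Fin d → ℝ) → E} {C : ℝ}
    (hC : ∀ θ ∈ Set.Icc (0 : Fin d → ℝ) 1, ‖u θ‖ ≤ C) (k : Fin d → ℤ) : ‖fourierCoef u k‖ ≤ C :=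
  norm_torusAvg_le fun θ hθ => by
    rw [norm_smul, norm_torusChar_toC, one_mul]
    exact hC θ hθ

/-- The Fourier coefficients of derivatives. -/
lemma fourierCoef_fderiv [CompleteSpace E] {u : (Fin d → ℝ) → E} (hu : IsZPeriodic u)
    (hs : ContDiff ℝ 1 u) (h : Fin d → ℝ) (k : Fin d → ℤ) :
    fourierCoef (fun θ => fderiv ℝ u θ h) k = phaseCL k (toC h) • fourierCoef u k := by
  have h1 := torusAvg_fderiv_apply (hu.char_smul (-k)) ((contDiff_torusChar_toC (-k)).smul hs) h
  have h2 : ∀ θ, fderiv ℝ (fun θ => torusChar (-k) (toC θ) • u θ) θ h =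
      torusChar (-k) (toC θ) • fderiv ℝ u θ h -
        phaseCL k (toC h) • torusChar (-k) (toC θ) • u θ := by
    intro θ
    have h3 := (hasFDerivAt_torusChar_toC (-k) θ).fun_smul (hs.differentiable (by simp) θ).hasFDerivAt
    rw [h3.fderiv]
    simp [toCL_apply, phaseCL_neg, smul_smul, mul_comm, sub_eq_add_neg]
  have hc1 : Continuous fun θ => torusChar (-k) (toC θ) • fderiv ℝ u θ h :=
    (contDiff_torusChar_toC (-k) (m := 1)).continuous.smul
      ((hs.continuous_fderiv (by simp)).clm_apply continuous_const)
  have hc2 : Continuous fun θ => torusChar (-k) (toC θ) • u θ :=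
    (contDiff_torusChar_toC (-k) (m := 1)).continuous.smul hs.continuous
  simp only [h2, torusAvg] at h1
  rw [integral_sub (f := fun θ => torusChar (-k) (toC θ) • fderiv ℝ u θ h)
    (g := fun θ => phaseCL k (toC h) • torusChar (-k) (toC θ) • u θ) (integrableOn_unitCube hc1)
    (integrableOn_unitCube (hc2.const_smul (phaseCL k (toC h)))), integral_smul, sub_eq_zero] at h1
  exact h1

end

/-- Periodic functions with absolutely convergent Fourier series are the sums of these series. -/
lemma hasSum_fourierCoef_scalar {u : (Fin d → ℝ) → ℂ} (hu : IsZPeriodic u) (hc : Continuous u)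
    (hsum : Summable (fourierCoef u)) (θ : Fin d → ℝ) :
    HasSum (fun k => torusChar k (toC θ) • fourierCoef u k) (u θ) := by
  have hchar : ∀ k (θ : Fin d → ℝ), UnitAddTorus.mFourier k (fun i => (θ i : UnitAddCircle)) =
      torusChar k (toC θ) := by
    intro k θ
    simp only [UnitAddTorus.mFourier, ContinuousMap.coe_mk, fourier_coe_apply, torusChar,
      phaseCL_apply, toC, ← Complex.exp_sum, Finset.mul_sum]
    congr 1
    refine Finset.sum_congr rfl fun j _ => ?_
    push_cast
    ring
  set v : C(UnitAddTorus (Fin d), ℂ) := ⟨descend u, continuous_descend hu hc⟩ with hv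
  have hcoef : UnitAddTorus.mFourierCoeff v = fourierCoef u := by
    funext k
    rw [UnitAddTorus.mFourierCoeff_eq_integral _ _ 0]
    simp only [hchar, hv, ContinuousMap.coe_mk, descend_coe hu]
    rfl
  have h := UnitAddTorus.hasSum_mFourier_series_apply_of_summable (f := v) (by rwa [hcoef])
    (fun i => (θ i : UnitAddCircle))
  rw [hcoef] at h
  simp only [hchar, hv, ContinuousMap.coe_mk, descend_coe hu, smul_eq_mul] at h
  simpa [mul_comm] using h

lemma hasSum_fourierCoef {u : (Fin d → ℝ) → Fin n → ℂ} (hu : IsZPeriodic u) (hc : Continuous u)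
    (hsum : Summable (fourierCoef u)) (θ : Fin d → ℝ) :
    HasSum (fun k => torusChar k (toC θ) • fourierCoef u k) (u θ) := by
  have hcomp : ∀ i, fourierCoef (fun θ => u θ i) = fun k => fourierCoef u k i := by
    intro i
    funext k
    have hcont : Continuous fun θ => torusChar (-k) (toC θ) • u θ :=
      (contDiff_torusChar_toC (-k) (m := 1)).continuous.smul hc
    have := (ContinuousLinearMap.proj (R := ℂ) (φ := fun _ : Fin n => ℂ) i).integral_comp_comm
      (integrableOn_unitCube hcont)
    exact this
  rw [Pi.hasSum]
  intro i
  have hui : IsZPeriodic fun θ => u θ i := fun θ m => congrFun (hu θ m) i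
  have h := hasSum_fourierCoef_scalar hui ((continuous_apply i).comp hc)
    (by rw [hcomp]; exact Pi.summable.1 hsum i) θ
  simpa [hcomp] using h

/-! ### Decay of coefficients -/

/-- Decay faster than any power. -/
def RapidDecay {E : Type*} [NormedAddCommGroup E] (a : (Fin d → ℤ) → E) : Prop :=
  ∀ N : ℕ, ∃ C, ∀ k, (1 + norm1 k) ^ N * ‖a k‖ ≤ C

/-- Exponential decay at every rate below `2πξ`. -/
def ExpDecay {E : Type*} [NormedAddCommGroup E] (ξ : ℝ) (a : (Fin d → ℤ) → E) : Prop :=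
  ∀ ξ', 0 < ξ' → ξ' < ξ → ∃ C, ∀ k, Real.exp (2 * Real.pi * ξ' * norm1 k) * ‖a k‖ ≤ C

/-- A finite set of multi-indices lies in a box, and over a box the sum of products factorizes. -/
lemma summable_of_pi_prod {ι : Type*} {g : ι → ℝ} (hg0 : ∀ i, 0 ≤ g i) (hg : Summable g) (d : ℕ) :
    Summable fun k : Fin d → ι => ∏ j, g (k j) := by
  classical
  refine summable_of_sum_le (c := (∑' i, g i) ^ d)
    (fun k => Finset.prod_nonneg fun j _ => hg0 _) fun s => ?_
  calc ∑ k ∈ s, ∏ j, g (k j)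
      ≤ ∑ k ∈ Fintype.piFinset fun j : Fin d => s.image fun k => k j, ∏ j, g (k j) := by
        refine Finset.sum_le_sum_of_subset_of_nonneg (fun k hk => ?_)
          fun k _ _ => Finset.prod_nonneg fun j _ => hg0 _
        exact Fintype.mem_piFinset.2 fun j => Finset.mem_image_of_mem _ hk
    _ = ∏ j : Fin d, ∑ i ∈ s.image fun k => k j, g i := (Finset.prod_univ_sum _ _).symm
    _ ≤ ∏ j : Fin d, ∑' i, g i := by
        refine Finset.prod_le_prod (fun j _ => Finset.sum_nonneg fun i _ => hg0 _) fun j _ => ?_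
        exact hg.sum_le_tsum _ fun i _ => hg0 i
    _ = _ := by simp

/-- Each of the d factors (1 + |k_j|)² is at most (1 + |k|)², which explains the exponent 2d. -/
lemma summable_norm1_pow_inv (d : ℕ) :
    Summable fun k : Fin d → ℤ => ((1 + norm1 k) ^ (2 * d))⁻¹ := by
  have h1 : Summable fun m : ℤ => ((1 + |(m : ℝ)|) ^ 2)⁻¹ := by
    have h2 : Summable fun m : ℤ => 1 / (m : ℝ) ^ 2 :=
      Real.summable_one_div_int_pow.2 one_lt_two
    refine Summable.of_norm_bounded_eventually h2 ?_
    have h3 : ∀ᶠ m : ℤ in cofinite, m ≠ 0 := (Set.finite_singleton (0 : ℤ)).eventually_cofinite_notMem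
    filter_upwards [h3] with m hm
    have hm' : (m : ℝ) ≠ 0 := by exact_mod_cast hm
    rw [Real.norm_of_nonneg (by positivity), one_div, ← sq_abs (m : ℝ)]
    have : 0 < |(m : ℝ)| := abs_pos.2 hm'
    gcongr
    linarith
  refine Summable.of_nonneg_of_le (fun k => ?_) (fun k => ?_)
    (summable_of_pi_prod (fun m : ℤ => by positivity) h1 d)
  · have := norm1_nonneg k
    positivity
  · rw [Finset.prod_inv_distrib]
    have : ∏ j, (1 + |(k j : ℝ)|) ^ 2 ≤ (1 + norm1 k) ^ (2 * d) := by
      calc ∏ j, (1 + |(k j : ℝ)|) ^ 2 ≤ ∏ j : Fin d, (1 + norm1 k) ^ 2 := by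
            refine Finset.prod_le_prod (fun j _ => by positivity) fun j _ => ?_
            have := abs_le_norm1 k j
            gcongr
        _ = _ := by simp [pow_mul]
    have h0 : 0 < ∏ j, (1 + |(k j : ℝ)|) ^ 2 := Finset.prod_pos fun j _ => by positivity
    gcongr

/-- A single term of the exponential series at c(1 + t) is at most the whole sum; the surplus e^c
enters the constant. -/
lemma one_add_pow_le_exp (N : ℕ) {c : ℝ} (hc : 0 < c) :
    ∃ B : ℝ, 0 ≤ B ∧ ∀ t : ℝ, 0 ≤ t → (1 + t) ^ N ≤ B * Real.exp (c * t) := by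
  refine ⟨N.factorial / c ^ N * Real.exp c, by positivity, fun t ht => ?_⟩
  have h1 := Real.pow_div_factorial_le_exp (c * (1 + t)) (by positivity) N
  rw [div_le_iff₀ (by positivity), mul_pow, mul_add, Real.exp_add, mul_one] at h1
  rw [div_mul_eq_mul_div, div_mul_eq_mul_div, le_div_iff₀ (by positivity)]
  nlinarith

section

variable {E : Type*} [NormedAddCommGroup E]

lemma RapidDecay.summable {a : (Fin d → ℤ) → E} (ha : RapidDecay a) (N : ℕ) :
    Summable fun k => (1 + norm1 k) ^ N * ‖a k‖ := by
  obtain ⟨C, hC⟩ := ha (N + 2 * d)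
  refine Summable.of_nonneg_of_le (fun k => ?_) (fun k => ?_)
    ((summable_norm1_pow_inv d).mul_left C)
  · have := norm1_nonneg k
    positivity
  · have h0 := norm1_nonneg k
    have h1 := hC k
    rw [pow_add] at h1
    rw [← div_eq_mul_inv, le_div_iff₀ (by positivity)]
    linarith

/-- Exponential decay is rapid decay. -/
lemma ExpDecay.rapidDecay {ξ : ℝ} (hξ : 0 < ξ) {a : (Fin d → ℤ) → E} (ha : ExpDecay ξ a) :
    RapidDecay a := by
  intro N
  obtain ⟨C, hC⟩ := ha (ξ / 2) (by positivity) (by linarith)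
  set c : ℝ := 2 * Real.pi * (ξ / 2) with hc
  have hc0 : 0 < c := by have := Real.pi_pos; positivity
  obtain ⟨B, hB0, key⟩ := one_add_pow_le_exp N hc0
  refine ⟨B * C, fun k => ?_⟩
  have h2 := key (norm1 k) (norm1_nonneg k)
  calc (1 + norm1 k) ^ N * ‖a k‖
      ≤ B * Real.exp (c * norm1 k) * ‖a k‖ := by gcongr
    _ = B * (Real.exp (c * norm1 k) * ‖a k‖) := by ring
    _ ≤ _ := by
      have := hC k
      gcongr

lemma RapidDecay.summable' [CompleteSpace E] {a : (Fin d → ℤ) → E} (ha : RapidDecay a) :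
    Summable a := by
  have := ha.summable 0
  simp only [pow_zero, one_mul] at this
  exact this.of_norm

end

/-- The Fourier coefficients of smooth functions decay rapidly. -/
lemma rapidDecay_fourierCoef {E : Type*} [NormedAddCommGroup E] [NormedSpace ℂ E] [CompleteSpace E]
    {u : (Fin d → ℝ) → E} (hu : IsZPeriodic u)
    (hs : ContDiff ℝ (⊤ : ℕ∞) u) : RapidDecay (fourierCoef u) := by
  have hbd : ∀ u : (Fin d → ℝ) → E, Continuous u → ∃ C, 0 ≤ C ∧ ∀ k, ‖fourierCoef u k‖ ≤ C := by
    intro u hc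
    obtain ⟨C, hC⟩ := (isCompact_Icc (a := (0 : Fin d → ℝ)) (b := 1)).exists_bound_of_continuousOn
      hc.continuousOn
    exact ⟨|C|, abs_nonneg _, norm_fourierCoef_le fun θ hθ => (hC θ hθ).trans (le_abs_self _)⟩
  have hcoord : ∀ (N : ℕ) (j : Fin d) (u : (Fin d → ℝ) → E), IsZPeriodic u →
      ContDiff ℝ (⊤ : ℕ∞) u → ∃ C, 0 ≤ C ∧ ∀ k, |(k j : ℝ)| ^ N * ‖fourierCoef u k‖ ≤ C := by
    intro N j
    induction N with
    | zero =>
      intro u _ hs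
      simpa using hbd u hs.continuous
    | succ N ih =>
      intro u hu hs
      have hs' : ContDiff ℝ (⊤ : ℕ∞) fun θ => fderiv ℝ u θ (Pi.single j 1) :=
        (hs.fderiv_right (m := ((⊤ : ℕ∞) : WithTop ℕ∞)) (by simp)).clm_apply contDiff_const
      have hu' : IsZPeriodic fun θ => fderiv ℝ u θ (Pi.single j 1) := fun θ m => by
        simp only [hu.fderiv θ m]
      obtain ⟨C, hC0, hC⟩ := ih _ hu' hs'
      refine ⟨C, hC0, fun k => le_trans ?_ (hC k)⟩
      rw [fourierCoef_fderiv hu (hs.of_le (by exact_mod_cast le_top)), norm_smul]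
      have h1 : phaseCL k (toC (Pi.single j 1)) = 2 * Real.pi * Complex.I * (k j : ℂ) := by
        rw [phaseCL_toC]
        simp [dotZ, Pi.single_apply]
      have h2 : |(k j : ℝ)| ≤ ‖phaseCL k (toC (Pi.single j 1))‖ := by
        rw [h1, norm_mul, Complex.norm_intCast]
        have : ‖(2 * Real.pi * Complex.I : ℂ)‖ = 2 * Real.pi := by simp [abs_of_pos Real.pi_pos]
        rw [this]
        have h3 := Real.pi_gt_three
        nlinarith [abs_nonneg (k j : ℝ)]
      calc |(k j : ℝ)| ^ (N + 1) * ‖fourierCoef u k‖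
          = |(k j : ℝ)| ^ N * (|(k j : ℝ)| * ‖fourierCoef u k‖) := by ring
        _ ≤ _ := by gcongr
  intro N
  choose C hC0 hC using fun j => hcoord N j u hu hs
  obtain ⟨C', hC0', hC'⟩ := hbd u hs.continuous
  refine ⟨((d : ℝ) + 1) ^ N * (C' + ∑ j, C j), fun k => ?_⟩
  -- The ℓ¹ norm is compared with the largest |k_j|, for which the estimate by the j-th derivatives
  -- is available; when all |k_j| ≤ 1, take t = 1 and the plain bound.
  have hmax : ∃ t : ℝ, 0 ≤ t ∧ 1 + norm1 k ≤ ((d : ℝ) + 1) * t ∧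
      t ^ N * ‖fourierCoef u k‖ ≤ C' + ∑ j, C j := by
    have hsum0 : 0 ≤ ∑ j, C j := Finset.sum_nonneg fun j _ => hC0 j
    by_cases hk : ∀ j, |(k j : ℝ)| ≤ 1
    · refine ⟨1, zero_le_one, ?_, ?_⟩
      · have : norm1 k ≤ ∑ _j : Fin d, (1 : ℝ) := Finset.sum_le_sum fun j _ => hk j
        simp at this
        linarith
      · rw [one_pow, one_mul]
        linarith [hC' k]
    · push Not at hk
      obtain ⟨j₀, hj₀⟩ := hk
      obtain ⟨j, -, hj⟩ := Finset.exists_max_image Finset.univ (fun j => |(k j : ℝ)|)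
        ⟨j₀, Finset.mem_univ _⟩
      refine ⟨|(k j : ℝ)|, abs_nonneg _, ?_, ?_⟩
      · have h1 : norm1 k ≤ ∑ _j : Fin d, |(k j : ℝ)| := Finset.sum_le_sum fun i hi => hj i hi
        simp at h1
        have h2 := hj j₀ (Finset.mem_univ _)
        linarith
      · have h1 := Finset.single_le_sum (f := C) (fun i _ => hC0 i) (Finset.mem_univ j)
        linarith [hC j k]
  obtain ⟨t, ht0, ht, htC⟩ := hmax
  have h0 := norm1_nonneg k
  calc (1 + norm1 k) ^ N * ‖fourierCoef u k‖
      ≤ (((d : ℝ) + 1) * t) ^ N * ‖fourierCoef u k‖ := by gcongr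
    _ = ((d : ℝ) + 1) ^ N * (t ^ N * ‖fourierCoef u k‖) := by rw [mul_pow]; ring
    _ ≤ _ := by gcongr

/-- The Fourier coefficients of functions that are analytic on a strip decay exponentially. -/
lemma expDecay_fourierCoef {E : Type*} [NormedAddCommGroup E] [NormedSpace ℂ E]
    [FiniteDimensional ℂ E] {ξ : ℝ} {U : (Fin d → ℂ) → E} (hU : DifferentiableOn ℂ U (strip d ξ))
    (hper : IsZPeriodic fun θ => U (toC θ)) : ExpDecay ξ (fourierCoef fun θ => U (toC θ)) := by
  intro ξ' h0 hlt
  have hcpt : IsCompact (Set.Icc (0 : Fin d → ℝ) 1 ×ˢ Metric.closedBall (0 : Fin d → ℝ) ξ') :=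
    isCompact_Icc.prod (isCompact_closedBall _ _)
  set Z : (Fin d → ℝ) × (Fin d → ℝ) → Fin d → ℂ := fun p => toC p.1 + Complex.I • toC p.2 with hZ
  have hZc : Continuous Z := by
    have h1 := (toCL d).continuous
    exact (h1.comp continuous_fst).add ((h1.comp continuous_snd).const_smul Complex.I)
  have hZim : ∀ p j, (Z p j).im = p.2 j := fun p j => by simp [hZ, toC]
  have hZs : ∀ p : (Fin d → ℝ) × (Fin d → ℝ), p.2 ∈ Metric.closedBall (0 : Fin d → ℝ) ξ' →
      Z p ∈ strip d ξ := fun p hp j => by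
    rw [hZim]
    have h1 := norm_le_pi_norm p.2 j
    rw [mem_closedBall_zero_iff] at hp
    rw [Real.norm_eq_abs] at h1
    linarith
  obtain ⟨C, hC⟩ := hcpt.exists_bound_of_continuousOn (f := fun p => U (Z p))
    (hU.continuousOn.comp hZc.continuousOn fun p hp => hZs p hp.2)
  refine ⟨C, fun k => ?_⟩
  -- On the translate of the torus by iy the character of −k has modulus exp(−2πξ'|k|), and the
  -- translation does not change the average.
  set y : Fin d → ℝ := fun j => -(ξ' * SignType.sign (k j : ℝ)) with hy
  have hyb : y ∈ Metric.closedBall (0 : Fin d → ℝ) ξ' := by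
    rw [mem_closedBall_zero_iff, pi_norm_le_iff_of_nonneg h0.le]
    intro j
    rw [Real.norm_eq_abs, abs_neg, abs_mul, abs_of_pos h0]
    rcases lt_trichotomy (k j : ℝ) 0 with h | h | h <;> simp [h, h0.le]
  have hsum : ∑ j, ((-k) j : ℝ) * y j = ξ' * norm1 k := by
    rw [norm1, Finset.mul_sum]
    refine Finset.sum_congr rfl fun j _ => ?_
    simp only [hy, Pi.neg_apply, Int.cast_neg, neg_mul_neg]
    rw [← self_mul_sign (k j : ℝ)]
    ring
  have hUk : DifferentiableOn ℂ (fun z => torusChar (-k) z • U z) (strip d ξ) := fun z hz =>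
    (hasFDerivAt_torusChar (-k) z).differentiableAt.differentiableWithinAt.smul (hU z hz)
  have hz : Complex.I • toC y ∈ strip d ξ := by
    have := hZs (0, y) hyb
    have h0 : Z (0, y) = Complex.I • toC y := by
      funext j
      simp [hZ, toC]
    rwa [h0] at this
  have htr : torusAvg (fun θ => torusChar (-k) (toC θ + Complex.I • toC y) •
      U (toC θ + Complex.I • toC y)) = fourierCoef (fun θ => U (toC θ)) k :=
    torusAvg_complex_translate hUk (hper.char_smul (-k)) hz
  rw [← htr]
  have hbound : ‖torusAvg (fun θ => torusChar (-k) (toC θ + Complex.I • toC y) •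
      U (toC θ + Complex.I • toC y))‖ ≤ Real.exp (-(2 * Real.pi * ξ' * norm1 k)) * C := by
    refine norm_torusAvg_le fun θ hθ => ?_
    have h1 : ‖torusChar (-k) (toC θ + Complex.I • toC y)‖ =
        Real.exp (-(2 * Real.pi * ξ' * norm1 k)) := by
      rw [norm_torusChar]
      have h2 : ∀ j, ((toC θ + Complex.I • toC y) j).im = y j := fun j => hZim (θ, y) j
      simp only [h2]
      rw [mul_assoc _ ξ', ← hsum]
    rw [norm_smul, h1]
    gcongr
    exact hC (θ, y) ⟨hθ, hyb⟩
  calc _ ≤ Real.exp (2 * Real.pi * ξ' * norm1 k) *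
        (Real.exp (-(2 * Real.pi * ξ' * norm1 k)) * C) := by gcongr
    _ = C := by rw [← mul_assoc, ← Real.exp_add, add_neg_cancel, Real.exp_zero, one_mul]

end DelayTorus
end

/-! ### Sums of Fourier series, small divisors and the cohomological equation. -/

noncomputable section
namespace DelayTorus
open Asymptotics Filter MeasureTheory

variable {d n : ℕ}

section Series

variable {E : Type*} [NormedAddCommGroup E] [NormedSpace ℂ E]

/-- The sum of a Fourier series, on `ℂᵈ`. -/
def fourierSeries (b : (Fin d → ℤ) → E) (z : Fin d → ℂ) : E := ∑' k, torusChar k z • b k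

lemma fourierSeries_periodic (b : (Fin d → ℤ) → E) :
    IsZPeriodic fun θ => fourierSeries b (toC θ) := by
  intro θ m
  simp only [fourierSeries]
  refine tsum_congr fun k => ?_
  have := torusChar_toC_periodic k θ m
  simp only at this
  rw [this]

lemma RapidDecay.phase_smul {b : (Fin d → ℤ) → E} (hb : RapidDecay b) (z : Fin d → ℂ) :
    RapidDecay fun k => phaseCL k z • b k := by
  intro N
  obtain ⟨C, hC⟩ := hb (N + 1)
  refine ⟨2 * Real.pi * ‖z‖ * C, fun k => ?_⟩
  have h0 := norm1_nonneg k
  rw [norm_smul]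
  calc (1 + norm1 k) ^ N * (‖phaseCL k z‖ * ‖b k‖)
      ≤ (1 + norm1 k) ^ N * ((2 * Real.pi * (1 + norm1 k) * ‖z‖) * ‖b k‖) := by
        have h1 := norm_phaseCL_apply_le k z
        have h2 : 2 * Real.pi * norm1 k * ‖z‖ ≤ 2 * Real.pi * (1 + norm1 k) * ‖z‖ := by
          have := Real.pi_pos
          gcongr
          linarith
        have h3 := h1.trans h2
        gcongr
    _ = 2 * Real.pi * ‖z‖ * ((1 + norm1 k) ^ (N + 1) * ‖b k‖) := by ring
    _ ≤ _ := by
        have := hC k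
        have := Real.pi_pos
        gcongr

lemma summable_char_smul [CompleteSpace E] {b : (Fin d → ℤ) → E} (hb : RapidDecay b)
    (θ : Fin d → ℝ) : Summable fun k => torusChar k (toC θ) • b k := by
  refine Summable.of_norm ?_
  simpa [norm_smul, norm_torusChar_toC] using hb.summable 0

/-- Termwise differentiation. -/
lemma hasFDerivAt_fourierSeries [CompleteSpace E] {b : (Fin d → ℤ) → E} (hb : RapidDecay b)
    (θ : Fin d → ℝ) : ∃ D : (Fin d → ℝ) →L[ℝ] E,
      HasFDerivAt (fun θ => fourierSeries b (toC θ)) D θ ∧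
      ∀ h, D h = fourierSeries (fun k => phaseCL k (toC h) • b k) (toC θ) := by
  set D : (Fin d → ℤ) → (Fin d → ℝ) → (Fin d → ℝ) →L[ℝ] E := fun k θ =>
    (((torusChar k (toC θ) • phaseCL k).restrictScalars ℝ).comp (toCL d)).smulRight (b k) with hD
  have hbound : ∀ k θ, ‖D k θ‖ ≤ 2 * Real.pi * ((1 + norm1 k) ^ 1 * ‖b k‖) := by
    intro k θ
    refine ContinuousLinearMap.opNorm_le_bound _ ?_ fun h => ?_
    · have := norm1_nonneg k
      have := Real.pi_pos
      positivity
    · have h1 : D k θ h = (torusChar k (toC θ) * phaseCL k (toC h)) • b k := by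
        simp [hD, toCL_apply]
      rw [h1, norm_smul, norm_mul, norm_torusChar_toC, one_mul, pow_one]
      have h2 := norm_phaseCL_apply_le k (toC h)
      rw [norm_toC] at h2
      have h3 : 2 * Real.pi * norm1 k * ‖h‖ ≤ 2 * Real.pi * (1 + norm1 k) * ‖h‖ := by
        have := Real.pi_pos
        gcongr
        linarith
      calc _ ≤ 2 * Real.pi * (1 + norm1 k) * ‖h‖ * ‖b k‖ := by
            have := h2.trans h3
            gcongr
        _ = _ := by ring
  have hsumm : Summable fun k => 2 * Real.pi * ((1 + norm1 k) ^ 1 * ‖b k‖) :=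
    (hb.summable 1).mul_left _
  refine ⟨∑' k, D k θ, ?_, fun h => ?_⟩
  · exact hasFDerivAt_tsum hsumm (f := fun k θ => torusChar k (toC θ) • b k)
      (fun k θ => (hasFDerivAt_torusChar_toC k θ).smul_const (b k)) hbound
      (summable_char_smul hb 0) θ
  · have hs : Summable fun k => D k θ := Summable.of_norm_bounded hsumm fun k => hbound k θ
    have h1 := (ContinuousLinearMap.apply ℝ E h).map_tsum hs
    simp only [ContinuousLinearMap.apply_apply] at h1
    rw [h1]
    refine tsum_congr fun k => ?_
    simp [hD, toCL_apply, smul_smul]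

/-- Directional derivatives are again Fourier series with rapidly decaying coefficients, so
induction on the order applies. -/
lemma contDiff_fourierSeries [CompleteSpace E] {b : (Fin d → ℤ) → E} (hb : RapidDecay b) :
    ContDiff ℝ (⊤ : ℕ∞) fun θ => fourierSeries b (toC θ) := by
  rw [contDiff_infty]
  intro m
  induction m generalizing b with
  | zero =>
    refine contDiff_zero.2 (continuous_iff_continuousAt.2 fun θ => ?_)
    obtain ⟨D, hD, -⟩ := hasFDerivAt_fourierSeries hb θ
    exact hD.continuousAt
  | succ m ih =>
    push_cast
    refine contDiff_succ_iff_fderiv_apply.2 ⟨fun θ => ?_, by simp, fun h => ?_⟩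
    · obtain ⟨D, hD, -⟩ := hasFDerivAt_fourierSeries hb θ
      exact hD.differentiableAt
    · convert ih (hb.phase_smul (toC h)) using 1
      funext θ
      obtain ⟨D, hD, hDh⟩ := hasFDerivAt_fourierSeries hb θ
      rw [hD.fderiv, hDh]

lemma norm_torusChar_le {ξ : ℝ} (k : Fin d → ℤ) {z : Fin d → ℂ} (hz : z ∈ strip d ξ) :
    ‖torusChar k z‖ ≤ Real.exp (2 * Real.pi * ξ * norm1 k) := by
  rw [norm_torusChar]
  refine Real.exp_le_exp.2 ?_
  have h1 : |∑ j, (k j : ℝ) * (z j).im| ≤ ξ * norm1 k := by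
    rw [norm1, Finset.mul_sum]
    refine (Finset.abs_sum_le_sum_abs _ _).trans (Finset.sum_le_sum fun j _ => ?_)
    rw [abs_mul, mul_comm]
    have := (hz j).le
    gcongr
  have h2 := neg_le_of_abs_le h1
  have := Real.pi_pos
  nlinarith

-- The weight bounds the characters on the strip of width ξ'; exponential decay at every rate below
-- 2π(ξ − ξ') is left over.
omit [NormedSpace ℂ E] in
lemma ExpDecay.rapidDecay_mul_exp {ξ ξ' : ℝ} (h0 : 0 ≤ ξ') (hlt : ξ' < ξ) {b : (Fin d → ℤ) → E}
    (hb : ExpDecay ξ b) :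
    RapidDecay fun k => Real.exp (2 * Real.pi * ξ' * norm1 k) * ‖b k‖ := by
  refine ExpDecay.rapidDecay (sub_pos.2 hlt) fun η hη hηlt => ?_
  obtain ⟨C, hC⟩ := hb (η + ξ') (by linarith) (by linarith)
  refine ⟨C, fun k => ?_⟩
  rw [norm_mul, norm_norm, Real.norm_of_nonneg (Real.exp_pos _).le, ← mul_assoc, ← Real.exp_add]
  convert hC k using 3
  ring

lemma exists_mem_strip_lt {ξ : ℝ} (hξ : 0 < ξ) {z : Fin d → ℂ} (hz : z ∈ strip d ξ) :
    ∃ ξ', 0 < ξ' ∧ ξ' < ξ ∧ z ∈ strip d ξ' := by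
  have h1 : ∀ᶠ ξ' in 𝓝[<] ξ, ∀ j, |(z j).im| < ξ' :=
    eventually_all.2 fun j => by
      filter_upwards [Ioo_mem_nhdsLT (hz j)] with ξ' h using h.1
  have h2 : ∀ᶠ ξ' in 𝓝[<] ξ, ξ' ∈ Set.Ioo 0 ξ := Ioo_mem_nhdsLT hξ
  obtain ⟨ξ', h3, h4⟩ := (h1.and h2).exists
  exact ⟨ξ', h4.1, h4.2, h3⟩

/-- Fourier series with exponentially decaying coefficients define functions on the strip. -/
lemma differentiableOn_fourierSeries [CompleteSpace E] {ξ : ℝ} (hξ : 0 < ξ)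
    {b : (Fin d → ℤ) → E} (hb : ExpDecay ξ b) :
    DifferentiableOn ℂ (fourierSeries b) (strip d ξ) := by
  intro z hz
  obtain ⟨ξ', h0, hlt, hz'⟩ := exists_mem_strip_lt hξ hz
  refine DifferentiableAt.differentiableWithinAt ?_
  have hr := hb.rapidDecay_mul_exp h0.le hlt
  have hsum : ∀ N : ℕ, Summable fun k =>
      (1 + norm1 k) ^ N * (Real.exp (2 * Real.pi * ξ' * norm1 k) * ‖b k‖) := fun N => by
    have h := hr.summable N
    simpa [abs_of_pos (Real.exp_pos _)] using h
  refine (hasFDerivAt_tsum_of_isPreconnected ((hsum 1).mul_left (2 * Real.pi)) (isOpen_strip d ξ')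
    (convex_strip d ξ').isPreconnected (f := fun k z => torusChar k z • b k)
    (f' := fun k z => (torusChar k z • phaseCL k).smulRight (b k))
    (fun k x _ => (hasFDerivAt_torusChar k x).smul_const (b k)) ?_ hz' ?_ hz').differentiableAt
  · intro k x hx
    rw [ContinuousLinearMap.norm_smulRight_apply, norm_smul]
    have h1 := norm_torusChar_le k hx
    have h2 := norm_phaseCL_le k
    have h3 := norm1_nonneg k
    have := Real.pi_pos
    have h4 : ‖phaseCL k‖ ≤ 2 * Real.pi * (1 + norm1 k) := h2.trans (by gcongr; linarith)
    calc ‖torusChar k x‖ * ‖phaseCL k‖ * ‖b k‖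
        ≤ Real.exp (2 * Real.pi * ξ' * norm1 k) * (2 * Real.pi * (1 + norm1 k)) * ‖b k‖ := by gcongr
      _ = _ := by ring
  · refine Summable.of_norm_bounded (hsum 0) fun k => ?_
    rw [norm_smul, pow_zero, one_mul]
    have h1 := norm_torusChar_le k hz'
    gcongr

end Series

/-- Solution of `ω · ∂v - Λ v = g` from a solution of the equations for the coefficients. -/
lemma fourierSeries_solves {Λ : Matrix (Fin n) (Fin n) ℂ} {ω : Fin d → ℝ}
    {g : (Fin d → ℝ) → Fin n → ℂ} (hg : IsZPeriodic g) (hgs : ContDiff ℝ (⊤ : ℕ∞) g)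
    {b : (Fin d → ℤ) → Fin n → ℂ} (hb : RapidDecay b)
    (heq : ∀ k, phaseCL k (toC ω) • b k - Λ.mulVec (b k) = fourierCoef g k) (θ : Fin d → ℝ) :
    fderiv ℝ (fun θ => fourierSeries b (toC θ)) θ ω - Λ.mulVec (fourierSeries b (toC θ)) = g θ := by
  obtain ⟨D, hD, hDh⟩ := hasFDerivAt_fourierSeries hb θ
  rw [hD.fderiv, hDh]
  have h1 := (summable_char_smul (hb.phase_smul (toC ω)) θ).hasSum
  have h2 := (Λ.mulVecLin.toContinuousLinearMap).hasSum (summable_char_smul hb θ).hasSum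
  have h3 := hasSum_fourierCoef hg hgs.continuous (rapidDecay_fourierCoef hg hgs).summable' θ
  refine (h1.sub h2).unique ?_
  have h4 : ∀ k, torusChar k (toC θ) • phaseCL k (toC ω) • b k -
      (Λ.mulVecLin.toContinuousLinearMap) (torusChar k (toC θ) • b k) =
      torusChar k (toC θ) • fourierCoef g k := fun k => by
    rw [← heq k]
    simp [smul_sub]
  simpa only [h4] using h3

/-! ### Small divisors -/

/-- Multipliers of polynomial growth, away from `k = 0`. -/
def PolyGrowth (m : (Fin d → ℤ) → ℝ) : Prop :=
  (∀ k, 0 ≤ m k) ∧ ∃ (C : ℝ) (N : ℕ), 0 ≤ C ∧ ∀ k, k ≠ 0 → m k ≤ C * (1 + norm1 k) ^ N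

/-- Multipliers of subexponential growth, away from `k = 0`. -/
def SubexpGrowth (m : (Fin d → ℤ) → ℝ) : Prop :=
  (∀ k, 0 ≤ m k) ∧ ∀ δ > 0, ∃ C : ℝ, 0 ≤ C ∧ ∀ k, k ≠ 0 → m k ≤ C * Real.exp (δ * norm1 k)

lemma PolyGrowth.one : PolyGrowth (1 : (Fin d → ℤ) → ℝ) :=
  ⟨fun _ => zero_le_one, 1, 0, zero_le_one, fun k _ => by simp⟩

lemma PolyGrowth.mul {m m' : (Fin d → ℤ) → ℝ} (h : PolyGrowth m) (h' : PolyGrowth m') :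
    PolyGrowth (m * m') := by
  obtain ⟨h0, C, N, hC0, hC⟩ := h
  obtain ⟨h0', C', N', hC0', hC'⟩ := h'
  refine ⟨fun k => mul_nonneg (h0 k) (h0' k), C * C', N + N', by positivity, fun k hk => ?_⟩
  have := norm1_nonneg k
  calc m k * m' k ≤ (C * (1 + norm1 k) ^ N) * (C' * (1 + norm1 k) ^ N') :=
        mul_le_mul (hC k hk) (hC' k hk) (h0' k) (by positivity)
    _ = _ := by ring

lemma SubexpGrowth.one : SubexpGrowth (1 : (Fin d → ℤ) → ℝ) :=
  ⟨fun _ => zero_le_one, fun δ hδ => ⟨1, zero_le_one, fun k _ => by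
    have := norm1_nonneg k
    simp only [Pi.one_apply, one_mul]
    exact Real.one_le_exp (by positivity)⟩⟩

lemma SubexpGrowth.mul {m m' : (Fin d → ℤ) → ℝ} (h : SubexpGrowth m) (h' : SubexpGrowth m') :
    SubexpGrowth (m * m') := by
  refine ⟨fun k => mul_nonneg (h.1 k) (h'.1 k), fun δ hδ => ?_⟩
  obtain ⟨C, hC0, hC⟩ := h.2 (δ / 2) (by positivity)
  obtain ⟨C', hC0', hC'⟩ := h'.2 (δ / 2) (by positivity)
  refine ⟨C * C', by positivity, fun k hk => ?_⟩
  calc m k * m' k ≤ (C * Real.exp (δ / 2 * norm1 k)) * (C' * Real.exp (δ / 2 * norm1 k)) :=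
        mul_le_mul (hC k hk) (hC' k hk) (h'.1 k) (by positivity)
    _ = C * C' * (Real.exp (δ / 2 * norm1 k) * Real.exp (δ / 2 * norm1 k)) := by ring
    _ = _ := by rw [← Real.exp_add]; congr 2; ring

lemma PolyGrowth.subexp {m : (Fin d → ℤ) → ℝ} (h : PolyGrowth m) : SubexpGrowth m := by
  obtain ⟨h0, C, N, hC0, hC⟩ := h
  refine ⟨h0, fun δ hδ => ?_⟩
  obtain ⟨B, hB0, hB⟩ := one_add_pow_le_exp N hδ
  refine ⟨C * B, by positivity, fun k hk => (hC k hk).trans ?_⟩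
  rw [mul_assoc]
  have := hB _ (norm1_nonneg k)
  gcongr

lemma polyGrowth_pow (N : ℕ) {C : ℝ} (hC : 0 ≤ C) :
    PolyGrowth fun k : Fin d → ℤ => C * (1 + norm1 k) ^ N :=
  ⟨fun k => by have := norm1_nonneg k; positivity, C, N, hC, fun k _ => le_rfl⟩

section

variable {E E' : Type*} [NormedAddCommGroup E] [NormedAddCommGroup E']

lemma RapidDecay.of_polyGrowth {a : (Fin d → ℤ) → E} {b : (Fin d → ℤ) → E'} {m : (Fin d → ℤ) → ℝ}
    (ha : RapidDecay a) (hm : PolyGrowth m) (h : ∀ k, k ≠ 0 → ‖b k‖ ≤ m k * ‖a k‖) :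
    RapidDecay b := by
  intro N
  obtain ⟨h0, C, M, hC0, hC⟩ := hm
  obtain ⟨A, hA⟩ := ha (N + M)
  have hA0 : 0 ≤ A := le_trans (by have := norm1_nonneg (0 : Fin d → ℤ); positivity) (hA 0)
  refine ⟨C * A + ‖b 0‖, fun k => ?_⟩
  by_cases hk : k = 0
  · subst hk
    have : norm1 (0 : Fin d → ℤ) = 0 := by simp [norm1]
    rw [this]
    simp only [add_zero, one_pow, one_mul]
    have := mul_nonneg hC0 hA0
    linarith
  · have hn := norm1_nonneg k
    have h1 : ‖b k‖ ≤ C * (1 + norm1 k) ^ M * ‖a k‖ := (h k hk).trans (by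
      have := hC k hk
      gcongr)
    calc (1 + norm1 k) ^ N * ‖b k‖ ≤ (1 + norm1 k) ^ N * (C * (1 + norm1 k) ^ M * ‖a k‖) := by gcongr
      _ = C * ((1 + norm1 k) ^ (N + M) * ‖a k‖) := by ring
      _ ≤ C * A := by have := hA k; gcongr
      _ ≤ _ := by linarith [norm_nonneg (b 0)]

/-- Half of the gap ξ − ξ' pays for the multiplier. As `ExpDecay` asks only for the rates below 2πξ,
the width ξ itself is preserved, and so it does not shrink in the recursion. The index 0, where
nothing is assumed, enters through the additive constant ‖b 0‖. -/
lemma ExpDecay.of_subexpGrowth {ξ : ℝ} {a : (Fin d → ℤ) → E} {b : (Fin d → ℤ) → E'}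
    {m : (Fin d → ℤ) → ℝ} (ha : ExpDecay ξ a) (hm : SubexpGrowth m)
    (h : ∀ k, k ≠ 0 → ‖b k‖ ≤ m k * ‖a k‖) : ExpDecay ξ b := by
  intro ξ' h0 hlt
  have hpi := Real.pi_pos
  obtain ⟨C, hC0, hC⟩ := hm.2 (2 * Real.pi * ((ξ - ξ') / 2)) (by
    have : 0 < ξ - ξ' := sub_pos.2 hlt
    positivity)
  obtain ⟨A, hA⟩ := ha (ξ' + (ξ - ξ') / 2) (by linarith) (by linarith)
  have hA0 : 0 ≤ A := le_trans (by positivity) (hA 0)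
  refine ⟨C * A + ‖b 0‖, fun k => ?_⟩
  by_cases hk : k = 0
  · subst hk
    have : norm1 (0 : Fin d → ℤ) = 0 := by simp [norm1]
    rw [this]
    simp only [mul_zero, Real.exp_zero, one_mul]
    have := mul_nonneg hC0 hA0
    linarith
  · have h1 : ‖b k‖ ≤ C * Real.exp (2 * Real.pi * ((ξ - ξ') / 2) * norm1 k) * ‖a k‖ :=
      (h k hk).trans (by
        have := hC k hk
        gcongr)
    calc Real.exp (2 * Real.pi * ξ' * norm1 k) * ‖b k‖
        ≤ Real.exp (2 * Real.pi * ξ' * norm1 k) *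
          (C * Real.exp (2 * Real.pi * ((ξ - ξ') / 2) * norm1 k) * ‖a k‖) := by gcongr
      _ = C * ((Real.exp (2 * Real.pi * ξ' * norm1 k) *
          Real.exp (2 * Real.pi * ((ξ - ξ') / 2) * norm1 k)) * ‖a k‖) := by ring
      _ = C * (Real.exp (2 * Real.pi * (ξ' + (ξ - ξ') / 2) * norm1 k) * ‖a k‖) := by
          rw [← Real.exp_add]
          congr 3
          ring
      _ ≤ C * A := by have := hA k; gcongr
      _ ≤ _ := by linarith [norm_nonneg (b 0)]

end

lemma divisor_eq (ω : Fin d → ℝ) (μ : ℂ) (k : Fin d → ℤ) :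
    divisor ω μ k = μ - phaseCL k (toC ω) := by
  rw [divisor, phaseCL_toC]

lemma polyGrowth_inv {q : (Fin d → ℤ) → ℝ} (hq : ∀ k, 0 ≤ q k) {γ τ : ℝ} (hγ : 0 < γ)
    (h : ∀ k, k ≠ 0 → γ / norm1 k ^ τ ≤ q k) : PolyGrowth fun k => (q k)⁻¹ := by
  -- The exponent τ is an arbitrary real number; since |k| ≥ 1 it may be enlarged to a natural
  -- number.
  refine ⟨fun k => inv_nonneg.2 (hq k), γ⁻¹, ⌈|τ|⌉₊, by positivity, fun k hk => ?_⟩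
  have h1 := one_le_norm1 hk
  have h2 : norm1 k ^ τ ≤ (1 + norm1 k) ^ ⌈|τ|⌉₊ := by
    calc norm1 k ^ τ ≤ norm1 k ^ ((⌈|τ|⌉₊ : ℕ) : ℝ) :=
          Real.rpow_le_rpow_of_exponent_le h1 ((le_abs_self τ).trans (Nat.le_ceil _))
      _ = norm1 k ^ ⌈|τ|⌉₊ := Real.rpow_natCast _ _
      _ ≤ _ := by gcongr; linarith
  have h3 : 0 < norm1 k ^ τ := Real.rpow_pos_of_pos (by linarith) _
  calc (q k)⁻¹ ≤ (γ / norm1 k ^ τ)⁻¹ := inv_anti₀ (by positivity) (h k hk)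
    _ = γ⁻¹ * norm1 k ^ τ := by rw [inv_div]; ring
    _ ≤ _ := by gcongr

/-- The limit gives the bound with constant 1 off a finite set; the finitely many exceptions are
summed into the constant. -/
lemma subexpGrowth_inv {q : (Fin d → ℤ) → ℝ} (hq : ∀ k, 0 ≤ q k)
    (h0 : ∀ k, k ≠ 0 → q k ≠ 0)
    (h : Tendsto (fun k => 1 / norm1 k * Real.log (1 / q k)) cofinite (𝓝 0)) :
    SubexpGrowth fun k => (q k)⁻¹ := by
  refine ⟨fun k => inv_nonneg.2 (hq k), fun δ hδ => ?_⟩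
  have h1 : ∀ᶠ k in cofinite, k ≠ 0 → (q k)⁻¹ ≤ Real.exp (δ * norm1 k) := by
    filter_upwards [h.eventually (gt_mem_nhds hδ)] with k hk hk0
    have h2 := one_le_norm1 hk0
    have hqk : 0 < q k := lt_of_le_of_ne (hq k) (Ne.symm (h0 k hk0))
    rw [one_div_mul_eq_div, div_lt_iff₀ (by linarith)] at hk
    rw [one_div] at hk
    exact (Real.log_le_iff_le_exp (by positivity)).1 hk.le
  set s := (Filter.eventually_cofinite.1 h1).toFinset with hs
  have hsum : 0 ≤ ∑ k ∈ s, (q k)⁻¹ := Finset.sum_nonneg fun k _ => inv_nonneg.2 (hq k)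
  refine ⟨1 + ∑ k ∈ s, (q k)⁻¹, by positivity, fun k hk => ?_⟩
  have h3 := norm1_nonneg k
  have h4 : 1 ≤ Real.exp (δ * norm1 k) := Real.one_le_exp (by positivity)
  by_cases hks : k ∈ s
  · have h5 := Finset.single_le_sum (f := fun k => (q k)⁻¹) (fun k _ => inv_nonneg.2 (hq k)) hks
    nlinarith
  · have h5 : (q k)⁻¹ ≤ Real.exp (δ * norm1 k) := by
      simp only [hs, Set.Finite.mem_toFinset, Set.mem_ofPred_eq, not_not] at hks
      exact hks hk
    nlinarith

/-- The condition on ω alone is thereby the condition for the eigenvalue 0, and all eigenvalues are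
treated alike. -/
lemma norm_divisor_zero (ω : Fin d → ℝ) (k : Fin d → ℤ) :
    ‖divisor ω 0 k‖ = 2 * Real.pi * |dotZ ω k| := by
  simp [divisor, abs_of_pos Real.pi_pos]

lemma abs_dotZ_le (ω : Fin d → ℝ) (k : Fin d → ℤ) : |dotZ ω k| ≤ ‖divisor ω 0 k‖ := by
  rw [norm_divisor_zero]
  nlinarith [Real.pi_gt_three, abs_nonneg (dotZ ω k)]

lemma IsDiophantine.polyGrowth {ω : Fin d → ℝ} (h : IsDiophantine ω) :
    PolyGrowth fun k => ‖divisor ω 0 k‖⁻¹ := by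
  obtain ⟨γ, τ, hγ, h⟩ := h
  exact polyGrowth_inv (fun _ => norm_nonneg _) hγ fun k hk => (h k hk).trans (abs_dotZ_le ω k)

lemma IsDiophantineWrt.polyGrowth {ω : Fin d → ℝ} {μ : ℂ} (h : IsDiophantineWrt ω μ) :
    PolyGrowth fun k => ‖divisor ω μ k‖⁻¹ := by
  obtain ⟨γ, τ, hγ, h⟩ := h
  exact polyGrowth_inv (fun _ => norm_nonneg _) hγ h

lemma IsSubexpDiophantine.subexpGrowth {ω : Fin d → ℝ} (h : IsSubexpDiophantine ω) :
    SubexpGrowth fun k => ‖divisor ω 0 k‖⁻¹ := by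
  have h1 := subexpGrowth_inv (fun k => abs_nonneg (dotZ ω k)) (fun k hk => abs_ne_zero.2 (h.1 k hk))
    h.2
  refine ⟨fun k => inv_nonneg.2 (norm_nonneg _), fun δ hδ => ?_⟩
  obtain ⟨C, hC0, hC⟩ := h1.2 δ hδ
  refine ⟨C, hC0, fun k hk => le_trans ?_ (hC k hk)⟩
  exact inv_anti₀ (abs_pos.2 (h.1 k hk)) (abs_dotZ_le ω k)

lemma IsSubexpDiophantineWrt.subexpGrowth {ω : Fin d → ℝ} {μ : ℂ}
    (h : IsSubexpDiophantineWrt ω μ) : SubexpGrowth fun k => ‖divisor ω μ k‖⁻¹ := by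
  refine subexpGrowth_inv (fun _ => norm_nonneg _) (fun k hk => norm_ne_zero_iff.2 (h.1 k hk)) ?_
  have := h.2.neg
  simpa using this

/-- The absence of resonances. -/
def NonResonant (ω : Fin d → ℝ) (Λ : Matrix (Fin n) (Fin n) ℂ) : Prop :=
  ∀ k : Fin d → ℤ, k ≠ 0 → ∀ μ ∈ spectrum ℂ Λ, divisor ω μ k ≠ 0

lemma IsDiophantine.divisor_ne_zero {ω : Fin d → ℝ} (h : IsDiophantine ω) {k : Fin d → ℤ}
    (hk : k ≠ 0) : divisor ω 0 k ≠ 0 := by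
  obtain ⟨γ, τ, hγ, h⟩ := h
  have h1 : 0 < norm1 k ^ τ := Real.rpow_pos_of_pos (by linarith [one_le_norm1 hk]) _
  have h2 : 0 < γ / norm1 k ^ τ := by positivity
  exact norm_pos_iff.1 (h2.trans_le ((h k hk).trans (abs_dotZ_le ω k)))

lemma IsDiophantineWrt.divisor_ne_zero {ω : Fin d → ℝ} {μ : ℂ} (h : IsDiophantineWrt ω μ)
    {k : Fin d → ℤ} (hk : k ≠ 0) : divisor ω μ k ≠ 0 := by
  obtain ⟨γ, τ, hγ, h⟩ := h
  have h1 : 0 < norm1 k ^ τ := Real.rpow_pos_of_pos (by linarith [one_le_norm1 hk]) _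
  have h2 : 0 < γ / norm1 k ^ τ := by positivity
  exact norm_pos_iff.1 (h2.trans_le (h k hk))

lemma IsSubexpDiophantine.divisor_ne_zero {ω : Fin d → ℝ} (h : IsSubexpDiophantine ω)
    {k : Fin d → ℤ} (hk : k ≠ 0) : divisor ω 0 k ≠ 0 :=
  norm_pos_iff.1 ((abs_pos.2 (h.1 k hk)).trans_le (abs_dotZ_le ω k))

lemma norm_mulVec_le {A : Matrix (Fin n) (Fin n) ℂ} {x : ℝ} (hx0 : 0 ≤ x)
    (hx : ∀ i j, ‖A i j‖ ≤ x) (v : Fin n → ℂ) : ‖A.mulVec v‖ ≤ n * x * ‖v‖ := by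
  refine (pi_norm_le_iff_of_nonneg (by positivity)).2 fun i => ?_
  rw [Matrix.mulVec, dotProduct]
  refine (norm_sum_le _ _).trans ?_
  calc ∑ j, ‖A i j * v j‖ ≤ ∑ _j : Fin n, x * ‖v‖ := by
        refine Finset.sum_le_sum fun j _ => ?_
        rw [norm_mul]
        have := hx i j
        have := norm_le_pi_norm v j
        gcongr
    _ = _ := by simp [mul_assoc]

/-- Entries of the adjugate are determinants with one row replaced by a unit vector; `hx1` accounts
for the entry 1 of that row. -/
lemma norm_adjugate_le {A : Matrix (Fin n) (Fin n) ℂ} {x : ℝ} (hx1 : 1 ≤ x)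
    (hx : ∀ i j, ‖A i j‖ ≤ x) (i j : Fin n) : ‖A.adjugate i j‖ ≤ n.factorial * x ^ n := by
  rw [Matrix.adjugate_apply]
  have h := Matrix.det_le (A := A.updateRow j (Pi.single i 1)) (abv := NormedField.toAbsoluteValue ℂ)
    (x := x) (fun p q => by
      change ‖A.updateRow j (Pi.single i 1) p q‖ ≤ x
      rw [Matrix.updateRow_apply]
      split_ifs
      · rw [Pi.single_apply]
        split_ifs <;> simp <;> linarith
      · exact hx p q)
  simpa using! h

/-- The product of the inverses of the small divisors. -/
def invDivisorProd {d n : ℕ} (ω : Fin d → ℝ) (Λ : Matrix (Fin n) (Fin n) ℂ) : (Fin d → ℤ) → ℝ :=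
  (Λ.charpoly.roots.map fun (μ : ℂ) (k : Fin d → ℤ) => ‖divisor ω μ k‖⁻¹).prod

lemma mem_spectrum_of_mem_roots {Λ : Matrix (Fin n) (Fin n) ℂ} {μ : ℂ}
    (h : μ ∈ Λ.charpoly.roots) : μ ∈ spectrum ℂ Λ :=
  Matrix.mem_spectrum_iff_isRoot_charpoly.2 (Polynomial.isRoot_of_mem_roots h)

lemma invDivisorProd_induction {ω : Fin d → ℝ} {Λ : Matrix (Fin n) (Fin n) ℂ}
    (P : ((Fin d → ℤ) → ℝ) → Prop) (h1 : P 1) (hmul : ∀ f g, P f → P g → P (f * g))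
    (h : ∀ μ ∈ spectrum ℂ Λ, P fun k => ‖divisor ω μ k‖⁻¹) : P (invDivisorProd ω Λ) := by
  refine Multiset.prod_induction P _ hmul h1 fun f hf => ?_
  obtain ⟨μ, hμ, rfl⟩ := Multiset.mem_map.1 hf
  exact h μ (mem_spectrum_of_mem_roots hμ)

/-- The coefficient equations have solutions that are controlled by the small divisors. -/
lemma exists_coeff_solution {ω : Fin d → ℝ} {Λ : Matrix (Fin n) (Fin n) ℂ} (hnr : NonResonant ω Λ)
    (a : (Fin d → ℤ) → Fin n → ℂ) {v₀ : Fin n → ℂ} (hv₀ : -Λ.mulVec v₀ = a 0) :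
    ∃ (b : (Fin d → ℤ) → Fin n → ℂ) (C : ℝ), 0 ≤ C ∧
      (∀ k, phaseCL k (toC ω) • b k - Λ.mulVec (b k) = a k) ∧
      ∀ k, k ≠ 0 →
        ‖b k‖ ≤ ((fun k : Fin d → ℤ => C * (1 + norm1 k) ^ n) * invDivisorProd ω Λ :
          (Fin d → ℤ) → ℝ) k * ‖a k‖ := by
  set B : (Fin d → ℤ) → Matrix (Fin n) (Fin n) ℂ := fun k =>
    Matrix.scalar (Fin n) (phaseCL k (toC ω)) - Λ with hB
  have hBv : ∀ k v, (B k).mulVec v = phaseCL k (toC ω) • v - Λ.mulVec v := fun k v => by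
    simp only [hB, Matrix.sub_mulVec, Matrix.scalar_apply]
    congr 1
    funext i
    simp [Matrix.mulVec_diagonal]
  -- The determinant is the characteristic polynomial at 2πi ω·k, a product of small divisors with
  -- multiplicity. With the adjugate this bounds the inverse without Λ being diagonalizable.
  have hdet : ∀ k, (B k).det = (Λ.charpoly.roots.map (phaseCL k (toC ω) - ·)).prod := fun k => by
    rw [← (IsAlgClosed.splits Λ.charpoly).eval_eq_prod_roots_of_monic Λ.charpoly_monic,
      Matrix.eval_charpoly]
  have hdetn : ∀ k, ‖(B k).det‖⁻¹ = invDivisorProd ω Λ k := fun k => by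
    rw [hdet, invDivisorProd]
    induction Λ.charpoly.roots using Multiset.induction_on with
    | empty => simp
    | cons μ s ih =>
      rw [Multiset.map_cons, Multiset.map_cons, Multiset.prod_cons, Multiset.prod_cons, norm_mul,
        mul_inv, ih, Pi.mul_apply, divisor_eq, norm_sub_rev]
  have hdet0 : ∀ k, k ≠ 0 → (B k).det ≠ 0 := fun k hk h0 => by
    rw [← Matrix.eval_charpoly] at h0
    refine hnr k hk _ (Matrix.mem_spectrum_iff_isRoot_charpoly.2 h0) ?_
    rw [divisor_eq, sub_self]
  set X : ℝ := 2 * Real.pi * ‖toC ω‖ + ∑ i, ∑ j, ‖Λ i j‖ + 1 with hX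
  have hpi := Real.pi_pos
  have hΛ0 : 0 ≤ ∑ i, ∑ j, ‖Λ i j‖ :=
    Finset.sum_nonneg fun i _ => Finset.sum_nonneg fun j _ => norm_nonneg _
  have hΛ : ∀ i j, ‖Λ i j‖ ≤ ∑ i, ∑ j, ‖Λ i j‖ := fun i j =>
    (Finset.single_le_sum (f := fun j => ‖Λ i j‖) (fun _ _ => norm_nonneg _)
      (Finset.mem_univ j)).trans (Finset.single_le_sum (f := fun i => ∑ j, ‖Λ i j‖)
      (fun _ _ => Finset.sum_nonneg fun j _ => norm_nonneg _) (Finset.mem_univ i))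
  have hX1 : 1 ≤ X := by
    have : 0 ≤ 2 * Real.pi * ‖toC ω‖ := by positivity
    linarith
  have hBe : ∀ k i j, ‖B k i j‖ ≤ X * (1 + norm1 k) := fun k i j => by
    have hn := norm1_nonneg k
    have h1 := norm_phaseCL_apply_le k (toC ω)
    have h2 : ‖(Matrix.scalar (Fin n) (phaseCL k (toC ω))) i j‖ ≤ ‖phaseCL k (toC ω)‖ := by
      rw [Matrix.scalar_apply, Matrix.diagonal_apply]
      split_ifs <;> simp
    have h3 : ‖B k i j‖ ≤ ‖(Matrix.scalar (Fin n) (phaseCL k (toC ω))) i j‖ + ‖Λ i j‖ :=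
      norm_sub_le _ _
    have h4 : 0 ≤ 2 * Real.pi * ‖toC ω‖ := by positivity
    nlinarith [hΛ i j]
  -- At k = 0 the matrix is −Λ, and the given v₀ is the solution.
  refine ⟨fun k => if k = 0 then v₀ else (B k).det⁻¹ • (B k).adjugate.mulVec (a k),
    n * (n.factorial * X ^ n), by positivity, fun k => ?_, fun k hk => ?_⟩
  · by_cases hk : k = 0
    · subst hk
      simp [phaseCL_apply, ← hv₀]
    · simp only [if_neg hk]
      rw [← hBv, Matrix.mulVec_smul, Matrix.mulVec_mulVec, Matrix.mul_adjugate, Matrix.smul_mulVec,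
        Matrix.one_mulVec, smul_smul, inv_mul_cancel₀ (hdet0 k hk), one_smul]
  · simp only [if_neg hk]
    have hn := norm1_nonneg k
    have hX2 : 1 ≤ X * (1 + norm1 k) := by nlinarith
    have h1 := norm_mulVec_le (by positivity) (norm_adjugate_le hX2 (hBe k)) (a k)
    rw [norm_smul, norm_inv, hdetn, Pi.mul_apply]
    have h2 : 0 ≤ invDivisorProd ω Λ k := by rw [← hdetn]; positivity
    calc invDivisorProd ω Λ k * ‖(B k).adjugate.mulVec (a k)‖
        ≤ invDivisorProd ω Λ k *
          (n * (n.factorial * (X * (1 + norm1 k)) ^ n) * ‖a k‖) := by gcongr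
      _ = _ := by rw [mul_pow]; ring

/-- The cohomological equation for smooth functions. -/
theorem exists_smooth_solution {ω : Fin d → ℝ} {Λ : Matrix (Fin n) (Fin n) ℂ}
    (hω : IsDiophantine ω) (hΛ : ∀ μ ∈ spectrum ℂ Λ, μ ≠ 0 → IsDiophantineWrt ω μ)
    {g : (Fin d → ℝ) → Fin n → ℂ} (hg : IsZPeriodic g) (hgs : ContDiff ℝ (⊤ : ℕ∞) g)
    {v₀ : Fin n → ℂ} (hv₀ : -Λ.mulVec v₀ = torusAvg g) :
    ∃ v : (Fin d → ℝ) → Fin n → ℂ, IsZPeriodic v ∧ ContDiff ℝ (⊤ : ℕ∞) v ∧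
      ∀ θ, fderiv ℝ v θ ω - Λ.mulVec (v θ) = g θ := by
  have hnr : NonResonant ω Λ := fun k hk μ hμ => by
    by_cases h0 : μ = 0
    · rw [h0]; exact hω.divisor_ne_zero hk
    · exact (hΛ μ hμ h0).divisor_ne_zero hk
  obtain ⟨b, C, hC0, hb, hbd⟩ := exists_coeff_solution hnr (fourierCoef g)
    (by rw [hv₀, fourierCoef_zero])
  have hm : PolyGrowth (invDivisorProd ω Λ) := by
    refine invDivisorProd_induction PolyGrowth .one (fun _ _ h h' => h.mul h') fun μ hμ => ?_
    by_cases h0 : μ = 0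
    · rw [h0]; exact hω.polyGrowth
    · exact (hΛ μ hμ h0).polyGrowth
  have hbr := (rapidDecay_fourierCoef hg hgs).of_polyGrowth ((polyGrowth_pow n hC0).mul hm) hbd
  exact ⟨_, fourierSeries_periodic b, contDiff_fourierSeries hbr, fourierSeries_solves hg hgs hbr hb⟩

lemma contDiff_comp_toC {E : Type*} [NormedAddCommGroup E] [NormedSpace ℂ E]
    [FiniteDimensional ℂ E] {ξ : ℝ} (hξ : 0 < ξ) {U : (Fin d → ℂ) → E}
    (hU : DifferentiableOn ℂ U (strip d ξ)) : ContDiff ℝ (⊤ : ℕ∞) fun θ => U (toC θ) := by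
  have h1 := (contDiffOn_of_differentiableOn (isOpen_strip d ξ) hU)
  refine contDiff_iff_contDiffAt.2 fun θ => ?_
  have h2 := (h1.contDiffAt ((isOpen_strip d ξ).mem_nhds (toC_mem_strip hξ θ))).restrict_scalars ℝ
  exact ContDiffAt.comp θ (f := toCL d) h2 (toCL d).contDiff.contDiffAt

/-- The cohomological equation for functions that are analytic on a strip. -/
theorem exists_analytic_solution {ω : Fin d → ℝ} {Λ : Matrix (Fin n) (Fin n) ℂ} {ξ : ℝ}
    (hξ : 0 < ξ) (hω : IsSubexpDiophantine ω)
    (hΛ : ∀ μ ∈ spectrum ℂ Λ, μ ≠ 0 → IsSubexpDiophantineWrt ω μ)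
    {G : (Fin d → ℂ) → Fin n → ℂ} (hG : DifferentiableOn ℂ G (strip d ξ))
    (hper : IsZPeriodic fun θ => G (toC θ))
    {v₀ : Fin n → ℂ} (hv₀ : -Λ.mulVec v₀ = torusAvg fun θ => G (toC θ)) :
    ∃ V : (Fin d → ℂ) → Fin n → ℂ, DifferentiableOn ℂ V (strip d ξ) ∧
      IsZPeriodic (fun θ => V (toC θ)) ∧
      ∀ θ, fderiv ℝ (fun θ => V (toC θ)) θ ω - Λ.mulVec (V (toC θ)) = G (toC θ) := by
  have hnr : NonResonant ω Λ := fun k hk μ hμ => by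
    by_cases h0 : μ = 0
    · rw [h0]; exact hω.divisor_ne_zero hk
    · exact (hΛ μ hμ h0).1 k hk
  obtain ⟨b, C, hC0, hb, hbd⟩ := exists_coeff_solution hnr (fourierCoef fun θ => G (toC θ))
    (by rw [hv₀, fourierCoef_zero])
  have hm : SubexpGrowth (invDivisorProd ω Λ) := by
    refine invDivisorProd_induction SubexpGrowth .one (fun _ _ h h' => h.mul h') fun μ hμ => ?_
    by_cases h0 : μ = 0
    · rw [h0]; exact hω.subexpGrowth
    · exact (hΛ μ hμ h0).subexpGrowth
  have hbr := (expDecay_fourierCoef hG hper).of_subexpGrowth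
    ((polyGrowth_pow n hC0).subexp.mul hm) hbd
  exact ⟨_, differentiableOn_fourierSeries hξ hbr, fourierSeries_periodic b,
    fourierSeries_solves hper (contDiff_comp_toC hξ hG) (hbr.rapidDecay hξ) hb⟩

end DelayTorus
end

noncomputable section
namespace DelayTorus
open Asymptotics Filter MeasureTheory

variable {d n : ℕ}

/-! ### Linear algebra -/

section Matrices

variable {𝕜 V : Type*} [NontriviallyNormedField 𝕜] [NormedAddCommGroup V] [NormedSpace 𝕜 V]
  [NormedAlgebra 𝕜 ℂ] {m : WithTop ℕ∞} {S : Set V}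

lemma contDiffOn_det {A : V → Matrix (Fin n) (Fin n) ℂ}
    (hA : ∀ i j, ContDiffOn 𝕜 m (fun x => A x i j) S) : ContDiffOn 𝕜 m (fun x => (A x).det) S := by
  simp only [Matrix.det_apply']
  exact ContDiffOn.sum fun σ _ => contDiffOn_const.mul (contDiffOn_prod fun i _ => hA _ _)

/-- Cramer's rule. The field is general so that it applies on the real torus and on the complex
strip. -/
lemma contDiffOn_matrix_inv {A : V → Matrix (Fin n) (Fin n) ℂ}
    (hA : ∀ i j, ContDiffOn 𝕜 m (fun x => A x i j) S) (h0 : ∀ x ∈ S, (A x).det ≠ 0) (i j : Fin n) :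
    ContDiffOn 𝕜 m (fun x => (A x)⁻¹ i j) S := by
  simp only [Matrix.inv_def, Matrix.smul_apply, Ring.inverse_eq_inv', smul_eq_mul,
    Matrix.adjugate_apply]
  refine ((contDiffOn_det hA).inv h0).mul (contDiffOn_det fun p q => ?_)
  simp only [Matrix.updateRow_apply]
  split_ifs
  · exact contDiffOn_const
  · exact hA p q

lemma contDiffOn_mulVec {A : V → Matrix (Fin n) (Fin n) ℂ} {v : V → Fin n → ℂ}
    (hA : ∀ i j, ContDiffOn 𝕜 m (fun x => A x i j) S) (hv : ContDiffOn 𝕜 m v S) :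
    ContDiffOn 𝕜 m (fun x => (A x).mulVec (v x)) S := by
  refine contDiffOn_pi.2 fun i => ?_
  simp only [Matrix.mulVec, dotProduct]
  exact ContDiffOn.sum fun j _ => (hA i j).mul (contDiffOn_pi.1 hv j)

end Matrices

/-- The kernel of `Λ` is complementary to its range if it contains the range of an injective map
from a space whose dimension is the algebraic multiplicity of the eigenvalue `0`. -/
lemma exists_neg_mulVec_eq {Λ : Matrix (Fin n) (Fin n) ℂ} (hzero : Λ.charpoly.rootMultiplicity 0 = d)
    (P : (Fin d → ℂ) →ₗ[ℂ] (Fin n → ℂ)) (hP : Function.Injective P) (hΛP : ∀ w, Λ.mulVec (P w) = 0)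
    (g₀ : Fin n → ℂ) : ∃ w v₀, -Λ.mulVec v₀ = g₀ - P w := by
  set φ : Module.End ℂ (Fin n → ℂ) := Matrix.toLin' Λ with hφ
  have hφa : ∀ v, φ v = Λ.mulVec v := fun v => Matrix.toLin'_apply _ _
  have hfin : Module.finrank ℂ (φ.maxGenEigenspace 0) = d := by
    rw [LinearMap.finrank_maxGenEigenspace_eq, Matrix.charpoly_toLin', hzero]
  have hle : LinearMap.range P ≤ φ.maxGenEigenspace 0 := by
    rintro _ ⟨w, rfl⟩
    refine (Module.End.mem_maxGenEigenspace _ _ _).2 ⟨1, ?_⟩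
    simp [hφa, hΛP]
  -- Both spaces have dimension d; hence all generalized null vectors lie in the range of P and are
  -- annihilated by Λ.
  have heq : LinearMap.range P = φ.maxGenEigenspace 0 := by
    refine Submodule.eq_of_le_of_finrank_eq hle ?_
    rw [hfin, LinearMap.finrank_range_of_inj hP]
    simp
  -- If φ y lies in the kernel, then y is a generalized null vector, hence in the range of P, and φ
  -- y = 0.
  have hdisj : Disjoint (LinearMap.ker φ) (LinearMap.range φ) := by
    rw [Submodule.disjoint_def]
    rintro _ hx ⟨y, rfl⟩
    have hy : y ∈ φ.maxGenEigenspace 0 := by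
      refine (Module.End.mem_maxGenEigenspace _ _ _).2 ⟨2, ?_⟩
      simpa [pow_two] using! hx
    rw [← heq] at hy
    obtain ⟨w, rfl⟩ := hy
    rw [hφa, hΛP]
  have htop : LinearMap.ker φ ⊔ LinearMap.range φ = ⊤ := by
    refine Submodule.eq_top_of_disjoint _ _ ?_ hdisj
    rw [add_comm, LinearMap.finrank_range_add_finrank_ker]
  have hker : LinearMap.ker φ ≤ LinearMap.range P := by
    intro x hx
    rw [heq]
    exact (Module.End.mem_maxGenEigenspace _ _ _).2 ⟨1, by simpa using hx⟩
  obtain ⟨a, ha, b, ⟨v, rfl⟩, hab⟩ := Submodule.mem_sup.1 (htop ▸ Submodule.mem_top (x := g₀))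
  obtain ⟨w, rfl⟩ := hker ha
  refine ⟨w, -v, ?_⟩
  rw [← hab, hφa, Matrix.mulVec_neg]
  abel

/-! ### Solutions of the homogeneous equation -/

lemma fourierCoef_mulVec (Λ : Matrix (Fin n) (Fin n) ℂ) {p : (Fin d → ℝ) → Fin n → ℂ}
    (hp : Continuous p) (k : Fin d → ℤ) :
    fourierCoef (fun θ => Λ.mulVec (p θ)) k = Λ.mulVec (fourierCoef p k) := by
  have hc : Continuous fun θ => torusChar (-k) (toC θ) • p θ :=
    (contDiff_torusChar_toC (-k) (m := 1)).continuous.smul hp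
  have h := (Λ.mulVecLin.toContinuousLinearMap).integral_comp_comm (integrableOn_unitCube hc)
  simp only [fourierCoef, torusAvg]
  simpa [Matrix.mulVec_smul] using! h

/-- In the absence of resonances, periodic solutions of the homogeneous equation are constant. -/
lemma eq_const_of_homogeneous {ω : Fin d → ℝ} {Λ : Matrix (Fin n) (Fin n) ℂ}
    (hnr : NonResonant ω Λ) {p : (Fin d → ℝ) → Fin n → ℂ} (hp : IsZPeriodic p)
    (hs : ContDiff ℝ 1 p) (h : ∀ θ, fderiv ℝ p θ ω = Λ.mulVec (p θ)) :
    (∀ θ, p θ = torusAvg p) ∧ Λ.mulVec (torusAvg p) = 0 := by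
  have hk : ∀ k, phaseCL k (toC ω) • fourierCoef p k = Λ.mulVec (fourierCoef p k) := fun k => by
    rw [← fourierCoef_fderiv hp hs ω k, ← fourierCoef_mulVec Λ hs.continuous]
    simp only [h]
  -- The coefficient would be an eigenvector of Λ for the eigenvalue 2πi ω·k.
  have hz : ∀ k, k ≠ 0 → fourierCoef p k = 0 := by
    intro k hk0
    have h1 : phaseCL k (toC ω) ∉ spectrum ℂ Λ := fun hmem =>
      hnr k hk0 _ hmem (by rw [divisor_eq, sub_self])
    have h2 := spectrum.notMem_iff.1 h1
    refine Matrix.mulVec_injective_of_isUnit h2 ?_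
    rw [Matrix.mulVec_zero, Matrix.sub_mulVec, ← hk, Algebra.algebraMap_eq_smul_one,
      Matrix.smul_mulVec, Matrix.one_mulVec, sub_self]
  have hsum : Summable (fourierCoef p) :=
    summable_of_ne_finset_zero (s := {0}) fun k hk => hz k (by simpa using hk)
  rw [← fourierCoef_zero]
  refine ⟨fun θ => ?_, ?_⟩
  · have h1 := hasSum_fourierCoef hp hs.continuous hsum θ
    have h2 := hasSum_single (f := fun k => torusChar k (toC θ) • fourierCoef p k) 0
      fun k hk => by rw [hz k hk, smul_zero]
    rw [h1.unique h2, torusChar_zero, one_smul]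
  · rw [← hk]
    simp [phaseCL_apply]

/-! ### The linearized equation -/

section Linearized

variable {f : ℝ → (Fin n → ℝ) → (Fin n → ℝ) → (Fin n → ℝ)} {K₀ : (Fin d → ℝ) → (Fin n → ℝ)}

/-- The componentwise real part. -/
def reC {m : ℕ} (z : Fin m → ℂ) : Fin m → ℝ := fun i => (z i).re

/-- The componentwise real part as a continuous linear map. -/
def reCL (m : ℕ) : (Fin m → ℂ) →L[ℝ] (Fin m → ℝ) :=
  ContinuousLinearMap.pi fun i => Complex.reCLM.comp (ContinuousLinearMap.proj i)

lemma reCL_apply {m : ℕ} (z : Fin m → ℂ) : reCL m z = reC z := rfl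

lemma reC_toC {m : ℕ} (x : Fin m → ℝ) : reC (toC x) = x := by
  funext i
  simp [reC, toC]

/-- The real endomorphism underlying `linMatrix`. -/
def linMap (f : ℝ → (Fin n → ℝ) → (Fin n → ℝ) → (Fin n → ℝ)) (K₀ : (Fin d → ℝ) → (Fin n → ℝ))
    (θ : Fin d → ℝ) : (Fin n → ℝ) →L[ℝ] (Fin n → ℝ) :=
  fderiv ℝ (fun x => f 0 x (K₀ θ)) (K₀ θ) + fderiv ℝ (fun y => f 0 (K₀ θ) y) (K₀ θ)

/-- The coefficient matrix is real although M and Λ may be complex; hence real parts of complex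
solutions are solutions. -/
lemma reC_linMatrix_mulVec (θ : Fin d → ℝ) (z : Fin n → ℂ) :
    reC ((linMatrix f K₀ θ).mulVec z) = linMap f K₀ θ (reC z) := by
  funext i
  have h1 : linMap f K₀ θ (reC z) =
      (LinearMap.toMatrix' (linMap f K₀ θ).toLinearMap).mulVec (reC z) := by
    rw [← Matrix.toLin'_apply, Matrix.toLin'_toMatrix']
    rfl
  rw [h1]
  simp [reC, linMatrix, linMap, Matrix.mulVec, dotProduct, Matrix.map_apply]

lemma linMatrix_mulVec_toC (θ : Fin d → ℝ) (x : Fin n → ℝ) :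
    (linMatrix f K₀ θ).mulVec (toC x) = toC (linMap f K₀ θ x) := by
  funext i
  have h1 : linMap f K₀ θ x =
      (LinearMap.toMatrix' (linMap f K₀ θ).toLinearMap).mulVec x := by
    rw [← Matrix.toLin'_apply, Matrix.toLin'_toMatrix']
    rfl
  rw [h1]
  simp [toC, linMatrix, linMap, Matrix.mulVec, dotProduct, Matrix.map_apply]

lemma fderiv_diag_eq_linMap (hf : IsSmoothFamilyAlong f K₀) (θ : Fin d → ℝ) (x : Fin n → ℝ) :
    fderiv ℝ (fun p : ℝ × (Fin n → ℝ) × (Fin n → ℝ) => f p.1 p.2.1 p.2.2) (0, K₀ θ, K₀ θ) (0, x, x) =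
      linMap f K₀ θ x := by
  set F : ℝ × (Fin n → ℝ) × (Fin n → ℝ) → (Fin n → ℝ) := fun p => f p.1 p.2.1 p.2.2 with hF
  have h : HasFDerivAt F (fderiv ℝ F (0, K₀ θ, K₀ θ)) (0, K₀ θ, K₀ θ) :=
    ((hf θ).differentiableAt (by simp)).hasFDerivAt
  have h1 : HasFDerivAt (fun x => f 0 x (K₀ θ)) _ (K₀ θ) :=
    HasFDerivAt.comp (K₀ θ) (f := fun x => ((0 : ℝ), x, K₀ θ)) h
      ((hasFDerivAt_const (0 : ℝ) _).prodMk ((hasFDerivAt_id _).prodMk (hasFDerivAt_const (K₀ θ) _)))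
  have h2 : HasFDerivAt (fun y => f 0 (K₀ θ) y) _ (K₀ θ) :=
    HasFDerivAt.comp (K₀ θ) (f := fun y => ((0 : ℝ), K₀ θ, y)) h
      ((hasFDerivAt_const (0 : ℝ) _).prodMk ((hasFDerivAt_const (K₀ θ) _).prodMk (hasFDerivAt_id _)))
  rw [linMap, h1.fderiv, h2.fderiv, add_apply, ContinuousLinearMap.comp_apply,
    ContinuousLinearMap.comp_apply, ← map_add]
  simp

/-- The derivatives of the invariant torus solve the variational equation. -/
lemma fderiv_variational {ω₀ : Fin d → ℝ} (hf : IsSmoothFamilyAlong f K₀)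
    (hsm : ContDiff ℝ (⊤ : ℕ∞) K₀) (hinv : ∀ θ, fderiv ℝ K₀ θ ω₀ = f 0 (K₀ θ) (K₀ θ))
    (θ h : Fin d → ℝ) :
    fderiv ℝ (fun θ => fderiv ℝ K₀ θ h) θ ω₀ = linMap f K₀ θ (fderiv ℝ K₀ θ h) := by
  have hD : DifferentiableAt ℝ (fderiv ℝ K₀) θ :=
    (hsm.fderiv_right (m := ((⊤ : ℕ∞) : WithTop ℕ∞)) (by simp)).differentiable (by simp) θ
  have hDa : ∀ v, HasFDerivAt (fun θ => fderiv ℝ K₀ θ v)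
      ((ContinuousLinearMap.apply ℝ (Fin n → ℝ) v).comp (fderiv ℝ (fderiv ℝ K₀) θ)) θ := fun v =>
    (ContinuousLinearMap.apply ℝ (Fin n → ℝ) v).hasFDerivAt.comp θ hD.hasFDerivAt
  have hsymm : IsSymmSndFDerivAt ℝ K₀ θ :=
    hsm.contDiffAt.isSymmSndFDerivAt
      (by rw [minSmoothness_of_isRCLikeNormedField]; exact WithTop.coe_le_coe.2 (le_top (a := (2 : ℕ∞))))
  rw [(hDa h).fderiv]
  simp only [ContinuousLinearMap.comp_apply, ContinuousLinearMap.apply_apply]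
  -- After the exchange of ω₀ and h, the identity is the derivative of the invariance equation in
  -- the direction h.
  rw [hsymm.eq ω₀ h]
  set F : ℝ × (Fin n → ℝ) × (Fin n → ℝ) → (Fin n → ℝ) := fun p => f p.1 p.2.1 p.2.2 with hF
  have hK : HasFDerivAt K₀ (fderiv ℝ K₀ θ) θ := (hsm.differentiable (by simp) θ).hasFDerivAt
  have h1 : HasFDerivAt (fun θ => f 0 (K₀ θ) (K₀ θ)) _ θ :=
    HasFDerivAt.comp θ (g := F) (f := fun θ => ((0 : ℝ), K₀ θ, K₀ θ))
      ((hf θ).differentiableAt (by simp)).hasFDerivAt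
      ((hasFDerivAt_const (0 : ℝ) _).prodMk (hK.prodMk hK))
  have h2 := hDa ω₀
  simp only [hinv] at h2
  have h3 := congrArg (fun L => L h) (h2.unique h1)
  simp only [ContinuousLinearMap.comp_apply, ContinuousLinearMap.apply_apply] at h3
  rw [h3, ← fderiv_diag_eq_linMap hf]
  simp

/-- A smooth real reducing transformation. -/
structure IsReducing (ω : Fin d → ℝ) (A : (Fin d → ℝ) → Matrix (Fin n) (Fin n) ℂ)
    (Λ : Matrix (Fin n) (Fin n) ℂ) (M : (Fin d → ℝ) → Matrix (Fin n) (Fin n) ℂ) : Prop where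
  periodic : IsZPeriodic M
  smooth : ∀ i j, ContDiff ℝ (⊤ : ℕ∞) fun θ => M θ i j
  det_ne_zero : ∀ θ, (M θ).det ≠ 0
  eq : ∀ θ, matDirDeriv ω M θ = A θ * M θ - M θ * Λ

lemma isReducing_of_units {ω : Fin d → ℝ} {A : (Fin d → ℝ) → Matrix (Fin n) (Fin n) ℂ}
    {Λ : Matrix (Fin n) (Fin n) ℂ} {M : (Fin d → ℝ) → Matrix.GeneralLinearGroup (Fin n) ℂ}
    (hper : IsZPeriodic M)
    (hsm : ∀ i j, ContDiff ℝ (⊤ : ℕ∞) fun θ => (M θ : Matrix (Fin n) (Fin n) ℂ) i j)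
    (h : ∀ θ, (M θ : Matrix (Fin n) (Fin n) ℂ)⁻¹ *
      (-matDirDeriv ω (fun θ' => (M θ' : Matrix (Fin n) (Fin n) ℂ)) θ +
        A θ * (M θ : Matrix (Fin n) (Fin n) ℂ)) = Λ) :
    IsReducing ω A Λ fun θ => (M θ : Matrix (Fin n) (Fin n) ℂ) := by
  have hu : ∀ θ, IsUnit (M θ : Matrix (Fin n) (Fin n) ℂ).det := fun θ =>
    (Matrix.isUnit_iff_isUnit_det _).1 (M θ).isUnit
  refine ⟨fun θ m => by simp only [hper θ m], hsm, fun θ => (hu θ).ne_zero, fun θ => ?_⟩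
  rw [← h θ, Matrix.mul_nonsing_inv_cancel_left _ _ (hu θ)]
  abel

lemma fderiv_mulVec {M : (Fin d → ℝ) → Matrix (Fin n) (Fin n) ℂ} {v : (Fin d → ℝ) → Fin n → ℂ}
    {θ : Fin d → ℝ} (hM : ∀ i j, DifferentiableAt ℝ (fun θ => M θ i j) θ)
    (hv : DifferentiableAt ℝ v θ) (ω : Fin d → ℝ) :
    fderiv ℝ (fun θ => (M θ).mulVec (v θ)) θ ω =
      (matDirDeriv ω M θ).mulVec (v θ) + (M θ).mulVec (fderiv ℝ v θ ω) := by
  have hvi : ∀ i, HasFDerivAt (fun θ => v θ i)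
      ((ContinuousLinearMap.proj i).comp (fderiv ℝ v θ)) θ := fun i =>
    hasFDerivAt_pi'.1 hv.hasFDerivAt i
  have h : ∀ i, HasFDerivAt (fun θ => (M θ).mulVec (v θ) i)
      (∑ j, (M θ i j • (ContinuousLinearMap.proj j).comp (fderiv ℝ v θ) +
        v θ j • fderiv ℝ (fun θ => M θ i j) θ)) θ := fun i => by
    simp only [Matrix.mulVec, dotProduct]
    exact HasFDerivAt.fun_sum fun j _ => (hM i j).hasFDerivAt.mul (hvi j)
  rw [(hasFDerivAt_pi.2 h).fderiv]
  funext i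
  simp only [ContinuousLinearMap.coe_pi', Pi.add_apply, Matrix.mulVec, dotProduct, matDirDeriv,
    Matrix.of_apply, sum_apply, add_apply, smul_apply, ContinuousLinearMap.comp_apply,
    ContinuousLinearMap.proj_apply, smul_eq_mul, Finset.sum_add_distrib]
  rw [add_comm]
  congr 1
  exact Finset.sum_congr rfl fun j _ => mul_comm _ _

/-- The complexification of the derivative of the embedding. -/
def embDeriv (K₀ : (Fin d → ℝ) → (Fin n → ℝ)) (θ : Fin d → ℝ) : (Fin d → ℂ) →ₗ[ℂ] (Fin n → ℂ) :=
  Fintype.linearCombination ℂ fun j => toC (fderiv ℝ K₀ θ (Pi.single j 1))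

lemma reC_embDeriv (θ : Fin d → ℝ) (w : Fin d → ℂ) :
    reC (embDeriv K₀ θ w) = fderiv ℝ K₀ θ (reC w) := by
  have h1 : reC w = ∑ j, (w j).re • (Pi.single j 1 : Fin d → ℝ) := by
    funext i
    simp [reC, Finset.sum_apply, Pi.single_apply]
  rw [h1, map_sum]
  funext i
  simp [reC, embDeriv, Fintype.linearCombination_apply, toC, Finset.sum_apply]

lemma embDeriv_injective (hK₀ : IsTorusEmbedding K₀) (θ : Fin d → ℝ) :
    Function.Injective (embDeriv K₀ θ) := by
  refine (injective_iff_map_eq_zero _).2 fun w hw => ?_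
  have h1 : ∀ w, embDeriv K₀ θ w = 0 → reC w = 0 := fun w hw => by
    have h := reC_embDeriv (K₀ := K₀) θ w
    rw [hw] at h
    have h2 : reC (0 : Fin n → ℂ) = 0 := by funext i; simp [reC]
    rw [h2] at h
    exact (injective_iff_map_eq_zero _).1 (hK₀.immersion θ) _ h.symm
  have h2 := h1 w hw
  -- The real part of −iw is the imaginary part of w.
  have h3 := h1 (-Complex.I • w) (by rw [map_smul, hw, smul_zero])
  funext j
  refine Complex.ext (congrFun h2 j) ?_
  simpa [reC] using congrFun h3 j

/-- In the reduced coordinates the derivative of the embedding is a constant injective map into the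
kernel of `Λ`. -/
lemma exists_const_frame {ω₀ : Fin d → ℝ} {Λ : Matrix (Fin n) (Fin n) ℂ}
    {M : (Fin d → ℝ) → Matrix (Fin n) (Fin n) ℂ} (hf : IsSmoothFamilyAlong f K₀)
    (hK₀ : IsTorusEmbedding K₀) (hinv : ∀ θ, fderiv ℝ K₀ θ ω₀ = f 0 (K₀ θ) (K₀ θ))
    (hM : IsReducing ω₀ (linMatrix f K₀) Λ M) (hnr : NonResonant ω₀ Λ) :
    ∃ P : (Fin d → ℂ) →ₗ[ℂ] (Fin n → ℂ), Function.Injective P ∧ (∀ w, Λ.mulVec (P w) = 0) ∧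
      ∀ θ w, (M θ).mulVec (P w) = embDeriv K₀ θ w := by
  have hu : ∀ θ, IsUnit (M θ).det := fun θ => (hM.det_ne_zero θ).isUnit
  have hMinv : ∀ i j, ContDiff ℝ (⊤ : ℕ∞) fun θ => (M θ)⁻¹ i j := fun i j => by
    rw [← contDiffOn_univ]
    exact contDiffOn_matrix_inv (fun i j => (hM.smooth i j).contDiffOn)
      (fun θ _ => hM.det_ne_zero θ) i j
  set q : Fin d → (Fin d → ℝ) → Fin n → ℂ := fun j θ => toC (fderiv ℝ K₀ θ (Pi.single j 1)) with hq
  set p : Fin d → (Fin d → ℝ) → Fin n → ℂ := fun j θ => (M θ)⁻¹.mulVec (q j θ) with hp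
  have hqs0 : ∀ j, ContDiff ℝ (⊤ : ℕ∞) fun θ => fderiv ℝ K₀ θ (Pi.single j 1) := fun j =>
    (hK₀.smooth.fderiv_right (m := ((⊤ : ℕ∞) : WithTop ℕ∞)) (by simp)).clm_apply contDiff_const
  have hqs : ∀ j, ContDiff ℝ (⊤ : ℕ∞) (q j) := fun j => (toCL n).contDiff.comp (hqs0 j)
  have hps : ∀ j, ContDiff ℝ (⊤ : ℕ∞) (p j) := fun j => by
    rw [← contDiffOn_univ]
    exact contDiffOn_mulVec (fun i j => (hMinv i j).contDiffOn) (hqs j).contDiffOn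
  have hpp : ∀ j, IsZPeriodic (p j) := fun j θ m => by
    simp only [hp, hq, hM.periodic θ m, hK₀.periodic.fderiv θ m]
  have hMp : ∀ j θ, (M θ).mulVec (p j θ) = q j θ := fun j θ => by
    simp only [hp, Matrix.mulVec_mulVec, Matrix.mul_nonsing_inv _ (hu θ), Matrix.one_mulVec]
  have hqd : ∀ j θ, fderiv ℝ (q j) θ ω₀ = (linMatrix f K₀ θ).mulVec (q j θ) := fun j θ => by
    have h1 : HasFDerivAt (q j) ((toCL n).comp
        (fderiv ℝ (fun θ => fderiv ℝ K₀ θ (Pi.single j 1)) θ)) θ :=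
      (toCL n).hasFDerivAt.comp θ ((hqs0 j).differentiable (by simp) θ).hasFDerivAt
    rw [h1.fderiv, ContinuousLinearMap.comp_apply, fderiv_variational hf hK₀.smooth hinv, toCL_apply]
    simp only [hq, linMatrix_mulVec_toC]
  -- Differentiate M p = q: the variational equation for q and the equation for M leave M(ω₀·∂p) =
  -- MΛp.
  have hpd : ∀ j θ, fderiv ℝ (p j) θ ω₀ = Λ.mulVec (p j θ) := fun j θ => by
    have h1 := fderiv_mulVec (fun i k => (hM.smooth i k).differentiable (by simp) θ)
      ((hps j).differentiable (by simp) θ) ω₀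
    have h2 : (fun θ => (M θ).mulVec (p j θ)) = q j := funext fun θ => hMp j θ
    rw [h2, hqd, ← hMp, hM.eq θ, Matrix.sub_mulVec, Matrix.mulVec_mulVec] at h1
    have h3 : (M θ).mulVec (fderiv ℝ (p j) θ ω₀) = (M θ).mulVec (Λ.mulVec (p j θ)) := by
      rw [Matrix.mulVec_mulVec]
      have := h1.symm
      rw [sub_add_eq_add_sub, sub_eq_iff_eq_add] at this
      exact add_left_cancel this
    exact Matrix.mulVec_injective_of_isUnit ((Matrix.isUnit_iff_isUnit_det _).2 (hu θ)) h3
  have hc := fun j => eq_const_of_homogeneous hnr (hpp j) ((hps j).of_le (by exact_mod_cast le_top))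
    (hpd j)
  set P : (Fin d → ℂ) →ₗ[ℂ] (Fin n → ℂ) :=
    Fintype.linearCombination ℂ fun j => torusAvg (p j) with hP
  have hMP : ∀ θ w, (M θ).mulVec (P w) = embDeriv K₀ θ w := fun θ w => by
    simp only [hP, embDeriv, Fintype.linearCombination_apply]
    rw [Matrix.mulVec_sum]
    refine Finset.sum_congr rfl fun j _ => ?_
    rw [Matrix.mulVec_smul, ← (hc j).1 θ, hMp]
  refine ⟨P, fun w w' hw => ?_, fun w => ?_, hMP⟩
  · exact embDeriv_injective hK₀ 0 (by rw [← hMP, ← hMP, hw])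
  · simp only [hP, Fintype.linearCombination_apply]
    rw [Matrix.mulVec_sum]
    exact Finset.sum_eq_zero fun j _ => by rw [Matrix.mulVec_smul, (hc j).2, smul_zero]

/-- Back to the original coordinates, and to real functions. -/
lemma linearized_of_reduced {ω₀ : Fin d → ℝ} {Λ : Matrix (Fin n) (Fin n) ℂ}
    {M : (Fin d → ℝ) → Matrix (Fin n) (Fin n) ℂ} (hf : IsSmoothFamilyAlong f K₀)
    (hM : IsReducing ω₀ (linMatrix f K₀) Λ M) {P : (Fin d → ℂ) →ₗ[ℂ] (Fin n → ℂ)}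
    (hMP : ∀ θ w, (M θ).mulVec (P w) = embDeriv K₀ θ w) {R : (Fin d → ℝ) → (Fin n → ℝ)}
    {w : Fin d → ℂ} {v : (Fin d → ℝ) → Fin n → ℂ} (hv : ContDiff ℝ (⊤ : ℕ∞) v)
    (hvp : IsZPeriodic v)
    (heq : ∀ θ, fderiv ℝ v θ ω₀ - Λ.mulVec (v θ) = (M θ)⁻¹.mulVec (-toC (R θ)) - P w) :
    IsZPeriodic (fun θ => reC ((M θ).mulVec (v θ))) ∧
    ContDiff ℝ (⊤ : ℕ∞) (fun θ => reC ((M θ).mulVec (v θ))) ∧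
    ∀ θ, fderiv ℝ (fun θ => reC ((M θ).mulVec (v θ))) θ ω₀ + fderiv ℝ K₀ θ (reC w) -
      fderiv ℝ (fun p : ℝ × (Fin n → ℝ) × (Fin n → ℝ) => f p.1 p.2.1 p.2.2)
        (0, K₀ θ, K₀ θ) (0, reC ((M θ).mulVec (v θ)), reC ((M θ).mulVec (v θ))) = -R θ := by
  have hu : ∀ θ, IsUnit (M θ).det := fun θ => (hM.det_ne_zero θ).isUnit
  have hMv : ContDiff ℝ (⊤ : ℕ∞) fun θ => (M θ).mulVec (v θ) := by
    rw [← contDiffOn_univ]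
    exact contDiffOn_mulVec (fun i j => (hM.smooth i j).contDiffOn) hv.contDiffOn
  refine ⟨fun θ m => by simp only [hM.periodic θ m, hvp θ m], (reCL n).contDiff.comp hMv,
    fun θ => ?_⟩
  rw [fderiv_diag_eq_linMap hf, ← reC_linMatrix_mulVec]
  have h1 : HasFDerivAt (fun θ => reC ((M θ).mulVec (v θ)))
      ((reCL n).comp (fderiv ℝ (fun θ => (M θ).mulVec (v θ)) θ)) θ :=
    (reCL n).hasFDerivAt.comp θ (hMv.differentiable (by simp) θ).hasFDerivAt
  rw [h1.fderiv, ContinuousLinearMap.comp_apply,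
    fderiv_mulVec (fun i k => (hM.smooth i k).differentiable (by simp) θ)
      (hv.differentiable (by simp) θ) ω₀, hM.eq θ,
    sub_eq_iff_eq_add.1 (heq θ), ← reC_embDeriv, ← hMP]
  -- In ω₀·∂(Mv) the two terms MΛv cancel. The remaining MPw is the complexified DK₀ applied to w,
  -- so the real part of w serves as frequency correction.
  have h2 : (linMatrix f K₀ θ * M θ - M θ * Λ).mulVec (v θ) +
      (M θ).mulVec ((M θ)⁻¹.mulVec (-toC (R θ)) - P w + Λ.mulVec (v θ)) =
      (linMatrix f K₀ θ).mulVec ((M θ).mulVec (v θ)) - toC (R θ) - (M θ).mulVec (P w) := by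
    rw [Matrix.mulVec_add, Matrix.mulVec_sub, Matrix.sub_mulVec, Matrix.mulVec_mulVec,
      Matrix.mul_nonsing_inv _ (hu θ), Matrix.one_mulVec, Matrix.mulVec_mulVec,
      Matrix.mulVec_mulVec]
    abel
  have h3 : reCL n (toC (R θ)) = R θ := reC_toC _
  rw [h2]
  simp only [← reCL_apply, map_sub, h3]
  abel

end Linearized

end DelayTorus
end

noncomputable section
namespace DelayTorus
open Asymptotics Filter MeasureTheory

variable {d n : ℕ}

/-! ### Functions that are analytic on a strip -/

/-- Periodicity on the strip comes for free from the identity theorem. -/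
lemma isStripExtension_of_real {ξ : ℝ} {u : (Fin d → ℝ) → (Fin n → ℝ)}
    {U : (Fin d → ℂ) → (Fin n → ℂ)} (hU : DifferentiableOn ℂ U (strip d ξ)) (hu : IsZPeriodic u)
    (h : ∀ θ, U (toC θ) = toC (u θ)) : IsStripExtension ξ u U := by
  refine ⟨hU, fun z hz m => ?_, h⟩
  have hs : Set.MapsTo (fun z : Fin d → ℂ => fun j => z j + (m j : ℂ)) (strip d ξ) (strip d ξ) :=
    fun z hz j => by simpa using hz j
  have h1 : DifferentiableOn ℂ (fun z => U fun j => z j + (m j : ℂ)) (strip d ξ) :=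
    hU.comp (f := fun z : Fin d → ℂ => fun j => z j + (m j : ℂ)) (by fun_prop) hs
  refine eqOn_strip_of_eq_real h1 hU (fun θ => ?_) hz
  rw [← toC_add_int, h, h, hu θ m]

lemma IsAnalyticOnStrip.mono {ξ ξ' : ℝ} (hle : ξ' ≤ ξ) {u : (Fin d → ℝ) → (Fin n → ℝ)}
    (h : IsAnalyticOnStrip ξ u) : IsAnalyticOnStrip ξ' u := by
  obtain ⟨U, hU⟩ := h
  have hsub : strip d ξ' ⊆ strip d ξ := fun z hz j => (hz j).trans_le hle
  exact ⟨U, hU.holomorphic.mono hsub, fun z hz m => hU.periodic z (hsub hz) m, hU.extends_real⟩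

lemma star_toC {m : ℕ} (x : Fin m → ℝ) : star (toC x) = toC x := by
  funext i
  simp [toC]

/-- The real part of a function that is analytic on a strip is again analytic there. -/
lemma isAnalyticOnStrip_reC {ξ : ℝ} {W : (Fin d → ℂ) → (Fin n → ℂ)}
    (hW : DifferentiableOn ℂ W (strip d ξ)) (hper : IsZPeriodic fun θ => W (toC θ)) :
    IsAnalyticOnStrip ξ fun θ => reC (W (toC θ)) := by
  -- By Schwarz reflection the conjugate of W at the conjugate point is holomorphic; its mean with W
  -- equals the real part at real points.
  have hstar : DifferentiableOn ℂ (star ∘ W ∘ star) (strip d ξ) := by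
    intro z hz
    have hz' : star z ∈ strip d ξ := fun j => by simpa using hz j
    have h := (hW.differentiableAt ((isOpen_strip d ξ).mem_nhds hz')).star_star
    rw [star_star] at h
    exact h.differentiableWithinAt
  refine ⟨fun z => (2 : ℂ)⁻¹ • (W z + (star ∘ W ∘ star) z), isStripExtension_of_real
    ((hW.add hstar).const_smul (2 : ℂ)⁻¹) (fun θ m => congrArg reC (hper θ m)) fun θ => ?_⟩
  funext i
  simp only [Function.comp_apply, star_toC, Pi.smul_apply, Pi.add_apply, Pi.star_apply, smul_eq_mul,
    RCLike.star_def, Complex.add_conj, toC, reC]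
  push_cast
  ring

lemma fderiv_toC_of_real {U : (Fin d → ℂ) → (Fin n → ℂ)} {u : (Fin d → ℝ) → (Fin n → ℝ)}
    {θ : Fin d → ℝ} (hU : DifferentiableAt ℂ U (toC θ)) (hu : DifferentiableAt ℝ u θ)
    (h : ∀ x, U (toC x) = toC (u x)) (v : Fin d → ℝ) :
    fderiv ℂ U (toC θ) (toC v) = toC (fderiv ℝ u θ v) := by
  have h1 : HasFDerivAt (fun x => U (toC x)) _ θ :=
    HasFDerivAt.comp θ (f := toCL d) (hU.hasFDerivAt.restrictScalars ℝ) (toCL d).hasFDerivAt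
  have h2 : HasFDerivAt (fun x => toC (u x)) _ θ := (toCL n).hasFDerivAt.comp θ hu.hasFDerivAt
  simp only [h] at h1
  exact congrArg (fun L => L v) (h1.unique h2)

/-! ### The coefficients of the defect -/

section Coefficients

variable {f : ℝ → (Fin n → ℝ) → (Fin n → ℝ) → (Fin n → ℝ)} {r : (Fin n → ℝ) → ℝ}
  {K₀ : (Fin d → ℝ) → (Fin n → ℝ)}

lemma toC_partialSum {m : ℕ} (a : ℕ → Fin m → ℝ) (N : ℕ) (ε : ℝ) :
    partialSum (fun j => toC (a j)) N (ε : ℂ) = toC (partialSum a N ε) := by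
  funext i
  simp [partialSum, toC, Finset.sum_apply]

/-- The Taylor polynomial in `ε` of a complexified family. -/
def taylorFamily (F : ℕ → (Fin n → ℂ) × (Fin n → ℂ) → (Fin n → ℂ)) (N : ℕ) (ε : ℂ)
    (x y : Fin n → ℂ) : Fin n → ℂ :=
  ∑ j ∈ Finset.range N, ε ^ j • ((j.factorial : ℂ)⁻¹ • F j (x, y))

lemma contDiffAt_taylorFamily {F : ℕ → (Fin n → ℂ) × (Fin n → ℂ) → (Fin n → ℂ)} (N : ℕ)
    {p : ℂ × (Fin n → ℂ) × (Fin n → ℂ)} (hF : ∀ j, AnalyticAt ℂ (F j) p.2) :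
    ContDiffAt ℂ (⊤ : ℕ∞) (fun p : ℂ × (Fin n → ℂ) × (Fin n → ℂ) =>
      taylorFamily F N p.1 p.2.1 p.2.2) p := by
  unfold taylorFamily
  refine ContDiffAt.sum fun j _ => ContDiffAt.fun_smul (contDiffAt_fst.pow j)
    (ContDiffAt.fun_smul contDiffAt_const ?_)
  exact ContDiffAt.comp p (g := F j) (hF j).contDiffAt contDiffAt_snd

/-- On real points, the complexified defect agrees with the defect to high order. -/
lemma resid_complexified_isBigO {F : ℕ → (Fin n → ℂ) × (Fin n → ℂ) → (Fin n → ℂ)}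
    {rC : (Fin n → ℂ) → ℂ} {ω : ℕ → Fin d → ℝ} {K : ℕ → (Fin d → ℝ) → (Fin n → ℝ)}
    {KC : ℕ → (Fin d → ℂ) → (Fin n → ℂ)} {N : ℕ} {θ : Fin d → ℝ}
    (hf : ContDiffAt ℝ (⊤ : ℕ∞) (fun p : ℝ × (Fin n → ℝ) × (Fin n → ℝ) => f p.1 p.2.1 p.2.2)
      (0, K 0 θ, K 0 θ))
    (hr : ContDiffAt ℝ (⊤ : ℕ∞) r (K 0 θ)) (hK : ∀ j, ContDiff ℝ (⊤ : ℕ∞) (K j))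
    (hKC : ∀ j, DifferentiableAt ℂ (KC j) (toC θ)) (hext : ∀ j x, KC j (toC x) = toC (K j x))
    (hF : ∀ j, ∀ᶠ p : (Fin n → ℝ) × (Fin n → ℝ) in 𝓝 (K 0 θ, K 0 θ),
      F j (toC p.1, toC p.2) = toC (iteratedDeriv j (fun ε => f ε p.1 p.2) 0))
    (hrC : ∀ᶠ x : Fin n → ℝ in 𝓝 (K 0 θ), rC (toC x) = (r x : ℂ)) (m : ℕ) :
    (fun ε : ℝ => resid (taylorFamily F m) rC (fun j => toC (ω j)) KC N ((ε : ℂ), toC θ) -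
      toC (resid f r ω K N (ε, θ))) =O[𝓝 0] fun ε => ε ^ m := by
  have hP : ∀ (ε : ℝ) x, partialSumFun KC N ((ε : ℂ), toC x) = toC (partialSumFun K N (ε, x)) :=
    fun ε x => by
      have := toC_partialSum (fun j => K j x) N ε
      simp only [← hext] at this
      exact this
  have hD : ∀ ε : ℝ, fderiv ℂ (fun z => partialSumFun KC N ((ε : ℂ), z)) (toC θ)
      (partialSum (fun j => toC (ω j)) N (ε : ℂ)) =
      toC (fderiv ℝ (fun x => partialSumFun K N (ε, x)) θ (partialSum ω N ε)) := fun ε => by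
    rw [toC_partialSum]
    refine fderiv_toC_of_real ?_ ?_ (hP ε) _
    · unfold partialSumFun
      exact DifferentiableAt.fun_sum fun j _ => (hKC j).fun_const_smul ((ε : ℂ) ^ j)
    · unfold partialSumFun
      exact DifferentiableAt.fun_sum fun j _ => ((hK j).differentiable (by simp) θ).fun_const_smul (ε ^ j)
  set a : ℝ → Fin n → ℝ := fun ε => partialSumFun K N (ε, θ) with ha
  set b : ℝ → Fin n → ℝ := fun ε =>
    partialSumFun K N (ε, θ - (ε * r (a ε)) • partialSum ω N ε) with hb
  have hcK : ContinuousAt (partialSumFun K N) ((0 : ℝ), θ) :=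
    (contDiffAt_partialSumFun (m := 0) N fun j => (hK j).contDiffAt.of_le (by simp)).continuousAt
  have hat : Tendsto a (𝓝 0) (𝓝 (K 0 θ)) := by
    have h := hcK.tendsto.comp (tendsto_id.prodMk_nhds (tendsto_const_nhds (x := θ)))
    rw [partialSumFun_zero] at h
    exact h
  have hbt : Tendsto b (𝓝 0) (𝓝 (K 0 θ)) := by
    have h1 : Tendsto (fun ε : ℝ => θ - (ε * r (a ε)) • partialSum ω N ε) (𝓝 0) (𝓝 θ) := by
      have h2 := (tendsto_id (x := 𝓝 (0 : ℝ))).mul (hr.continuousAt.tendsto.comp hat)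
      have h3 : Tendsto (partialSum ω N) (𝓝 (0 : ℝ)) _ :=
        (contDiffAt_partialSum (m := 0) ω N (0 : ℝ)).continuousAt.tendsto
      have h4 := (tendsto_const_nhds (x := θ)).sub (h2.smul h3)
      simpa using! h4
    have h := hcK.tendsto.comp (tendsto_id.prodMk_nhds h1)
    rw [partialSumFun_zero] at h
    exact h
  have hT : (fun ε => f ε (a ε) (b ε) - ∑ j ∈ Finset.range m, ε ^ j •
      taylorCoeff (fun p : ℝ × (Fin n → ℝ) × (Fin n → ℝ) => f p.1 p.2.1 p.2.2) j (a ε, b ε))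
      =O[𝓝 0] fun ε => ε ^ m :=
    (taylor_isBigO m hf).comp_tendsto (tendsto_id.prodMk_nhds (hat.prodMk_nhds hbt))
  -- The derivative terms and the delayed arguments agree exactly on real points; the two defects
  -- differ only by the Taylor remainder of f in ε.
  refine IsBigO.trans (IsBigO.of_bound' ?_) hT
  have hFe : ∀ᶠ p : (Fin n → ℝ) × (Fin n → ℝ) in 𝓝 (K 0 θ, K 0 θ), ∀ j ∈ Finset.range m,
      F j (toC p.1, toC p.2) = toC (iteratedDeriv j (fun ε => f ε p.1 p.2) 0) := by
    rw [Finset.eventually_all]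
    exact fun j _ => hF j
  filter_upwards [hat.eventually hrC, (hat.prodMk_nhds hbt).eventually hFe] with ε h1 h2
  have h3 : resid (taylorFamily F m) rC (fun j => toC (ω j)) KC N ((ε : ℂ), toC θ) =
      toC (fderiv ℝ (fun x => partialSumFun K N (ε, x)) θ (partialSum ω N ε)) -
        taylorFamily F m ε (toC (a ε)) (toC (b ε)) := by
    simp only [resid]
    rw [hD, hP, h1, toC_partialSum]
    have h4 : toC θ - ((ε : ℂ) * (r (a ε) : ℂ)) • toC (partialSum ω N ε) =
        toC (θ - (ε * r (a ε)) • partialSum ω N ε) := by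
      funext i
      simp [toC]
    rw [h4, hP]
  have h5 : taylorFamily F m ε (toC (a ε)) (toC (b ε)) = toC (∑ j ∈ Finset.range m,
      ε ^ j • taylorCoeff (fun p : ℝ × (Fin n → ℝ) × (Fin n → ℝ) => f p.1 p.2.1 p.2.2) j
        (a ε, b ε)) := by
    rw [← toCL_apply (∑ j ∈ _, _), map_sum, taylorFamily]
    refine Finset.sum_congr rfl fun j hj => ?_
    rw [h2 j hj]
    funext i
    simp [toCL_apply, toC, taylorCoeff]
  have h6 : resid f r ω K N (ε, θ) = fderiv ℝ (fun x => partialSumFun K N (ε, x)) θ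
      (partialSum ω N ε) - f ε (a ε) (b ε) := rfl
  rw [h3, h5, h6, ← toCL_apply, ← toCL_apply, ← toCL_apply, ← map_sub, ← map_sub, toCL_apply,
    norm_toC, sub_sub_sub_cancel_left]

/-- The coefficients of the defect of an analytic series are analytic. -/
lemma isAnalyticOnStrip_taylorCoeff_resid {ξ : ℝ} (hξ : 0 < ξ) (hf : IsSmoothFamilyAlong f K₀)
    (hr : ∀ θ, ContDiffAt ℝ (⊤ : ℕ∞) r (K₀ θ)) {K₀C : (Fin d → ℂ) → (Fin n → ℂ)}
    (hK₀C : IsStripExtension ξ K₀ K₀C) (hfa : IsAnalyticFamilyAlong ξ f K₀ K₀C)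
    (hra : IsAnalyticDelayAlong ξ r K₀ K₀C) (ω : ℕ → Fin d → ℝ)
    {K : ℕ → (Fin d → ℝ) → (Fin n → ℝ)} (N : ℕ) (hK0 : K 0 = K₀) (hper : ∀ j, IsZPeriodic (K j))
    (hsm : ∀ j, ContDiff ℝ (⊤ : ℕ∞) (K j)) (hK : ∀ j, IsAnalyticOnStrip ξ (K j)) (i : ℕ) :
    IsAnalyticOnStrip ξ (taylorCoeff (resid f r ω K N) i) := by
  subst hK0
  choose KC hKC using hK
  choose F hFa hFr using hfa
  obtain ⟨rC, hrCa, hrCr⟩ := hra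
  -- The chosen extension must coincide with the given one, along which f and r are known to be
  -- analytic.
  have hKC0 : Set.EqOn (KC 0) K₀C (strip d ξ) :=
    eqOn_strip_of_eq_real (hKC 0).holomorphic hK₀C.holomorphic fun θ => by
      rw [(hKC 0).extends_real, hK₀C.extends_real]
  have hKCs : ∀ j, ∀ z ∈ strip d ξ, ContDiffAt ℂ (⊤ : ℕ∞) (KC j) z := fun j z hz =>
    (contDiffOn_of_differentiableOn (isOpen_strip d ξ) (hKC j).holomorphic).contDiffAt
      ((isOpen_strip d ξ).mem_nhds hz)
  -- The coefficient of order i involves the ε-coefficients of f up to order i only, hence the i + 1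
  -- terms. This defect is holomorphic in ε even if f is not analytic in ε.
  set H : ℂ × (Fin d → ℂ) → (Fin n → ℂ) :=
    resid (taylorFamily F (i + 1)) rC (fun j => toC (ω j)) KC N with hH
  have hHs : ∀ z ∈ strip d ξ, ContDiffAt ℂ (⊤ : ℕ∞) H (0, z) := fun z hz => by
    refine contDiffAt_resid N (fun j => hKCs j z hz) (contDiffAt_taylorFamily _ fun j => ?_) ?_
    · exact hFa j _ ⟨z, hz, by rw [hKC0 hz]⟩
    · exact (hrCa _ ⟨z, hz, by rw [hKC0 hz]⟩).contDiffAt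
  have hreal : ∀ θ, taylorCoeff H i (toC θ) = toC (taylorCoeff (resid f r ω K N) i θ) := by
    intro θ
    have hθ := toC_mem_strip hξ θ
    have hR : ContDiffAt ℝ (⊤ : ℕ∞) (resid f r ω K N) (0, θ) :=
      contDiffAt_resid N (fun j => (hsm j).contDiffAt) (hf θ) (hr θ)
    have h1 := (taylor_isBigO (i + 1) hR).comp_tendsto
      (tendsto_id.prodMk_nhds (tendsto_const_nhds (x := θ)))
    have h2 := (taylor_isBigO (i + 1) (hHs _ hθ)).comp_tendsto
      ((Complex.continuous_ofReal.tendsto' 0 0 (by simp)).prodMk_nhds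
        (tendsto_const_nhds (x := toC θ)))
    have h3 := resid_complexified_isBigO (ω := ω) (N := N) (hf θ) (hr θ) hsm
      (fun j => (hKCs j _ hθ).differentiableAt (by simp)) (fun j => (hKC j).extends_real)
      (fun j => hFr j θ) (hrCr θ) (i + 1)
    have h1' := ((toCL n).isBigO_comp _ _).trans h1
    have h2' : (fun ε : ℝ => H ((ε : ℂ), toC θ) - ∑ j ∈ Finset.range (i + 1),
        (ε : ℂ) ^ j • taylorCoeff H j (toC θ)) =O[𝓝 0] fun ε : ℝ => ε ^ (i + 1) := by
      refine h2.trans (isBigO_of_le _ fun ε => ?_)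
      simp
    have h4 := (h3.sub h2').add h1'
    -- For real ε the two expansions differ by O(ε^{i+1}), so their coefficients up to order i
    -- agree.
    refine sub_eq_zero.1 (coeff_eq_zero_of_isLittleO (fun j => taylorCoeff H j (toC θ) -
      toC (taylorCoeff (resid f r ω K N) j θ)) i ?_ i le_rfl)
    refine (h4.trans_isLittleO (isLittleO_pow_pow (Nat.lt_succ_self i))).congr_left fun ε => ?_
    have h5 : toCL n (resid f r ω K N (ε, θ)) = toC (resid f r ω K N (ε, θ)) := rfl
    simp only [Function.comp_def, map_sub, map_sum, map_smul, smul_sub, Finset.sum_sub_distrib,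
      ← Complex.ofReal_pow, Complex.coe_smul, id, toCL_apply]
    abel
  refine ⟨taylorCoeff H i, isStripExtension_of_real (fun z hz =>
    ((contDiffAt_taylorCoeff i (hHs z hz)).differentiableAt (by simp)).differentiableWithinAt)
    (fun θ m => ?_) hreal⟩
  simp only [taylorCoeff]
  congr 2
  funext ε
  exact resid_periodic hper N ε θ m

end Coefficients

end DelayTorus
end

noncomputable section
namespace DelayTorus
open Asymptotics Filter MeasureTheory

variable {d n : ℕ}

/-! ### Solution of the linearized equation -/

section Solve

variable {f : ℝ → (Fin n → ℝ) → (Fin n → ℝ) → (Fin n → ℝ)} {r : (Fin n → ℝ) → ℝ}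
  {ω₀ : Fin d → ℝ} {K₀ : (Fin d → ℝ) → (Fin n → ℝ)} {Λ : Matrix (Fin n) (Fin n) ℂ}

lemma torusAvg_sub_const {g : (Fin d → ℝ) → Fin n → ℂ} (hg : Continuous g) (c : Fin n → ℂ) :
    torusAvg (fun θ => g θ - c) = torusAvg g - c := by
  rw [torusAvg, integral_sub (integrableOn_unitCube hg) (integrableOn_unitCube continuous_const)]
  simp [torusAvg, Measure.real, volume_unitCube]

lemma IsReducing.contDiff_inv_mulVec {A : (Fin d → ℝ) → Matrix (Fin n) (Fin n) ℂ}
    {M : (Fin d → ℝ) → Matrix (Fin n) (Fin n) ℂ} (hM : IsReducing ω₀ A Λ M)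
    {v : (Fin d → ℝ) → Fin n → ℂ} (hv : ContDiff ℝ (⊤ : ℕ∞) v) :
    ContDiff ℝ (⊤ : ℕ∞) fun θ => (M θ)⁻¹.mulVec (v θ) := by
  rw [← contDiffOn_univ]
  exact contDiffOn_mulVec (contDiffOn_matrix_inv (fun i j => (hM.smooth i j).contDiffOn)
    fun θ _ => hM.det_ne_zero θ) hv.contDiffOn

theorem exists_lindstedt_smooth (hf : IsSmoothFamilyAlong f K₀)
    (hr : ∀ θ, ContDiffAt ℝ (⊤ : ℕ∞) r (K₀ θ)) (hK₀ : IsTorusEmbedding K₀)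
    (hinv : ∀ θ, fderiv ℝ K₀ θ ω₀ = f 0 (K₀ θ) (K₀ θ)) (hzero : Λ.charpoly.rootMultiplicity 0 = d)
    (hred : IsReducibleSmooth ω₀ (linMatrix f K₀) Λ) (hω : IsDiophantine ω₀)
    (hΛ : ∀ μ ∈ spectrum ℂ Λ, μ ≠ 0 → IsDiophantineWrt ω₀ μ) :
    ∃ (ω : ℕ → Fin d → ℝ) (K : ℕ → (Fin d → ℝ) → (Fin n → ℝ)),
      IsLindstedtSeries f r ω₀ K₀ ω K := by
  obtain ⟨Mu, hMper, hMsm, hMeq⟩ := hred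
  have hM := isReducing_of_units hMper hMsm hMeq
  set M : (Fin d → ℝ) → Matrix (Fin n) (Fin n) ℂ := fun θ => (Mu θ : Matrix (Fin n) (Fin n) ℂ)
  have hnr : NonResonant ω₀ Λ := fun k hk μ hμ => by
    by_cases h0 : μ = 0
    · rw [h0]; exact hω.divisor_ne_zero hk
    · exact (hΛ μ hμ h0).divisor_ne_zero hk
  obtain ⟨P, hP, hΛP, hMP⟩ := exists_const_frame hf hK₀ hinv hM hnr
  obtain ⟨ω, K, hωK, -⟩ := exists_lindstedt (fun _ => True) hf hr hK₀.periodic hK₀.smooth trivial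
    hinv (fun _ _ _ _ _ _ _ => trivial) fun R hRp hRs _ => by
      have hgs : ContDiff ℝ (⊤ : ℕ∞) fun θ => (M θ)⁻¹.mulVec (-toC (R θ)) :=
        hM.contDiff_inv_mulVec ((toCL n).contDiff.comp hRs).neg
      obtain ⟨w, v₀, hv₀⟩ := exists_neg_mulVec_eq hzero P hP hΛP
        -- The frequency correction w is fixed here, by solvability at the Fourier index 0.
        (torusAvg fun θ => (M θ)⁻¹.mulVec (-toC (R θ)))
      rw [← torusAvg_sub_const hgs.continuous] at hv₀
      obtain ⟨v, hvp, hvs, hv⟩ := exists_smooth_solution hω hΛ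
        (fun θ m => by rw [hM.periodic θ m, hRp θ m]) (hgs.sub contDiff_const) hv₀
      obtain ⟨h1, h2, h3⟩ := linearized_of_reduced hf hM hMP hvs hvp hv
      exact ⟨_, _, h1, h2, trivial, h3⟩
  exact ⟨ω, K, hωK⟩

theorem exists_lindstedt_analytic {ξ : ℝ} (hξ : 0 < ξ) {K₀C : (Fin d → ℂ) → (Fin n → ℂ)}
    (hf : IsSmoothFamilyAlong f K₀) (hr : ∀ θ, ContDiffAt ℝ (⊤ : ℕ∞) r (K₀ θ))
    (hK₀ : IsTorusEmbedding K₀) (hinv : ∀ θ, fderiv ℝ K₀ θ ω₀ = f 0 (K₀ θ) (K₀ θ))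
    (hzero : Λ.charpoly.rootMultiplicity 0 = d) (hK₀C : IsStripExtension ξ K₀ K₀C)
    (hfa : IsAnalyticFamilyAlong ξ f K₀ K₀C) (hra : IsAnalyticDelayAlong ξ r K₀ K₀C)
    (hred : IsReducibleOnStrip ξ ω₀ (linMatrix f K₀) Λ) (hω : IsSubexpDiophantine ω₀)
    (hΛ : ∀ μ ∈ spectrum ℂ Λ, μ ≠ 0 → IsSubexpDiophantineWrt ω₀ μ) :
    ∃ (ω : ℕ → Fin d → ℝ) (K : ℕ → (Fin d → ℝ) → (Fin n → ℝ)),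
      IsLindstedtSeries f r ω₀ K₀ ω K ∧ ∀ j, IsAnalyticOnStrip ξ (K j) := by
  obtain ⟨Mu, hMper, hMd, hMeq⟩ := hred
  have hM := isReducing_of_units (M := fun θ => Mu (toC θ))
    (fun θ m => by simp only [toC_add_int, hMper _ (toC_mem_strip hξ θ)])
    (fun i j => contDiff_comp_toC hξ (hMd i j)) hMeq
  set M : (Fin d → ℂ) → Matrix (Fin n) (Fin n) ℂ := fun z => (Mu z : Matrix (Fin n) (Fin n) ℂ)
  have hdet : ∀ z ∈ strip d ξ, (M z).det ≠ 0 := fun z _ =>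
    ((Matrix.isUnit_iff_isUnit_det _).1 (Mu z).isUnit).ne_zero
  have hMs : ∀ i j, ContDiffOn ℂ (⊤ : ℕ∞) (fun z => M z i j) (strip d ξ) := fun i j =>
    contDiffOn_of_differentiableOn (isOpen_strip d ξ) (hMd i j)
  have hMp : ∀ θ (m : Fin d → ℤ), M (toC fun j => θ j + (m j : ℝ)) = M (toC θ) := hM.periodic
  have hnr : NonResonant ω₀ Λ := fun k hk μ hμ => by
    by_cases h0 : μ = 0
    · rw [h0]; exact hω.divisor_ne_zero hk
    · exact (hΛ μ hμ h0).1 k hk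
  obtain ⟨P, hP, hΛP, hMP⟩ := exists_const_frame hf hK₀ hinv hM hnr
  -- Analyticity on the full strip of width ξ is itself a class stable under the recursion.
  refine exists_lindstedt (IsAnalyticOnStrip ξ) hf hr hK₀.periodic hK₀.smooth ⟨K₀C, hK₀C⟩ hinv
    (fun ω K N hK0 hKp hKs hKa => isAnalyticOnStrip_taylorCoeff_resid hξ hf hr hK₀C hfa hra ω N hK0
      hKp hKs hKa _) fun R hRp hRs ⟨RC, hRC⟩ => ?_
  have hgs : ContDiff ℝ (⊤ : ℕ∞) fun θ => (M (toC θ))⁻¹.mulVec (-toC (R θ)) :=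
    hM.contDiff_inv_mulVec ((toCL n).contDiff.comp hRs).neg
  obtain ⟨w, v₀, hv₀⟩ := exists_neg_mulVec_eq hzero P hP hΛP
    (torusAvg fun θ => (M (toC θ))⁻¹.mulVec (-toC (R θ)))
  rw [← torusAvg_sub_const hgs.continuous] at hv₀
  have hG : DifferentiableOn ℂ (fun z => (M z)⁻¹.mulVec (-RC z) - P w) (strip d ξ) :=
    ((contDiffOn_mulVec (contDiffOn_matrix_inv hMs hdet)
      (contDiffOn_of_differentiableOn (isOpen_strip d ξ) hRC.holomorphic).neg).sub
      contDiffOn_const).differentiableOn (by simp)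
  obtain ⟨V, hVd, hVp, hV⟩ := exists_analytic_solution hξ hω hΛ hG
    (fun θ m => by simp only [hRC.extends_real, hRp θ m, hMp θ m])
    (by simpa only [hRC.extends_real] using hv₀)
  simp only [hRC.extends_real] at hV
  obtain ⟨h1, h2, h3⟩ := linearized_of_reduced hf hM hMP (contDiff_comp_toC hξ hVd) hVp hV
  refine ⟨_, _, h1, h2, isAnalyticOnStrip_reC (W := fun z => (M z).mulVec (V z)) ?_ ?_, h3⟩
  · exact (contDiffOn_mulVec hMs (contDiffOn_of_differentiableOn (isOpen_strip d ξ)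
      hVd)).differentiableOn (by simp)
  · intro θ m
    have h4 : V (toC fun j => θ j + (m j : ℝ)) = V (toC θ) := hVp θ m
    simp only [hMp θ m, h4]

end Solve

end DelayTorus
end

theorem mainTheorem2 {d n : ℕ}
    (f : ℝ → (Fin n → ℝ) → (Fin n → ℝ) → (Fin n → ℝ)) (r : (Fin n → ℝ) → ℝ)
    (ω₀ : Fin d → ℝ) (K₀ : (Fin d → ℝ) → (Fin n → ℝ)) (Λ : Matrix (Fin n) (Fin n) ℂ)
    (hf : DelayTorus.IsSmoothFamilyAlong f K₀)
    (hr : ∀ θ, ContDiffAt ℝ (⊤ : ℕ∞) r (K₀ θ))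
    (hK₀ : DelayTorus.IsTorusEmbedding K₀)
    (hinv : ∀ θ, fderiv ℝ K₀ θ ω₀ = f 0 (K₀ θ) (K₀ θ))
    (hzero : Λ.charpoly.rootMultiplicity 0 = d) :
    -- the analytic case
    (∀ (ξ : ℝ) (K₀C : (Fin d → ℂ) → (Fin n → ℂ)), 0 < ξ →
      DelayTorus.IsStripExtension ξ K₀ K₀C →
      DelayTorus.IsAnalyticFamilyAlong ξ f K₀ K₀C →
      DelayTorus.IsAnalyticDelayAlong ξ r K₀ K₀C →
      DelayTorus.IsReducibleOnStrip ξ ω₀ (DelayTorus.linMatrix f K₀) Λ →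
      DelayTorus.IsSubexpDiophantine ω₀ →
      (∀ μ ∈ spectrum ℂ Λ, μ ≠ 0 → DelayTorus.IsSubexpDiophantineWrt ω₀ μ) →
      ∃ (ω : ℕ → Fin d → ℝ) (K : ℕ → (Fin d → ℝ) → (Fin n → ℝ)),
        DelayTorus.IsLindstedtSeries f r ω₀ K₀ ω K ∧
        ∀ (j : ℕ) (ξ' : ℝ), 0 < ξ' → ξ' < ξ → DelayTorus.IsAnalyticOnStrip ξ' (K j)) ∧
    -- the smooth case
    (DelayTorus.IsReducibleSmooth ω₀ (DelayTorus.linMatrix f K₀) Λ →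
      DelayTorus.IsDiophantine ω₀ →
      (∀ μ ∈ spectrum ℂ Λ, μ ≠ 0 → DelayTorus.IsDiophantineWrt ω₀ μ) →
      ∃ (ω : ℕ → Fin d → ℝ) (K : ℕ → (Fin d → ℝ) → (Fin n → ℝ)),
        DelayTorus.IsLindstedtSeries f r ω₀ K₀ ω K) := by
  refine ⟨fun ξ K₀C hξ hK₀C hfa hra hred hω hΛ => ?_, fun hred hω hΛ =>
    DelayTorus.exists_lindstedt_smooth hf hr hK₀ hinv hzero hred hω hΛ⟩
  obtain ⟨ω, K, hωK, hK⟩ := DelayTorus.exists_lindstedt_analytic hξ hf hr hK₀ hinv hzero hK₀C hfa hra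
    hred hω hΛ
  exact ⟨ω, K, hωK, fun j ξ' _ hlt => (hK j).mono hlt.le⟩
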